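/- **Setting.** $\mathrm{Sym}_0(3)$ is the space of symmetric trace-free real $3\times3$ matrices with norm $|A|=\sqrt{\mathrm{tr}(A^2)}$, $H=L^2(\mathbb R^3;\mathrm{Sym}_0(3))\cap L^6(\mathbb R^3;\mathrm{Sym}_0(3))$ with norm $\max\{\|Q\|_2,\|Q\|_6\}$, $\Phi_1(x,t)=(4\pi(t+1))^{-3/2}e^{-|x|^2/4(t+1)}$, and $\mathcal D=\{(a,b,c)\in(0,\infty)^3: b^2>27ac\}$. For $Q_0\in H$ let $S(t)Q_0=Q(\cdot,t)$, where $Q\in C([0,\infty);H)$ has $Q(\cdot,0)=Q_0$ and is a smooth classical solution on $\mathbb R^3\times(0,\infty)$ of $$\partial_tQ=\Delta Q-aQ+b\left(Q^2-\tfrac13\mathrm{tr}(Q^2)I\right)-c\,\mathrm{tr}(Q^2)Q .$$ For $\delta>0$ let $\|R\|_{\mathcal A}=\operatorname{ess\,sup}_x(1+|x|)^{8+\delta}|R(x)|$ and let $X_0$ be the set of continuous $V:\mathbb R^3\times(0,\infty)\to\mathrm{Sym}_0(3)$ such that $\left(1+\frac{|x|}{\sqrt{t+1}}\right)^{4+\delta/2}(t+1)^2|V(x,t)|$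 is bounded. For $\eta>0$ let $\mathcal A^\circ=\{R\in L^\infty(\mathbb R^3;\mathrm{Sym}_0(3)):\|R\|_{\mathcal A}<\eta\}$, a subset of $H$. **Theorem.** Let $\delta>0$ and $(a,b,c)\in\mathcal D$. There is $\eta>0$, depending only on $\delta$ and $(a,b,c)$, such that the following hold. 1. For each $Q_0\in\mathcal A^\circ$ the solution $S(t)Q_0$ exists for all $t\ge 0$ and is unique, and there is exactly one matrix $A\in\mathrm{Sym}_0(3)$ (the coefficient matrix of $Q_0$) such that, for some $V\in X_0$, $S(t)Q_0=Ae^{-at}\Phi_1(\cdot,t)+e^{-at}V(\cdot,t)$ for all $t>0$. 2. Let $\mathcal B$ be the set of $Q_0\in\mathcal A^\circ$ whose coefficient matrix is $0$. Then $\mathcal A^\circ\setminus\mathcal B$ is open and dense in $\mathcal A^\circ$ for the norm $\|\cdot\|_{\mathcal A}$. 3. Let $\mu_0$ be any Borel probability measure on $H$ carried by $\mathcal A^\circ\setminus\mathcal B$ (its complement is $\mu_0$-null), let $\mu_t$ be the image of $\mu_0$ under $S(t)$, and let $$c_{\mu_0}(r,t)=\frac{\int_H\int_{\mathbb R^3}\mathrm{tr}(Q(x+r)Q(x))\,dx\,d\mu_t(Q)}{\int_H\int_{\mathbb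 R^3}\mathrm{tr}(Q(x)^2)\,dx\,d\mu_t(Q)} .$$ For all $t\ge0$, $S(t)$ is $\mu_0$-measurable and the integrals over $H$ converge absolutely; the denominator is positive for all large $t$; and $$\left\|c_{\mu_0}(r,t)-e^{-|r|^2/8t}\right\|_{L^\infty(\mathbb R^3,\,dr)}=\mathcal O(t^{-1/2})\quad\text{as } t\to\infty .$$ -/

import Mathlib

open MeasureTheory Set Filter Topology
open scoped ENNReal ContDiff

noncomputable section

namespace QTensor

/-- Physical space `ℝ³` with its Euclidean norm. -/
abbrev E3 : Type := EuclideanSpace ℝ (Fin 3)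

/-- `Sym₀(3)`: the symmetric, trace-free real `3 × 3` matrices, inside the space of all `3 × 3` arrays
with the Euclidean norm of the nine entries. -/
def sym0Submodule : Submodule ℝ (EuclideanSpace ℝ (Fin 3 × Fin 3)) where
  carrier := {A | (∀ i j, A (i, j) = A (j, i)) ∧ ∑ i, A (i, i) = 0}
  zero_mem' := by simp
  add_mem' := by
    rintro A B ⟨hA, hA'⟩ ⟨hB, hB'⟩
    refine ⟨fun i j => ?_, ?_⟩
    · simp [hA i j, hB i j]
    · simp [Finset.sum_add_distrib, hA', hB']
  smul_mem' := by
    rintro k A ⟨hA, hA'⟩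
    refine ⟨fun i j => ?_, ?_⟩
    · simp [hA i j]
    · simp [← Finset.mul_sum, hA']

/-- `Sym₀(3)` as a normed space; the norm is the Frobenius norm `|A| = √tr(A²)`. -/
abbrev Sym0 : Type := sym0Submodule

/-- An element of `Sym₀(3)` as a matrix. -/
def Sym0.mat (A : Sym0) : Matrix (Fin 3) (Fin 3) ℝ := Matrix.of fun i j => A.1 (i, j)

theorem Sym0.mat_transpose (A : Sym0) : A.mat.transpose = A.mat := by
  ext i j
  exact A.2.1 j i

theorem Sym0.mat_trace (A : Sym0) : A.mat.trace = 0 := A.2.2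

/-- A symmetric, trace-free matrix as an element of `Sym₀(3)`. -/
def Sym0.ofMat (M : Matrix (Fin 3) (Fin 3) ℝ) (h : M.transpose = M) (h' : M.trace = 0) : Sym0 :=
  ⟨WithLp.toLp 2 fun p => M p.1 p.2, fun i j => congrFun (congrFun h j) i, h'⟩

/-- The region of uniaxial bistability of the material constants. -/
def bistableRegion : Set (ℝ × ℝ × ℝ) :=
  {p | 0 < p.1 ∧ 0 < p.2.1 ∧ 0 < p.2.2 ∧ 27 * p.1 * p.2.2 < p.2.1 ^ 2}

/-- The reaction term `- a Q + b (Q² - (1/3) tr(Q²) I) - c tr(Q²) Q`, a map from `Sym₀(3)` to itself. -/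
def reaction (a b c : ℝ) (Q : Sym0) : Sym0 :=
  Sym0.ofMat
    (-(a • Q.mat) + b • (Q.mat ^ 2 - ((1 / 3 : ℝ) * (Q.mat ^ 2).trace) • (1 : Matrix (Fin 3) (Fin 3) ℝ))
      - (c * (Q.mat ^ 2).trace) • Q.mat)
    (by simp [Matrix.transpose_pow, Q.mat_transpose])
    (by
      simp [Q.mat_trace]
      right
      ring)

instance factOneLeSix : Fact ((1 : ℝ≥0∞) ≤ 6) := ⟨by norm_num⟩

/-- The phase space `H = L²(ℝ³; Sym₀(3)) ∩ L⁶(ℝ³; Sym₀(3))`: pairs of an `L²` class and an `L⁶` class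
that agree almost everywhere. As a subspace of the product it carries the norm
`max {‖Q‖₂, ‖Q‖₆}`. -/
def phaseSubmodule :
    Submodule ℝ (Lp Sym0 2 (volume : Measure E3) × Lp Sym0 6 (volume : Measure E3)) where
  carrier := {p | (p.1 : E3 → Sym0) =ᵐ[volume] p.2}
  zero_mem' := (Lp.coeFn_zero Sym0 2 volume).trans (Lp.coeFn_zero Sym0 6 volume).symm
  add_mem' := by
    rintro p q (hp : _ =ᵐ[volume] _) (hq : _ =ᵐ[volume] _)
    exact (Lp.coeFn_add p.1 q.1).trans ((hp.add hq).trans (Lp.coeFn_add p.2 q.2).symm)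
  smul_mem' := by
    rintro k p (hp : _ =ᵐ[volume] _)
    exact (Lp.coeFn_smul k p.1).trans ((hp.const_smul k).trans (Lp.coeFn_smul k p.2).symm)

/-- The phase space `H` as a normed space. -/
abbrev H : Type := phaseSubmodule

/-- A representative of an element of `H`, as a map on `ℝ³`. -/
def profile (Q : H) : E3 → Sym0 := (Q.1.1 : E3 → Sym0)

/-- `H` carries its Borel σ-algebra. -/
instance instMeasurableSpaceH : MeasurableSpace H := borel H

instance instBorelSpaceH : BorelSpace H := ⟨rfl⟩

/-- `u` is a smooth classical solution, on `ℝ³ × (0, ∞)`, of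
`∂ₜ Q = Δ Q - a Q + b (Q² - (1/3) tr(Q²) I) - c tr(Q²) Q`. -/
def IsClassicalSolution (a b c : ℝ) (u : ℝ → E3 → Sym0) : Prop :=
  ContDiffOn ℝ ∞ (fun p : ℝ × E3 => u p.1 p.2) (Ioi (0 : ℝ) ×ˢ (univ : Set E3)) ∧
    ∀ t : ℝ, 0 < t → ∀ x : E3,
      HasDerivAt (fun s => u s x) (Laplacian.laplacian (u t) x + reaction a b c (u t x)) t

/-- `q` is the trajectory in `H` of a smooth classical solution with initial datum `Q₀`: it is
continuous on `[0, ∞)` for the norm of `H` and starts at `Q₀`. -/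
def IsTrajectory (a b c : ℝ) (Q₀ : H) (q : ℝ → H) : Prop :=
  q 0 = Q₀ ∧ ContinuousOn q (Ici 0) ∧
    ∃ u : ℝ → E3 → Sym0, IsClassicalSolution a b c u ∧
      ∀ t : ℝ, 0 < t → profile (q t) =ᵐ[volume] u t

/-- There is exactly one trajectory on `[0, ∞)` with initial datum `Q₀`. -/
def IsWellPosedAt (a b c : ℝ) (Q₀ : H) : Prop :=
  (∃ q, IsTrajectory a b c Q₀ q) ∧
    ∀ q q', IsTrajectory a b c Q₀ q → IsTrajectory a b c Q₀ q' → EqOn q q' (Ici 0)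

open Classical in
/-- The solution operator `S(t)`; its value is the default `0` for data without a trajectory. -/
def solutionMap (a b c t : ℝ) (Q₀ : H) : H :=
  if h : ∃ q, IsTrajectory a b c Q₀ q then h.choose t else 0

/-- The weighted norm `ess sup (1 + |x|)^(8 + δ) |f(x)|`, with values in `[0, ∞]`. -/
def weightedNorm (δ : ℝ) (f : E3 → Sym0) : ℝ≥0∞ :=
  eLpNorm (fun x => (1 + ‖x‖) ^ (8 + δ) • f x) ∞ volume

/-- The data with `ess sup (1 + |x|)^(8 + δ) |R(x)| < η`. A measurable map with finite weighted norm is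
bounded and decays fast enough to lie in `L² ∩ L⁶`, so nothing is lost by looking inside `H`. -/
def smallData (δ η : ℝ) : Set H :=
  {Q₀ | weightedNorm δ (profile Q₀) < ENNReal.ofReal η}

/-- The heat kernel shifted by one unit of time, `Φ₁(x, t) = Φ(x, t + 1)`. -/
def shiftedHeatKernel (t : ℝ) (x : E3) : ℝ :=
  Real.exp (-‖x‖ ^ 2 / (4 * (t + 1))) / (4 * Real.pi * (t + 1)) ^ (3 / 2 : ℝ)

/-- The space `X₀` of remainders: continuous `V` on `ℝ³ × (0, ∞)` such that
`(1 + |x| / √(t + 1))^(4 + δ/2) (t + 1)² |V(x, t)|` is bounded. -/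
def IsRemainder (δ : ℝ) (V : ℝ → E3 → Sym0) : Prop :=
  ContinuousOn (fun p : ℝ × E3 => V p.1 p.2) (Ioi (0 : ℝ) ×ˢ (univ : Set E3)) ∧
    ∃ M : ℝ, ∀ t : ℝ, 0 < t → ∀ x : E3,
      (1 + ‖x‖ / √(t + 1)) ^ (4 + δ / 2) * (t + 1) ^ 2 * ‖V t x‖ ≤ M

/-- `A` is the coefficient matrix of the datum `Q₀`: the solution is
`Q(x, t) = e^(-at) A Φ₁(x, t) + e^(-at) V(x, t)` for all `t > 0`, with a remainder `V`. -/
def IsCoefficientMatrix (δ a b c : ℝ) (Q₀ : H) (A : Sym0) : Prop :=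
  ∃ V : ℝ → E3 → Sym0, IsRemainder δ V ∧ ∀ t : ℝ, 0 < t →
    profile (solutionMap a b c t Q₀) =ᵐ[volume]
      fun x => Real.exp (-a * t) • (shiftedHeatKernel t x • A) + Real.exp (-a * t) • V t x

/-- The small data whose coefficient matrix is zero. -/
def zeroCoefficientData (δ η a b c : ℝ) : Set H :=
  {Q₀ | Q₀ ∈ smallData δ η ∧ IsCoefficientMatrix δ a b c Q₀ 0}

/-- `E` is open for the weighted norm. -/
def IsWeightedOpen (δ : ℝ) (E : Set H) : Prop :=
  ∀ Q ∈ E, ∃ ε : ℝ, 0 < ε ∧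
    ∀ P : H, weightedNorm δ (profile (P - Q)) < ENNReal.ofReal ε → P ∈ E

/-- `E` is dense in `F` for the weighted norm. -/
def IsWeightedDenseIn (δ : ℝ) (E F : Set H) : Prop :=
  ∀ Q ∈ F, ∀ ε : ℝ, 0 < ε →
    ∃ P ∈ E, weightedNorm δ (profile (P - Q)) < ENNReal.ofReal ε

/-- The statistical solution `μₜ` with initial measure `μ₀`: the transport of `μ₀` by `S(t)`. -/
def statSolution (a b c : ℝ) (μ₀ : Measure H) (t : ℝ) : Measure H :=
  μ₀.map (solutionMap a b c t)

/-- `∫ tr(Q(x + r) Q(x)) dx`. -/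
def twoPoint (r : E3) (Q : H) : ℝ :=
  ∫ x : E3, ((profile Q (x + r)).mat * (profile Q x).mat).trace

/-- `∫ tr(Q(x)²) dx`. -/
def onePoint (Q : H) : ℝ :=
  ∫ x : E3, ((profile Q x).mat ^ 2).trace

/-- The averaged correlation function `c_{μ₀}(r, t)`. -/
def correlation (a b c : ℝ) (μ₀ : Measure H) (r : E3) (t : ℝ) : ℝ :=
  (∫ Q, twoPoint r Q ∂(statSolution a b c μ₀ t)) / ∫ Q, onePoint Q ∂(statSolution a b c μ₀ t)

end QTensor

end

open QTensor

/-! Put w = e^(at) Q. The linear damping disappears and w solves ∂ₜw = Δw + F(t, w), where F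
(`scaledReaction`) is at least quadratic in w and carries a factor e^(-at). The nonlinearity is
therefore integrable in time, and a small solution behaves like a free heat flow.

Existence. With ρ = (1+|x|)^(-8-δ) and data |R| ≤ ηρ, the integral equation is solved among
functions dominated pointwise by 2η e^(tΔ)ρ. Duhamel's formula reproduces such caloric majorants,
because e^(τΔ) e^((t-τ)Δ) ρ = e^(tΔ) ρ leaves only ∫ e^(-as) ds ≤ 1/a (`norm_duhamel_le_heat`); for
η small against a, the Picard map contracts by 1/4 (`norm_picard_sub_le`). Mild solutions are smooth
because a solution together with its gradient solves a mild system of the same type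
(`IsMild.gradient`, `contDiffOn_nat_of_isMild`). Uniqueness is a localized L² energy estimate in
which the cubic term absorbs the quadratic one (`inner_reaction_sub_le`, `eqOn_of_isTrajectory`).

Asymptotics. The heat flow of a localized function with zero integral decays like t^(-2) instead of
t^(-3/2) (`exists_norm_heat_le_decay`). Comparing the datum, and the source at each time, with the
multiple of the heat kernel of equal mass gives w = A Φ₁ + V with A = ∫ R + ∫∫ F (`massLimit`), with
constants uniform over the small data. The exponents fit because 8 + δ > (4 + δ/2) + 4.

Openness and density. The change of A differs from the change of ∫ R by at most one third of the L¹
distance of the data (`norm_massLimit_sub_le`). So a nonzero A survives small perturbations, and a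
zero A is destroyed by adding a function of one sign times a fixed matrix.

Correlation. In L², the main term of w has size t^(-3/4) and the remainder t^(-5/4), so e^(2at) ∫
tr(Q(x+r)Q(x)) dx = |A|² Φ(r, 2(t+1)) + O(t^(-2)), uniformly in r and in the data
(`exists_twoPoint_expansion`). Dividing by Φ(0, 2(t+1)), of size t^(-3/2), leaves |A|²
e^(-|r|²/8(t+1)) + O(t^(-1/2)). This is averaged over μ₀ and divided by its value at r = 0, whose
limit ∫ |A|² dμ₀ is positive since A ≠ 0 almost surely. -/

noncomputable section


/-! ### The heat kernel and the heat semigroup as a Gaussian average -/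

namespace QTensor

/-- The heat kernel `(4πt)^(-3/2) exp(-|x|²/4t)` on `ℝ³`. -/
def heatKernel (t : ℝ) (x : E3) : ℝ :=
  Real.exp (-‖x‖ ^ 2 / (4 * t)) / (4 * Real.pi * t) ^ (3 / 2 : ℝ)

theorem shiftedHeatKernel_eq (t : ℝ) : shiftedHeatKernel t = heatKernel (t + 1) := rfl

theorem heatKernel_pos {t : ℝ} (ht : 0 < t) (x : E3) : 0 < heatKernel t x := by
  unfold heatKernel; positivity

theorem heatKernel_neg (t : ℝ) (x : E3) : heatKernel t (-x) = heatKernel t x := by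
  simp [heatKernel]

theorem contDiff_heatKernel (t : ℝ) {n : WithTop ℕ∞} : ContDiff ℝ n (heatKernel t) := by
  unfold heatKernel
  exact ((contDiff_norm_sq ℝ).neg.div_const _).exp.div_const _

theorem continuous_heatKernel (t : ℝ) : Continuous (heatKernel t) :=
  (contDiff_heatKernel t (n := 0)).continuous

theorem integral_exp_neg_mul_norm_sq {b : ℝ} (hb : 0 < b) :
    ∫ v : E3, Real.exp (-b * ‖v‖ ^ 2) = (Real.pi / b) ^ (3 / 2 : ℝ) := by
  rw [GaussianFourier.integral_rexp_neg_mul_sq_norm hb]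
  norm_num

theorem integrable_exp_neg_mul_norm_sq {b : ℝ} (hb : 0 < b) :
    Integrable fun v : E3 => Real.exp (-b * ‖v‖ ^ 2) := by
  -- A non-integrable function has Bochner integral 0, which contradicts the positive value just
  -- computed.
  by_contra h
  have h1 := integral_exp_neg_mul_norm_sq hb
  rw [integral_undef h] at h1
  have : 0 < (Real.pi / b) ^ (3 / 2 : ℝ) := by positivity
  linarith

theorem heatKernel_eq (t : ℝ) (x : E3) :
    heatKernel t x = Real.exp (-(1 / (4 * t)) * ‖x‖ ^ 2) * ((4 * Real.pi * t) ^ (3 / 2 : ℝ))⁻¹ := by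
  rw [heatKernel, div_eq_mul_inv]; congr 2; ring

theorem integrable_heatKernel {t : ℝ} (ht : 0 < t) : Integrable (heatKernel t) := by
  simp_rw [funext (heatKernel_eq t)]
  exact (integrable_exp_neg_mul_norm_sq (by positivity)).mul_const _

theorem integral_heatKernel {t : ℝ} (ht : 0 < t) : ∫ x, heatKernel t x = 1 := by
  simp_rw [heatKernel_eq t]
  rw [integral_mul_const, integral_exp_neg_mul_norm_sq (by positivity)]
  have : Real.pi / (1 / (4 * t)) = 4 * Real.pi * t := by field_simp
  rw [this]
  exact mul_inv_cancel₀ (by positivity)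

/-- The Gaussian probability measure with density `heatKernel 1`. -/
def gauss : Measure E3 := volume.withDensity fun y => ENNReal.ofReal (heatKernel 1 y)

instance : IsProbabilityMeasure gauss := by
  refine ⟨?_⟩
  rw [gauss, withDensity_apply _ MeasurableSet.univ, Measure.restrict_univ,
    ← ofReal_integral_eq_lintegral_ofReal (integrable_heatKernel one_pos)
      (ae_of_all _ fun x => (heatKernel_pos one_pos x).le), integral_heatKernel one_pos]
  simp

variable {E : Type*} [NormedAddCommGroup E] [NormedSpace ℝ E]

theorem integral_gauss (g : E3 → E) : ∫ y, g y ∂gauss = ∫ y, heatKernel 1 y • g y := by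
  rw [gauss, integral_withDensity_eq_integral_toReal_smul
    (continuous_heatKernel 1).measurable.ennreal_ofReal (by simp)]
  simp only [ENNReal.toReal_ofReal (heatKernel_pos one_pos _).le]

theorem integrable_gauss_iff (g : E3 → E) :
    Integrable g gauss ↔ Integrable fun y => heatKernel 1 y • g y := by
  rw [gauss, integrable_withDensity_iff_integrable_smul'
    (continuous_heatKernel 1).measurable.ennreal_ofReal (by simp)]
  simp only [ENNReal.toReal_ofReal (heatKernel_pos one_pos _).le]

/-- The heat semigroup on `ℝ³`, as an average over the Gaussian measure. -/
def heat (t : ℝ) (f : E3 → E) (x : E3) : E := ∫ y, f (x - √t • y) ∂gauss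

/-- Averaging over one fixed Gaussian with displacement √t y, instead of integrating against a
kernel that is singular at t = 0, includes time zero and leaves the measure independent of t in all
limit arguments. -/
theorem heat_zero [CompleteSpace E] (f : E3 → E) : heat 0 f = f := by
  ext x; simp [heat]

theorem heatKernel_smul {t : ℝ} (ht : 0 < t) (y : E3) :
    heatKernel t (√t • y) = t ^ (-(3 / 2) : ℝ) * heatKernel 1 y := by
  have h1 : (√t) ^ 2 = t := Real.sq_sqrt ht.le
  have h2 : -‖√t • y‖ ^ 2 / (4 * t) = -‖y‖ ^ 2 / (4 * 1) := by
    rw [norm_smul, mul_pow, Real.norm_eq_abs, sq_abs, h1]; field_simp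
  rw [heatKernel, heatKernel, h2, Real.mul_rpow (by positivity) ht.le, mul_one, Real.rpow_neg ht.le]
  field_simp

theorem heat_eq_integral {t : ℝ} (ht : 0 < t) (f : E3 → E) (x : E3) :
    heat t f x = ∫ z, heatKernel t z • f (x - z) := by
  have h := Measure.integral_comp_smul (volume : Measure E3)
    (fun z => heatKernel t z • f (x - z)) (√t)
  have hs : 0 < √t := Real.sqrt_pos.2 ht
  simp only [finrank_euclideanSpace, Fintype.card_fin, heatKernel_smul ht] at h
  have h3 : |((√t) ^ 3)⁻¹| = t ^ (-(3 / 2) : ℝ) := by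
    rw [abs_of_pos (by positivity), Real.rpow_neg ht.le, Real.sqrt_eq_rpow, ← Real.rpow_natCast,
      ← Real.rpow_mul ht.le]
    norm_num
  simp only [h3, mul_smul] at h
  rw [integral_smul] at h
  rw [heat, integral_gauss]
  exact smul_right_injective E (by positivity : t ^ (-(3 / 2) : ℝ) ≠ 0) h

theorem heat_eq_integral' {t : ℝ} (ht : 0 < t) (f : E3 → E) (x : E3) :
    heat t f x = ∫ y, heatKernel t (x - y) • f y := by
  rw [heat_eq_integral ht, ← integral_sub_left_eq_self _ _ x]
  simp

theorem heat_heatKernel {s t : ℝ} (hs : 0 < s) (ht : 0 < t) (x : E3) :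
    heat s (heatKernel t) x = heatKernel (s + t) x := by
  have hst : 0 < s + t := by positivity
  rw [heat_eq_integral' hs]
  -- Completing the square in y, around the centre (t/(s+t)) x.
  have key : ∀ y : E3, heatKernel s (x - y) • heatKernel t y =
      Real.exp (-((s + t) / (4 * s * t)) * ‖y - (t / (s + t)) • x‖ ^ 2) *
      (Real.exp (-‖x‖ ^ 2 / (4 * (s + t))) *
        (((4 * Real.pi * s) ^ (3 / 2 : ℝ))⁻¹ * ((4 * Real.pi * t) ^ (3 / 2 : ℝ))⁻¹)) := by
    intro y
    have e : Real.exp (-‖x - y‖ ^ 2 / (4 * s)) * Real.exp (-‖y‖ ^ 2 / (4 * t)) =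
        Real.exp (-((s + t) / (4 * s * t)) * ‖y - (t / (s + t)) • x‖ ^ 2) *
        Real.exp (-‖x‖ ^ 2 / (4 * (s + t))) := by
      rw [← Real.exp_add, ← Real.exp_add]
      congr 1
      rw [norm_sub_sq_real, norm_sub_sq_real, inner_smul_right, norm_smul, real_inner_comm x y,
        Real.norm_of_nonneg (by positivity)]
      field_simp
      ring
    rw [smul_eq_mul, heatKernel, heatKernel, div_eq_mul_inv (Real.exp _),
      div_eq_mul_inv (Real.exp (-‖y‖ ^ 2 / (4 * t)))]
    linear_combination e * (((4 * Real.pi * s) ^ (3 / 2 : ℝ))⁻¹ * ((4 * Real.pi * t) ^ (3 / 2 : ℝ))⁻¹)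
  simp_rw [key]
  rw [integral_mul_const,
    integral_sub_right_eq_self (fun y : E3 => Real.exp (-((s + t) / (4 * s * t)) * ‖y‖ ^ 2)),
    integral_exp_neg_mul_norm_sq (by positivity), heatKernel]
  have h1 : (4 * Real.pi * s) ^ (3 / 2 : ℝ) * (4 * Real.pi * t) ^ (3 / 2 : ℝ) =
      (Real.pi / ((s + t) / (4 * s * t))) ^ (3 / 2 : ℝ) * (4 * Real.pi * (s + t)) ^ (3 / 2 : ℝ) := by
    rw [← Real.mul_rpow (by positivity) (by positivity),
      ← Real.mul_rpow (by positivity) (by positivity)]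
    congr 1
    field_simp
  rw [← mul_inv, h1]
  field_simp

theorem charFun_gauss (ξ : E3) : charFun gauss ξ = Complex.exp (-(‖ξ‖ ^ 2 : ℝ)) := by
  have h := GaussianFourier.integral_cexp_neg_mul_sq_norm_add (V := E3) (b := 1 / 4)
    (by norm_num) Complex.I ξ
  have h0 := GaussianFourier.integral_cexp_neg_mul_sq_norm_add (V := E3) (b := 1 / 4)
    (by norm_num) 0 ξ
  have h1 := integral_heatKernel one_pos
  rw [charFun_apply, integral_gauss]
  have e1 : ∀ y : E3, (heatKernel 1 y • Complex.exp (inner ℝ y ξ * Complex.I) : ℂ) =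
      Complex.exp (-(1 / 4) * ‖y‖ ^ 2 + Complex.I * inner ℝ ξ y) *
        (((4 * Real.pi * 1) ^ (3 / 2 : ℝ))⁻¹ : ℝ) := by
    intro y
    rw [heatKernel_eq, Complex.real_smul, Complex.ofReal_mul, Complex.ofReal_exp, Complex.exp_add,
      real_inner_comm]
    push_cast
    ring_nf
  -- The same formula at frequency zero, where the left side is 1, supplies the normalizing constant
  -- without evaluating it.
  have e0 : ((∫ y : E3, heatKernel 1 y : ℝ) : ℂ) =
      ∫ y : E3, Complex.exp (-(1 / 4) * ‖y‖ ^ 2 + 0 * inner ℝ ξ y) *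
        (((4 * Real.pi * 1) ^ (3 / 2 : ℝ))⁻¹ : ℝ) := by
    rw [← integral_complex_ofReal]
    congr 1
    ext y
    rw [heatKernel_eq]
    push_cast
    ring_nf
  simp_rw [e1]
  rw [integral_mul_const, h]
  rw [h1, integral_mul_const, h0] at e0
  simp only [Complex.I_sq] at *
  have e2 : (-1 * (‖ξ‖ : ℂ) ^ 2 / (4 * (1 / 4))) = (-(‖ξ‖ ^ 2 : ℝ) : ℂ) := by push_cast; ring
  rw [e2]
  have e3 : ((0 : ℂ) ^ 2 * (‖ξ‖ : ℂ) ^ 2 / (4 * (1 / 4))) = 0 := by ring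
  rw [e3, Complex.exp_zero, mul_one] at e0
  rw [mul_right_comm, ← e0]
  simp

/-- Variances add: the characteristic functions are exp(-s|ξ|²) and exp(-t|ξ|²). This is the
semigroup law at the level of measures, so `heat_heat` needs no regularity of the data. -/
theorem gauss_conv {s t : ℝ} (hs : 0 ≤ s) (ht : 0 ≤ t) :
    (gauss.map fun y => √s • y) ∗ (gauss.map fun y => √t • y) = gauss.map fun y => √(s + t) • y := by
  have : ∀ r : ℝ, IsProbabilityMeasure (gauss.map fun y => r • y) := fun r =>
    Measure.isProbabilityMeasure_map (by fun_prop)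
  refine Measure.ext_of_charFun ?_
  ext ξ
  rw [charFun_conv, charFun_map_smul, charFun_map_smul, charFun_map_smul, charFun_gauss,
    charFun_gauss, charFun_gauss, ← Complex.exp_add]
  congr 1
  simp only [norm_smul, mul_pow, Real.norm_eq_abs, sq_abs, Real.sq_sqrt hs, Real.sq_sqrt ht,
    Real.sq_sqrt (add_nonneg hs ht)]
  push_cast
  ring

/-- Bounded strongly measurable maps. -/
structure IsBddMeas (f : E3 → E) : Prop where
  sm : StronglyMeasurable f
  bdd : ∃ M, ∀ x, ‖f x‖ ≤ M

theorem heat_eq_map {f : E3 → E} (hf : StronglyMeasurable f) (t : ℝ) (x : E3) :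
    heat t f x = ∫ z, f (x - z) ∂(gauss.map fun y => √t • y) := by
  rw [integral_map (by fun_prop)]
  · rfl
  · exact (hf.comp_measurable (by fun_prop)).aestronglyMeasurable

omit [NormedSpace ℝ E] in
theorem IsBddMeas.integrable {f : E3 → E} (hf : IsBddMeas f) (t : ℝ) (x : E3) :
    Integrable (fun y => f (x - √t • y)) gauss := by
  obtain ⟨M, hM⟩ := hf.bdd
  exact Integrable.of_bound (hf.sm.comp_measurable (by fun_prop)).aestronglyMeasurable M
    (ae_of_all _ fun y => hM _)

theorem norm_heat_le {f : E3 → E} {M : ℝ} (hM : ∀ x, ‖f x‖ ≤ M) (t : ℝ) (x : E3) :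
    ‖heat t f x‖ ≤ M := by
  simpa [heat] using
    norm_integral_le_of_norm_le_const (μ := gauss) (ae_of_all _ fun y => hM (x - √t • y))

theorem stronglyMeasurable_heat_uncurry {f : E3 → E} (hf : StronglyMeasurable f) :
    StronglyMeasurable fun p : ℝ × E3 => heat p.1 f p.2 := by
  unfold heat
  refine StronglyMeasurable.integral_prod_right (f := fun (p : ℝ × E3) y => f (p.2 - √p.1 • y)) ?_
  exact hf.comp_measurable (g := fun q : (ℝ × E3) × E3 => q.1.2 - √q.1.1 • q.2) (by fun_prop)

theorem stronglyMeasurable_heat {f : E3 → E} (hf : StronglyMeasurable f) (t : ℝ) :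
    StronglyMeasurable (heat t f) :=
  (stronglyMeasurable_heat_uncurry hf).comp_measurable measurable_prodMk_left

theorem IsBddMeas.heat {f : E3 → E} (hf : IsBddMeas f) (t : ℝ) : IsBddMeas (heat t f) :=
  ⟨stronglyMeasurable_heat hf.sm t, hf.bdd.imp fun _ h => norm_heat_le h t⟩

theorem heat_heat {f : E3 → E} (hf : IsBddMeas f) {s t : ℝ} (hs : 0 ≤ s) (ht : 0 ≤ t) :
    heat s (heat t f) = heat (s + t) f := by
  have : ∀ r : ℝ, IsProbabilityMeasure (gauss.map fun y => r • y) := fun r =>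
    Measure.isProbabilityMeasure_map (by fun_prop)
  ext x
  obtain ⟨M, hM⟩ := hf.bdd
  rw [heat_eq_map hf.sm (s + t), ← gauss_conv hs ht, integral_conv,
    heat_eq_map (hf.heat t).sm]
  · congr 1
    ext y
    rw [heat_eq_map hf.sm]
    congr 1
    ext z
    congr 1
    abel
  · exact Integrable.of_bound (hf.sm.comp_measurable (by fun_prop)).aestronglyMeasurable M
      (ae_of_all _ fun y => hM _)

theorem heat_mono {f g : E3 → ℝ} (hf : IsBddMeas f) (hg : IsBddMeas g) (h : ∀ x, f x ≤ g x)
    (t : ℝ) (x : E3) : heat t f x ≤ heat t g x :=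
  integral_mono (hf.integrable t x) (hg.integrable t x) fun y => h _

theorem norm_heat_le_heat {f : E3 → E} {g : E3 → ℝ} (hg : IsBddMeas g)
    (h : ∀ x, ‖f x‖ ≤ g x) (t : ℝ) (x : E3) : ‖heat t f x‖ ≤ heat t g x :=
  norm_integral_le_of_norm_le (hg.integrable t x) (ae_of_all _ fun y => h _)

theorem heat_const_mul (k : ℝ) (f : E3 → ℝ) (t : ℝ) (x : E3) :
    heat t (fun y => k * f y) x = k * heat t f x := integral_const_mul _ _

theorem heat_const [CompleteSpace E] (k : E) (t : ℝ) (x : E3) :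
    heat t (fun _ => k) x = k := by simp [heat]

theorem heat_smul_const (f : E3 → ℝ) (v : E) [CompleteSpace E] (t : ℝ) (x : E3) :
    heat t (fun y => f y • v) x = heat t f x • v := integral_smul_const _ _

theorem heat_add {f g : E3 → E} (hf : IsBddMeas f) (hg : IsBddMeas g) (t : ℝ) (x : E3) :
    heat t (fun y => f y + g y) x = heat t f x + heat t g x :=
  integral_add (hf.integrable t x) (hg.integrable t x)

theorem heat_sub {f g : E3 → E} (hf : IsBddMeas f) (hg : IsBddMeas g) (t : ℝ) (x : E3) :
    heat t (fun y => f y - g y) x = heat t f x - heat t g x :=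
  integral_sub (hf.integrable t x) (hg.integrable t x)

theorem integrable_prod_comp_sub {f : E3 → E} (hf : Integrable f) (hs : StronglyMeasurable f)
    (t : ℝ) : Integrable (fun p : E3 × E3 => f (p.1 - √t • p.2)) (volume.prod gauss) := by
  have hm : StronglyMeasurable fun p : E3 × E3 => f (p.1 - √t • p.2) :=
    hs.comp_measurable (g := fun p : E3 × E3 => p.1 - √t • p.2) (by fun_prop)
  rw [integrable_prod_iff' hm.aestronglyMeasurable]
  refine ⟨ae_of_all _ fun y => hf.comp_sub_right (√t • y), ?_⟩
  simp only [integral_sub_right_eq_self (fun x => ‖f x‖)]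
  exact integrable_const _

theorem integrable_heat {f : E3 → E} (hf : Integrable f) (hs : StronglyMeasurable f) (t : ℝ) :
    Integrable (heat t f) := (integrable_prod_comp_sub hf hs t).integral_prod_left

theorem integral_heat [CompleteSpace E] {f : E3 → E} (hf : Integrable f)
    (hs : StronglyMeasurable f) (t : ℝ) : ∫ x, heat t f x = ∫ x, f x := by
  unfold heat
  rw [integral_integral_swap (integrable_prod_comp_sub hf hs t)]
  simp [integral_sub_right_eq_self f]

theorem exists_exp_neg_sq_mul_rpow_le (N : ℝ) : ∃ C : ℝ, ∀ r : ℝ, 0 ≤ r →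
    Real.exp (-(1 / 8) * r ^ 2) * (1 + r) ^ N ≤ C := by
  obtain ⟨n, hn⟩ := exists_nat_ge N
  -- Bounding (1+r)^n by n! e^(1+r) leaves the exponent 1 + r - r²/8, which peaks at r = 4 with
  -- value 3.
  refine ⟨Real.exp 4 * n.factorial, fun r hr => ?_⟩
  have h1 : (1 + r) ^ N ≤ (1 + r) ^ n := by
    rw [← Real.rpow_natCast]; exact Real.rpow_le_rpow_of_exponent_le (by linarith) hn
  have h2 := Real.pow_div_factorial_le_exp (1 + r) (by linarith) n
  rw [div_le_iff₀ (by positivity)] at h2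
  calc _ ≤ Real.exp (-(1 / 8) * r ^ 2) * (Real.exp (1 + r) * n.factorial) := by
        gcongr; exact h1.trans h2
    _ = Real.exp (-(1 / 8) * r ^ 2 + (1 + r)) * n.factorial := by
        rw [Real.exp_add (-(1 / 8) * r ^ 2)]; ring
    _ ≤ _ := by gcongr; nlinarith [sq_nonneg (r - 4)]

/-- `(1 + |y|)^N` is integrable for the Gaussian measure. -/
theorem integrable_gauss_pow (N : ℝ) : Integrable (fun y : E3 => (1 + ‖y‖) ^ N) gauss := by
  rw [integrable_gauss_iff]
  obtain ⟨C, hC⟩ := exists_exp_neg_sq_mul_rpow_le N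
  refine (((integrable_exp_neg_mul_norm_sq (b := 1 / 8) (by norm_num)).const_mul
    (((4 * Real.pi * 1) ^ (3 / 2 : ℝ))⁻¹)).mul_const C).mono' ?_ (ae_of_all _ fun y => ?_)
  · refine ((continuous_heatKernel 1).mul ?_).aestronglyMeasurable
    exact (by fun_prop : Continuous fun y : E3 => 1 + ‖y‖).rpow_const
      fun y => Or.inl (by positivity)
  · rw [smul_eq_mul, Real.norm_of_nonneg (mul_nonneg (heatKernel_pos one_pos y).le (by positivity)),
      heatKernel_eq]
    have h := hC ‖y‖ (norm_nonneg y)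
    have e : Real.exp (-(1 / (4 * 1)) * ‖y‖ ^ 2) =
        Real.exp (-(1 / 8) * ‖y‖ ^ 2) * Real.exp (-(1 / 8) * ‖y‖ ^ 2) := by
      rw [← Real.exp_add]; ring_nf
    rw [e]
    calc _ = ((4 * Real.pi * 1) ^ (3 / 2 : ℝ))⁻¹ * Real.exp (-(1 / 8) * ‖y‖ ^ 2) *
          (Real.exp (-(1 / 8) * ‖y‖ ^ 2) * (1 + ‖y‖) ^ N) := by ring
      _ ≤ _ := by gcongr

theorem integrable_gauss_norm : Integrable (fun y : E3 => ‖y‖) gauss := by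
  refine (integrable_gauss_pow 1).mono' (by fun_prop) (ae_of_all _ fun y => ?_)
  simp

end QTensor
end

/-! ### Gradient of the heat flow and joint continuity -/

noncomputable section


namespace QTensor

variable {E : Type*} [NormedAddCommGroup E] [NormedSpace ℝ E]

theorem hasFDerivAt_heatKernel {t : ℝ} (ht : t ≠ 0) (z : E3) :
    HasFDerivAt (heatKernel t) ((-(1 / (2 * t)) * heatKernel t z) • innerSL ℝ z) z := by
  have h := (((((hasStrictFDerivAt_norm_sq z).hasFDerivAt.neg).const_mul (4 * t)⁻¹).exp).mul_const
    (((4 * Real.pi * t) ^ (3 / 2 : ℝ))⁻¹))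
  convert! h using 1
  · ext x
    rw [heatKernel, div_eq_mul_inv, div_eq_mul_inv]
    simp only [Pi.neg_apply]
    ring_nf
  · ext v
    simp only [heatKernel, smul_apply, innerSL_apply_apply, smul_eq_mul,
      neg_apply]
    have : -‖z‖ ^ 2 / (4 * t) = (4 * t)⁻¹ * -‖z‖ ^ 2 := by ring
    rw [this]
    field_simp
    simp
    ring_nf

/-- The spatial gradient of `heat t f`, written without derivatives of `f`. -/
def heatGrad (t : ℝ) (f : E3 → E) (x : E3) : E3 →L[ℝ] E :=
  (-(1 / (2 * √t))) • ∫ y, (innerSL ℝ y).smulRight (f (x - √t • y)) ∂gauss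

theorem integral_gauss_comp_smul {t : ℝ} (ht : 0 < t) (G : E3 → E) :
    ∫ y, G (√t • y) ∂gauss = ∫ z, heatKernel t z • G z := by
  have := heat_eq_integral ht (fun z => G (-z)) 0
  simpa [heat] using this

theorem hasFDerivAt_heat [CompleteSpace E] {t : ℝ} (ht : 0 < t) {f : E3 → E} (hf : IsBddMeas f)
    (x₀ : E3) : HasFDerivAt (heat t f) (heatGrad t f x₀) x₀ := by
  obtain ⟨M, hM⟩ := hf.bdd
  have hM0 : 0 ≤ M := (norm_nonneg _).trans (hM 0)
  set c : ℝ := ((4 * Real.pi * t) ^ (3 / 2 : ℝ))⁻¹ with hc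
  have hc0 : 0 < c := by positivity
  -- All derivatives fall on the kernel, `f` being only bounded and measurable. Half of the Gaussian
  -- exponent absorbs the linear factor |x - y|; the inequality |y - x₀|² ≤ 2|x - y|² + 2 recentres
  -- the other half at x₀, whence the rate 1/(16t).
  have hbound : ∀ x ∈ Metric.ball x₀ 1, ∀ y : E3,
      ‖((-(1 / (2 * t)) * heatKernel t (x - y)) • innerSL ℝ (x - y)).smulRight (f y)‖ ≤
        (1 / (2 * t)) * c * (1 + 8 * t) * Real.exp (1 / (8 * t)) * M *
          Real.exp (-(1 / (16 * t)) * ‖y - x₀‖ ^ 2) := by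
    intro x hx y
    rw [mem_ball_iff_norm] at hx
    set r := ‖x - y‖ with hr
    have hr0 : 0 ≤ r := norm_nonneg _
    rw [ContinuousLinearMap.norm_smulRight_apply, norm_smul, innerSL_apply_norm, norm_mul, norm_neg,
      Real.norm_of_nonneg (by positivity : (0 : ℝ) ≤ 1 / (2 * t)),
      Real.norm_of_nonneg (heatKernel_pos ht _).le, heatKernel_eq, ← hc, ← hr]
    have h1 : r ≤ (1 + 8 * t) * Real.exp (r ^ 2 / (8 * t)) := by
      have e1 := Real.add_one_le_exp (r ^ 2 / (8 * t))
      have e2 : 1 ≤ Real.exp (r ^ 2 / (8 * t)) := Real.one_le_exp (by positivity)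
      have e3 : 8 * t * (r ^ 2 / (8 * t)) = r ^ 2 := by field_simp
      nlinarith [mul_le_mul_of_nonneg_left e1 (by positivity : 0 ≤ 8 * t)]
    have h2 : ‖y - x₀‖ ^ 2 ≤ 2 * r ^ 2 + 2 := by
      have : ‖y - x₀‖ ≤ r + 1 := by
        calc ‖y - x₀‖ = ‖(x - x₀) - (x - y)‖ := by congr 1; abel
          _ ≤ ‖x - x₀‖ + ‖x - y‖ := norm_sub_le _ _
          _ ≤ r + 1 := by linarith
      nlinarith [norm_nonneg (y - x₀), sq_nonneg (r - 1)]
    have h3 : Real.exp (-(1 / (4 * t)) * r ^ 2) * Real.exp (r ^ 2 / (8 * t)) ≤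
        Real.exp (1 / (8 * t)) * Real.exp (-(1 / (16 * t)) * ‖y - x₀‖ ^ 2) := by
      rw [← Real.exp_add, ← Real.exp_add, Real.exp_le_exp]
      have e1 : -(1 / (4 * t)) * r ^ 2 + r ^ 2 / (8 * t) = -(2 * r ^ 2) / (16 * t) := by
        field_simp; ring
      have e2 : 1 / (8 * t) + -(1 / (16 * t)) * ‖y - x₀‖ ^ 2 = (2 - ‖y - x₀‖ ^ 2) / (16 * t) := by
        field_simp; ring
      rw [e1, e2]
      gcongr
      linarith
    calc 1 / (2 * t) * (Real.exp (-(1 / (4 * t)) * r ^ 2) * c) * r * ‖f y‖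
        ≤ 1 / (2 * t) * (Real.exp (-(1 / (4 * t)) * r ^ 2) * c) *
          ((1 + 8 * t) * Real.exp (r ^ 2 / (8 * t))) * M := by
          gcongr
          exact hM y
      _ = 1 / (2 * t) * c * (1 + 8 * t) * M *
          (Real.exp (-(1 / (4 * t)) * r ^ 2) * Real.exp (r ^ 2 / (8 * t))) := by ring
      _ ≤ 1 / (2 * t) * c * (1 + 8 * t) * M *
          (Real.exp (1 / (8 * t)) * Real.exp (-(1 / (16 * t)) * ‖y - x₀‖ ^ 2)) := by
          gcongr
      _ = _ := by ring
  have key := hasFDerivAt_integral_of_dominated_of_fderiv_le (μ := volume) (𝕜 := ℝ)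
    (F := fun x y => heatKernel t (x - y) • f y) (x₀ := x₀)
    (F' := fun x y => ((-(1 / (2 * t)) * heatKernel t (x - y)) • innerSL ℝ (x - y)).smulRight (f y))
    (bound := fun y => (1 / (2 * t)) * c * (1 + 8 * t) * Real.exp (1 / (8 * t)) * M *
          Real.exp (-(1 / (16 * t)) * ‖y - x₀‖ ^ 2))
    (Metric.ball_mem_nhds x₀ one_pos) ?_ ?_ ?_ (ae_of_all _ fun y x hx => hbound x hx y) ?_ ?_
  · convert! key using 1
    · ext x; exact heat_eq_integral' ht f x
    · have e : ∀ y : E3, (-(1 / (2 * √t))) • (innerSL ℝ y).smulRight (f (x₀ - √t • y)) =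
          (fun z : E3 => (-(1 / (2 * t))) • (innerSL ℝ z).smulRight (f (x₀ - z))) (√t • y) := by
        intro y
        ext v
        simp only [smul_apply, ContinuousLinearMap.smulRight_apply, map_smul,
          innerSL_apply_apply, smul_smul, smul_eq_mul]
        congr 1
        have : √t * √t = t := Real.mul_self_sqrt ht.le
        have h0 : 0 < √t := Real.sqrt_pos.2 ht
        rw [show (1 : ℝ) / (2 * t) = 1 / (2 * (√t * √t)) by rw [this]]
        field_simp
      rw [heatGrad, ← integral_smul]
      refine (integral_congr_ae (ae_of_all _ e)).trans ((integral_gauss_comp_smul ht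
        fun z : E3 => (-(1 / (2 * t))) • (innerSL ℝ z).smulRight (f (x₀ - z))).trans ?_)
      rw [← integral_sub_left_eq_self _ _ x₀]
      congr 1
      ext y v
      simp only [smul_apply, ContinuousLinearMap.smulRight_apply, sub_sub_cancel,
        smul_smul, smul_eq_mul]
      congr 1
      ring
  · refine Eventually.of_forall fun x => ?_
    exact ((continuous_heatKernel t).comp (by fun_prop)).aestronglyMeasurable.smul
      hf.sm.aestronglyMeasurable
  · have := ((integrable_heatKernel ht).comp_sub_left x₀).mul_const M
    refine this.mono' (((continuous_heatKernel t).comp (by fun_prop)).aestronglyMeasurable.smul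
      hf.sm.aestronglyMeasurable) (ae_of_all _ fun y => ?_)
    rw [norm_smul, Real.norm_of_nonneg (heatKernel_pos ht _).le]
    gcongr
    · exact (heatKernel_pos ht _).le
    · exact hM y
  · have h1 : Continuous fun y : E3 =>
        (-(1 / (2 * t)) * heatKernel t (x₀ - y)) • innerSL ℝ (x₀ - y) := by
      have := continuous_heatKernel t
      fun_prop
    have h2 := (ContinuousLinearMap.smulRightL ℝ E3 E).continuous₂.comp_stronglyMeasurable
      (h1.stronglyMeasurable.prodMk hf.sm)
    exact h2.aestronglyMeasurable
  · exact ((integrable_exp_neg_mul_norm_sq (b := 1 / (16 * t)) (by positivity)).comp_sub_right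
      x₀).const_mul _
  · refine ae_of_all _ fun y x _ => ?_
    have := (hasFDerivAt_heatKernel ht.ne' (x - y)).comp x ((hasFDerivAt_id x).sub_const y)
    exact this.smul_const (f y)

/-- The constant in the gradient bound of the heat semigroup. -/
def gradConst : ℝ := (∫ y, ‖y‖ ∂gauss) / 2

theorem gradConst_nonneg : 0 ≤ gradConst :=
  div_nonneg (integral_nonneg fun _ => norm_nonneg _) (by norm_num)

/-- The rate t^(-1/2) is integrable at 0; this is what gives the Duhamel integral of a merely
bounded source a spatial gradient. -/
theorem norm_heatGrad_le {f : E3 → E} {M : ℝ} (hM : ∀ x, ‖f x‖ ≤ M) {t : ℝ} (ht : 0 < t) (x : E3) :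
    ‖heatGrad t f x‖ ≤ gradConst * M * t ^ (-(1 / 2) : ℝ) := by
  have h1 : ‖∫ y, (innerSL ℝ y).smulRight (f (x - √t • y)) ∂gauss‖ ≤ ∫ y, ‖y‖ * M ∂gauss := by
    refine norm_integral_le_of_norm_le (integrable_gauss_norm.mul_const M) (ae_of_all _ fun y => ?_)
    rw [ContinuousLinearMap.norm_smulRight_apply, innerSL_apply_norm]
    gcongr
    exact hM _
  rw [integral_mul_const] at h1
  rw [heatGrad, norm_smul, norm_neg, Real.norm_of_nonneg (by positivity), gradConst,
    Real.rpow_neg ht.le, ← Real.sqrt_eq_rpow]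
  calc _ ≤ 1 / (2 * √t) * ((∫ y, ‖y‖ ∂gauss) * M) := by gcongr
    _ = _ := by ring

/-- A single dominated convergence argument for the semigroup (L constant) and for its gradient (L y
= ⟨y, ·⟩ ⊗ ·). The hypothesis on `g` is joint convergence, since the point at which `g p` is
evaluated moves with p. -/
theorem tendsto_gauss_integral {X W : Type*} [NormedAddCommGroup W] [NormedSpace ℝ W]
    {l : Filter X} [l.IsCountablyGenerated] {L : E3 → E →L[ℝ] W} (hL : Continuous L)
    (hLi : Integrable (fun y => ‖L y‖) gauss) {τ : X → ℝ} {ξ : X → E3} {g : X → E3 → E} {τ₀ : ℝ}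
    {ξ₀ : E3} {g₀ : E3 → E} {M : ℝ} (hτ : Tendsto τ l (𝓝 τ₀)) (hξ : Tendsto ξ l (𝓝 ξ₀))
    (hM : ∀ᶠ p in l, ∀ y, ‖g p y‖ ≤ M) (hm : ∀ᶠ p in l, StronglyMeasurable (g p))
    (hg : ∀ y, Tendsto (fun q : X × E3 => g q.1 q.2) (l ×ˢ 𝓝 y) (𝓝 (g₀ y))) :
    Tendsto (fun p => ∫ y, L y (g p (ξ p - √(τ p) • y)) ∂gauss) l
      (𝓝 (∫ y, L y (g₀ (ξ₀ - √τ₀ • y)) ∂gauss)) := by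
  refine tendsto_integral_filter_of_dominated_convergence (fun y => ‖L y‖ * M) ?_ ?_
    (hLi.mul_const M) (ae_of_all _ fun y => ?_)
  · filter_upwards [hm] with p hp
    have h2 : StronglyMeasurable fun y => g p (ξ p - √(τ p) • y) :=
      hp.comp_measurable (by fun_prop)
    exact (isBoundedBilinearMap_apply.continuous.comp_stronglyMeasurable
      (hL.stronglyMeasurable.prodMk h2)).aestronglyMeasurable
  · filter_upwards [hM] with p hp
    exact ae_of_all _ fun y => (L y).le_of_opNorm_le_of_le le_rfl (hp _)
  · refine ((L y).continuous.tendsto _).comp ?_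
    refine (hg _).comp (tendsto_id.prodMk ?_)
    exact hξ.sub (((Real.continuous_sqrt.tendsto _).comp hτ).smul_const y)

theorem tendsto_heat {X : Type*} {l : Filter X} [l.IsCountablyGenerated]
    {τ : X → ℝ} {ξ : X → E3} {g : X → E3 → E} {τ₀ : ℝ}
    {ξ₀ : E3} {g₀ : E3 → E} {M : ℝ} (hτ : Tendsto τ l (𝓝 τ₀)) (hξ : Tendsto ξ l (𝓝 ξ₀))
    (hM : ∀ᶠ p in l, ∀ y, ‖g p y‖ ≤ M) (hm : ∀ᶠ p in l, StronglyMeasurable (g p))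
    (hg : ∀ y, Tendsto (fun q : X × E3 => g q.1 q.2) (l ×ˢ 𝓝 y) (𝓝 (g₀ y))) :
    Tendsto (fun p => heat (τ p) (g p) (ξ p)) l (𝓝 (heat τ₀ g₀ ξ₀)) :=
  tendsto_gauss_integral (L := fun _ => ContinuousLinearMap.id ℝ E) continuous_const
    (integrable_const _) hτ hξ hM hm hg

theorem tendsto_heatGrad {X : Type*} {l : Filter X} [l.IsCountablyGenerated]
    {τ : X → ℝ} {ξ : X → E3} {g : X → E3 → E} {τ₀ : ℝ} (h₀ : 0 < τ₀)
    {ξ₀ : E3} {g₀ : E3 → E} {M : ℝ} (hτ : Tendsto τ l (𝓝 τ₀)) (hξ : Tendsto ξ l (𝓝 ξ₀))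
    (hM : ∀ᶠ p in l, ∀ y, ‖g p y‖ ≤ M) (hm : ∀ᶠ p in l, StronglyMeasurable (g p))
    (hg : ∀ y, Tendsto (fun q : X × E3 => g q.1 q.2) (l ×ˢ 𝓝 y) (𝓝 (g₀ y))) :
    Tendsto (fun p => heatGrad (τ p) (g p) (ξ p)) l (𝓝 (heatGrad τ₀ g₀ ξ₀)) := by
  have hs := ((Real.continuous_sqrt.tendsto _).comp hτ).const_mul 2
  have hs0 : 2 * √τ₀ ≠ 0 := by have := Real.sqrt_pos.2 h₀; positivity
  refine (((tendsto_const_nhds (x := (1 : ℝ))).div hs hs0).neg).smul ?_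
  have hL : Continuous fun y : E3 => ContinuousLinearMap.smulRightL ℝ E3 E (innerSL ℝ y) := by
    fun_prop
  refine tendsto_gauss_integral (L := fun y => ContinuousLinearMap.smulRightL ℝ E3 E (innerSL ℝ y))
    hL ?_ hτ hξ hM hm hg
  refine integrable_gauss_norm.mono' hL.norm.aestronglyMeasurable (ae_of_all _ fun y => ?_)
  rw [norm_norm]
  refine ContinuousLinearMap.opNorm_le_bound _ (norm_nonneg _) fun v => ?_
  rw [ContinuousLinearMap.smulRightL_apply_apply, ContinuousLinearMap.norm_smulRight_apply,
    innerSL_apply_norm]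

/-- For bounded measurable data, `heat t f` is jointly continuous in `(t, x)` for `t > 0`. -/
theorem continuousAt_heat_of_continuous {f : E3 → E} (hf : IsBddMeas f) (hc : Continuous f)
    (p : ℝ × E3) : ContinuousAt (fun p : ℝ × E3 => heat p.1 f p.2) p := by
  obtain ⟨M, hM⟩ := hf.bdd
  exact tendsto_heat (g := fun _ => f) (g₀ := f) (M := M) continuousAt_fst continuousAt_snd
    (Eventually.of_forall fun _ => hM) (Eventually.of_forall fun _ => hf.sm)
    fun y => (hc.tendsto y).comp tendsto_snd

theorem continuous_heat [CompleteSpace E] {t : ℝ} (ht : 0 < t) {f : E3 → E} (hf : IsBddMeas f) :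
    Continuous (heat t f) :=
  continuous_iff_continuousAt.2 fun x => (hasFDerivAt_heat ht hf x).continuousAt

/-- After half of the time has elapsed the data are continuous, so the semigroup law reduces the
claim to continuous data. -/
theorem continuousAt_heat [CompleteSpace E] {f : E3 → E} (hf : IsBddMeas f) {p : ℝ × E3}
    (hp : 0 < p.1) : ContinuousAt (fun p : ℝ × E3 => heat p.1 f p.2) p := by
  have h2 : 0 < p.1 / 2 := half_pos hp
  have h := continuousAt_heat_of_continuous (hf.heat (p.1 / 2)) (continuous_heat h2 hf)
    (p.1 - p.1 / 2, p.2)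
  have h3 : ContinuousAt (fun q : ℝ × E3 => heat (q.1 - p.1 / 2) (heat (p.1 / 2) f) q.2) p :=
    ContinuousAt.comp (f := fun q : ℝ × E3 => (q.1 - p.1 / 2, q.2))
      (g := fun p_1 : ℝ × E3 => heat p_1.1 (heat (p.1 / 2) f) p_1.2) h (by fun_prop)
  refine h3.congr ?_
  have : ∀ᶠ q : ℝ × E3 in 𝓝 p, p.1 / 2 < q.1 :=
    continuousAt_fst.eventually_const_lt (by linarith)
  filter_upwards [this] with q hq
  rw [heat_heat hf (by linarith) h2.le]
  congr 1
  ring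

theorem heatGrad_eq [CompleteSpace E] {f : E3 → E} (hf : IsBddMeas f) {s t : ℝ} (hs : 0 < s)
    (hst : s < t) (x : E3) : heatGrad (t - s) (heat s f) x = heatGrad t f x := by
  have h1 := hasFDerivAt_heat (sub_pos.2 hst) (hf.heat s) x
  rw [heat_heat hf (sub_pos.2 hst).le hs.le, sub_add_cancel] at h1
  exact h1.unique (hasFDerivAt_heat (hs.trans hst) hf x)

theorem continuousAt_heatGrad [CompleteSpace E] {f : E3 → E} (hf : IsBddMeas f) {p : ℝ × E3}
    (hp : 0 < p.1) : ContinuousAt (fun p : ℝ × E3 => heatGrad p.1 f p.2) p := by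
  have h2 : 0 < p.1 / 2 := half_pos hp
  obtain ⟨M, hM⟩ := (hf.heat (p.1 / 2)).bdd
  have h3 : ContinuousAt (fun q : ℝ × E3 => heatGrad (q.1 - p.1 / 2) (heat (p.1 / 2) f) q.2) p := by
    refine tendsto_heatGrad (g := fun _ => heat (p.1 / 2) f) (M := M)
      (by linarith : 0 < p.1 - p.1 / 2) (continuousAt_fst.sub_const _) continuousAt_snd
      (Eventually.of_forall fun _ => hM) (Eventually.of_forall fun _ => (hf.heat _).sm)
      fun y => ((continuous_heat h2 hf).tendsto y).comp tendsto_snd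
  refine h3.congr ?_
  have : ∀ᶠ q : ℝ × E3 in 𝓝 p, p.1 / 2 < q.1 :=
    continuousAt_fst.eventually_const_lt (by linarith)
  filter_upwards [this] with q hq
  exact heatGrad_eq hf h2 hq q.2

theorem hasFDerivAt_heat_of_hasFDerivAt {f : E3 → E} {f' : E3 → E3 →L[ℝ] E}
    (hf : IsBddMeas f) (hf' : IsBddMeas f') (h : ∀ x, HasFDerivAt f (f' x) x) (t : ℝ) (x : E3) :
    HasFDerivAt (heat t f) (heat t f' x) x := by
  obtain ⟨M, hM⟩ := hf'.bdd
  refine hasFDerivAt_integral_of_dominated_of_fderiv_le (μ := gauss) (𝕜 := ℝ)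
    (F := fun x y => f (x - √t • y)) (F' := fun x y => f' (x - √t • y)) (bound := fun _ => M)
    univ_mem (Eventually.of_forall fun x => (hf.integrable t x).aestronglyMeasurable)
    (hf.integrable t x) (hf'.integrable t x).aestronglyMeasurable
    (ae_of_all _ fun y x _ => hM _) (integrable_const _) (ae_of_all _ fun y x _ => ?_)
  exact (h _).comp x ((hasFDerivAt_id x).sub_const _)

/-- For differentiable data the derivative may fall on the data instead of the kernel; both are the
derivative of the same function. This turns the gradient of the integral equation into an integral
equation for the gradient. -/
theorem heatGrad_eq_heat [CompleteSpace E] {f : E3 → E} {f' : E3 → E3 →L[ℝ] E}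
    (hf : IsBddMeas f) (hf' : IsBddMeas f') (h : ∀ x, HasFDerivAt f (f' x) x) {t : ℝ} (ht : 0 < t)
    (x : E3) : heatGrad t f x = heat t f' x :=
  (hasFDerivAt_heat ht hf x).unique (hasFDerivAt_heat_of_hasFDerivAt hf hf' h t x)

end QTensor
end

/-! ### The Duhamel integral -/

noncomputable section


namespace QTensor

variable {E : Type*} [NormedAddCommGroup E] [NormedSpace ℝ E]

/-- Extending the integrand by zero beyond the moving endpoint fixes the domain of integration; for
given (t, x) the extension can fail to be continuous only at τ = t, a null set, so dominated
convergence applies. -/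
theorem continuousOn_intervalIntegral_of_dominated {W : Type*} [NormedAddCommGroup W]
    [NormedSpace ℝ W] {T : ℝ} {k : ℝ → ℝ → E3 → W} {b : ℝ → ℝ} (hb : IntegrableOn b (Ioo 0 T))
    (hk : ∀ τ t x, 0 < τ → τ < t → t < T → ‖k τ t x‖ ≤ b τ)
    (hm : ∀ t x, 0 < t → t < T → ContinuousOn (fun τ => k τ t x) (Ioo 0 t))
    (hc : ∀ τ t x, 0 < τ → τ < t → t < T → ContinuousAt (fun p : ℝ × E3 => k τ p.1 p.2) (t, x)) :
    ContinuousOn (fun p : ℝ × E3 => ∫ τ in (0 : ℝ)..p.1, k τ p.1 p.2) (Ioo 0 T ×ˢ univ) := by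
  have hopen : IsOpen (Ioo 0 T ×ˢ (univ : Set E3)) := isOpen_Ioo.prod isOpen_univ
  have key : ContinuousOn (fun p : ℝ × E3 => ∫ τ in Ioo 0 T,
      (Ioo 0 p.1).indicator (fun τ => k τ p.1 p.2) τ) (Ioo 0 T ×ˢ univ) := by
    rintro ⟨t, x⟩ ⟨ht, -⟩
    refine ContinuousAt.continuousWithinAt ?_
    have hnear : ∀ᶠ p : ℝ × E3 in 𝓝 (t, x), p ∈ Ioo 0 T ×ˢ (univ : Set E3) :=
      hopen.mem_nhds ⟨ht, mem_univ _⟩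
    refine tendsto_integral_filter_of_dominated_convergence (fun τ => |b τ|) ?_ ?_ hb.abs ?_
    · filter_upwards [hnear] with p hp
      exact (aestronglyMeasurable_indicator_iff measurableSet_Ioo).2
        (((hm p.1 p.2 hp.1.1 hp.1.2).aestronglyMeasurable measurableSet_Ioo).mono_measure
          (Measure.restrict_mono le_rfl Measure.restrict_le_self))
    · filter_upwards [hnear] with p hp
      refine ae_of_all _ fun τ => ?_
      by_cases h : τ ∈ Ioo 0 p.1
      · rw [indicator_of_mem h]
        exact (hk τ _ _ h.1 h.2 hp.1.2).trans (le_abs_self _)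
      · rw [indicator_of_notMem h, norm_zero]
        exact abs_nonneg _
    · have hne : ∀ᵐ τ ∂(volume.restrict (Ioo 0 T)), τ ≠ t :=
        ae_restrict_of_ae (Measure.ae_ne volume t)
      filter_upwards [hne, ae_restrict_mem measurableSet_Ioo] with τ hτ hτm
      rcases lt_or_gt_of_ne hτ with h | h
      · have h1 : ∀ᶠ p : ℝ × E3 in 𝓝 (t, x), τ < p.1 := continuousAt_fst.eventually_const_lt h
        rw [indicator_of_mem (show τ ∈ Ioo 0 (t, x).1 from ⟨hτm.1, h⟩)]
        refine (hc τ t x hτm.1 h ht.2).tendsto.congr' ?_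
        filter_upwards [h1] with p hp
        rw [indicator_of_mem (show τ ∈ Ioo 0 p.1 from ⟨hτm.1, hp⟩)]
      · have h1 : ∀ᶠ p : ℝ × E3 in 𝓝 (t, x), p.1 < τ := continuousAt_fst.eventually_lt_const h
        rw [indicator_of_notMem (show τ ∉ Ioo 0 (t, x).1 from fun h' => (h'.2.trans h).false)]
        refine tendsto_const_nhds.congr' ?_
        filter_upwards [h1] with p hp
        rw [indicator_of_notMem (show τ ∉ Ioo 0 p.1 from fun h' => (h'.2.trans hp).false)]
  refine key.congr fun p hp => ?_
  simp only
  rw [intervalIntegral.integral_of_le hp.1.1.le, integral_Ioc_eq_integral_Ioo,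
    setIntegral_indicator measurableSet_Ioo,
    inter_eq_self_of_subset_right (Ioo_subset_Ioo_right hp.1.2.le)]

/-- A bounded continuous source term on `(0, T) × ℝ³`. -/
structure IsSource (T : ℝ) (F : ℝ → E3 → E) (M : ℝ) : Prop where
  cont : ContinuousOn (fun p : ℝ × E3 => F p.1 p.2) (Ioo 0 T ×ˢ univ)
  bdd : ∀ t ∈ Ioo 0 T, ∀ x, ‖F t x‖ ≤ M

namespace IsSource

variable {T M : ℝ} {F : ℝ → E3 → E}

omit [NormedSpace ℝ E] in
theorem continuousAt (hF : IsSource T F M) {t : ℝ} (ht : t ∈ Ioo 0 T) (x : E3) :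
    ContinuousAt (fun p : ℝ × E3 => F p.1 p.2) (t, x) :=
  hF.cont.continuousAt ((isOpen_Ioo.prod isOpen_univ).mem_nhds ⟨ht, mem_univ _⟩)

omit [NormedSpace ℝ E] in
theorem continuous (hF : IsSource T F M) {t : ℝ} (ht : t ∈ Ioo 0 T) : Continuous (F t) :=
  continuous_iff_continuousAt.2 fun x =>
    (hF.continuousAt ht x).comp (f := fun x => (t, x)) (by fun_prop)

omit [NormedSpace ℝ E] in
theorem isBddMeas (hF : IsSource T F M) {t : ℝ} (ht : t ∈ Ioo 0 T) : IsBddMeas (F t) :=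
  ⟨(hF.continuous ht).stronglyMeasurable, M, hF.bdd t ht⟩

theorem tendsto_heat (hF : IsSource T F M) {X : Type*} {l : Filter X} [l.IsCountablyGenerated]
    {τ s : X → ℝ} {ξ : X → E3} {τ₀ s₀ : ℝ} {ξ₀ : E3} (hs₀ : s₀ ∈ Ioo 0 T)
    (hτ : Tendsto τ l (𝓝 τ₀)) (hs : Tendsto s l (𝓝 s₀)) (hξ : Tendsto ξ l (𝓝 ξ₀)) :
    Tendsto (fun p => heat (τ p) (F (s p)) (ξ p)) l (𝓝 (heat τ₀ (F s₀) ξ₀)) := by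
  have hev : ∀ᶠ p in l, s p ∈ Ioo 0 T := hs.eventually (isOpen_Ioo.mem_nhds hs₀)
  exact QTensor.tendsto_heat (M := M) hτ hξ (hev.mono fun p hp => hF.bdd _ hp)
    (hev.mono fun p hp => (hF.isBddMeas hp).sm)
    fun y => (hF.continuousAt hs₀ y).tendsto.comp ((hs.comp tendsto_fst).prodMk_nhds tendsto_snd)

theorem tendsto_heatGrad (hF : IsSource T F M) {X : Type*} {l : Filter X} [l.IsCountablyGenerated]
    {τ s : X → ℝ} {ξ : X → E3} {τ₀ s₀ : ℝ} {ξ₀ : E3} (hs₀ : s₀ ∈ Ioo 0 T) (hτ₀ : 0 < τ₀)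
    (hτ : Tendsto τ l (𝓝 τ₀)) (hs : Tendsto s l (𝓝 s₀)) (hξ : Tendsto ξ l (𝓝 ξ₀)) :
    Tendsto (fun p => heatGrad (τ p) (F (s p)) (ξ p)) l (𝓝 (heatGrad τ₀ (F s₀) ξ₀)) := by
  have hev : ∀ᶠ p in l, s p ∈ Ioo 0 T := hs.eventually (isOpen_Ioo.mem_nhds hs₀)
  exact QTensor.tendsto_heatGrad (M := M) hτ₀ hτ hξ (hev.mono fun p hp => hF.bdd _ hp)
    (hev.mono fun p hp => (hF.isBddMeas hp).sm)
    fun y => (hF.continuousAt hs₀ y).tendsto.comp ((hs.comp tendsto_fst).prodMk_nhds tendsto_snd)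

end IsSource

/-- The Duhamel integral `∫₀ᵗ e^(τΔ) F(t - τ) dτ`. -/
def duhamel (F : ℝ → E3 → E) (t : ℝ) (x : E3) : E := ∫ τ in (0 : ℝ)..t, heat τ (F (t - τ)) x

/-- The gradient of the Duhamel integral. -/
def duhamelGrad (F : ℝ → E3 → E) (t : ℝ) (x : E3) : E3 →L[ℝ] E :=
  ∫ τ in (0 : ℝ)..t, heatGrad τ (F (t - τ)) x

theorem sub_mem_Ioo_of {T t τ : ℝ} (h0 : 0 < τ) (h : τ < t) (ht : t < T) : t - τ ∈ Ioo 0 T :=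
  ⟨by linarith, by linarith⟩

theorem integrableOn_rpow_neg_half (T : ℝ) :
    IntegrableOn (fun τ : ℝ => τ ^ (-(1 / 2) : ℝ)) (Ioo 0 T) := by
  rcases le_total T 0 with h | h
  · simp [Ioo_eq_empty (not_lt.2 h)]
  · exact ((intervalIntegrable_iff_integrableOn_Ioo_of_le h).1
      (intervalIntegral.intervalIntegrable_rpow' (by norm_num)))

namespace IsSource

variable {T M : ℝ} {F : ℝ → E3 → E}

theorem continuousOn_heat (hF : IsSource T F M) {t : ℝ} (htT : t < T) (x : E3) :
    ContinuousOn (fun τ => heat τ (F (t - τ)) x) (Ioo 0 t) := fun τ hτ =>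
  ContinuousAt.continuousWithinAt (hF.tendsto_heat (s := fun τ => t - τ)
    (sub_mem_Ioo_of hτ.1 hτ.2 htT) tendsto_id (tendsto_const_nhds.sub tendsto_id)
    tendsto_const_nhds)

theorem continuousOn_heatGrad (hF : IsSource T F M) {t : ℝ} (htT : t < T) (x : E3) :
    ContinuousOn (fun τ => heatGrad τ (F (t - τ)) x) (Ioo 0 t) := fun τ hτ =>
  ContinuousAt.continuousWithinAt (hF.tendsto_heatGrad (s := fun τ => t - τ)
    (sub_mem_Ioo_of hτ.1 hτ.2 htT) hτ.1 tendsto_id (tendsto_const_nhds.sub tendsto_id)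
    tendsto_const_nhds)

theorem intervalIntegrable_heat (hF : IsSource T F M) {t : ℝ} (ht0 : 0 ≤ t) (htT : t < T) (x : E3) :
    IntervalIntegrable (fun τ => heat τ (F (t - τ)) x) volume 0 t := by
  rw [intervalIntegrable_iff_integrableOn_Ioo_of_le ht0]
  refine IntegrableOn.of_bound (by simp) ((hF.continuousOn_heat htT x).aestronglyMeasurable
    measurableSet_Ioo) M ?_
  filter_upwards [ae_restrict_mem measurableSet_Ioo] with τ hτ
  exact norm_heat_le (hF.bdd _ (sub_mem_Ioo_of hτ.1 hτ.2 htT)) _ _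

theorem continuousOn_duhamel (hF : IsSource T F M) :
    ContinuousOn (fun p : ℝ × E3 => duhamel F p.1 p.2) (Ioo 0 T ×ˢ univ) := by
  refine continuousOn_intervalIntegral_of_dominated (b := fun _ => M)
    (k := fun τ t x => heat τ (F (t - τ)) x) (integrableOn_const (by simp)) ?_ ?_ ?_
  · exact fun τ t x h0 h1 h2 => norm_heat_le (hF.bdd _ (sub_mem_Ioo_of h0 h1 h2)) _ _
  · exact fun _ x _ htT => hF.continuousOn_heat htT x
  · exact fun τ t x h0 h1 h2 => hF.tendsto_heat (s := fun p : ℝ × E3 => p.1 - τ)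
      (sub_mem_Ioo_of h0 h1 h2) tendsto_const_nhds (continuousAt_fst.sub continuousAt_const)
      continuousAt_snd

theorem continuousOn_duhamelGrad (hF : IsSource T F M) :
    ContinuousOn (fun p : ℝ × E3 => duhamelGrad F p.1 p.2) (Ioo 0 T ×ˢ univ) := by
  refine continuousOn_intervalIntegral_of_dominated
    (b := fun τ => gradConst * M * τ ^ (-(1 / 2) : ℝ))
    (k := fun τ t x => heatGrad τ (F (t - τ)) x)
    ((integrableOn_rpow_neg_half T).const_mul _) ?_ ?_ ?_
  · exact fun τ t x h0 h1 h2 => norm_heatGrad_le (hF.bdd _ (sub_mem_Ioo_of h0 h1 h2)) h0 _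
  · exact fun t x _ htT => hF.continuousOn_heatGrad htT x
  · exact fun τ t x h0 h1 h2 => hF.tendsto_heatGrad (s := fun p : ℝ × E3 => p.1 - τ)
      (sub_mem_Ioo_of h0 h1 h2) h0 tendsto_const_nhds (continuousAt_fst.sub continuousAt_const)
      continuousAt_snd

theorem norm_duhamel_le (hF : IsSource T F M) {t : ℝ} (ht : t ∈ Ioo 0 T) (x : E3) :
    ‖duhamel F t x‖ ≤ M * t := by
  rw [duhamel, intervalIntegral.integral_of_le ht.1.le, integral_Ioc_eq_integral_Ioo]
  refine (norm_setIntegral_le_of_norm_le_const (C := M) (by simp) fun τ hτ =>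
    norm_heat_le (hF.bdd _ (sub_mem_Ioo_of hτ.1 hτ.2 ht.2)) _ _).trans ?_
  simp [Measure.real, ht.1.le]

theorem norm_duhamelGrad_le (hF : IsSource T F M) {t : ℝ} (ht : t ∈ Ioo 0 T) (x : E3) :
    ‖duhamelGrad F t x‖ ≤ ∫ τ in Ioo 0 T, gradConst * M * τ ^ (-(1 / 2) : ℝ) := by
  have hM : 0 ≤ M := (norm_nonneg _).trans (hF.bdd t ht 0)
  rw [duhamelGrad, intervalIntegral.integral_of_le ht.1.le, integral_Ioc_eq_integral_Ioo]
  refine (norm_integral_le_of_norm_le ((integrableOn_rpow_neg_half t).const_mul (gradConst * M))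
    ?_).trans ?_
  · filter_upwards [ae_restrict_mem measurableSet_Ioo] with τ hτ
    exact norm_heatGrad_le (hF.bdd _ (sub_mem_Ioo_of hτ.1 hτ.2 ht.2)) hτ.1 _
  · refine setIntegral_mono_set ((integrableOn_rpow_neg_half T).const_mul _) ?_
      (Ioo_subset_Ioo_right ht.2.le).eventuallyLE
    filter_upwards [ae_restrict_mem measurableSet_Ioo] with τ hτ
    have := gradConst_nonneg
    have := hτ.1
    positivity

theorem hasFDerivAt_duhamel [CompleteSpace E] (hF : IsSource T F M) {t : ℝ} (ht : t ∈ Ioo 0 T)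
    (x : E3) : HasFDerivAt (duhamel F t) (duhamelGrad F t x) x := by
  have e : uIoc 0 t = Ioc 0 t := uIoc_of_le ht.1.le
  have hr : (volume : Measure ℝ).restrict (uIoc 0 t) = volume.restrict (Ioo 0 t) := by
    rw [e, restrict_Ioo_eq_restrict_Ioc]
  refine intervalIntegral.hasFDerivAt_integral_of_dominated_of_fderiv_le
    (F := fun x τ => heat τ (F (t - τ)) x) (F' := fun x τ => heatGrad τ (F (t - τ)) x)
    (bound := fun τ => gradConst * M * τ ^ (-(1 / 2) : ℝ)) univ_mem
    (Eventually.of_forall fun x => ?_) (hF.intervalIntegrable_heat ht.1.le ht.2 x) ?_ ?_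
    ((intervalIntegral.intervalIntegrable_rpow' (by norm_num)).const_mul _) ?_
  · rw [hr]
    exact (hF.continuousOn_heat ht.2 x).aestronglyMeasurable measurableSet_Ioo
  · rw [hr]
    exact (hF.continuousOn_heatGrad ht.2 x).aestronglyMeasurable measurableSet_Ioo
  -- At τ = t the source would be evaluated at time 0, where nothing is known about it; that point
  -- is discarded as a null set.
  · have : ∀ᵐ τ ∂(volume : Measure ℝ), τ ≠ t := Measure.ae_ne volume t
    filter_upwards [this] with τ hne hτ x _
    rw [e] at hτ
    exact norm_heatGrad_le (hF.bdd _ (sub_mem_Ioo_of hτ.1 (lt_of_le_of_ne hτ.2 hne) ht.2)) hτ.1 _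
  · have : ∀ᵐ τ ∂(volume : Measure ℝ), τ ≠ t := Measure.ae_ne volume t
    filter_upwards [this] with τ hne hτ x _
    rw [e] at hτ
    exact hasFDerivAt_heat hτ.1
      (hF.isBddMeas (sub_mem_Ioo_of hτ.1 (lt_of_le_of_ne hτ.2 hne) ht.2)) x

/-- The semigroup passes through the Duhamel integral. -/
theorem heat_duhamel (hF : IsSource T F M) {ε r : ℝ} (hε : ε ∈ Ioo 0 T) (hr : 0 < r) (x : E3) :
    heat r (duhamel F ε) x = ∫ σ in (0 : ℝ)..ε, heat (r + σ) (F (ε - σ)) x := by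
  have e : ∀ y, duhamel F ε y = ∫ σ in Ioo 0 ε, heat σ (F (ε - σ)) y := fun y => by
    rw [duhamel, intervalIntegral.integral_of_le hε.1.le, integral_Ioc_eq_integral_Ioo]
  rw [intervalIntegral.integral_of_le hε.1.le, integral_Ioc_eq_integral_Ioo]
  unfold heat at *
  simp_rw [e]
  rw [integral_integral_swap]
  · refine setIntegral_congr_fun measurableSet_Ioo fun σ hσ => ?_
    exact congrFun (heat_heat (hF.isBddMeas (sub_mem_Ioo_of hσ.1 hσ.2 hε.2)) hr.le hσ.1.le) x
  · have hc : ContinuousOn (fun p : E3 × ℝ => heat p.2 (F (ε - p.2)) (x - √r • p.1))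
        (univ ×ˢ Ioo 0 ε) := by
      rintro ⟨y, σ⟩ ⟨-, hσ⟩
      refine ContinuousAt.continuousWithinAt (hF.tendsto_heat (s := fun p : E3 × ℝ => ε - p.2)
        (ξ := fun p : E3 × ℝ => x - √r • p.1)
        (sub_mem_Ioo_of hσ.1 hσ.2 hε.2) continuousAt_snd ?_ ?_)
      · exact (continuous_const.sub continuous_snd).tendsto (y, σ)
      · exact (by fun_prop : Continuous fun p : E3 × ℝ => x - √r • p.1).tendsto (y, σ)
    have hmeas : (gauss.prod (volume.restrict (Ioo 0 ε))) =
        (gauss.prod volume).restrict (univ ×ˢ Ioo 0 ε) := by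
      rw [← Measure.prod_restrict, Measure.restrict_univ]
    refine Integrable.of_bound (C := M) ?_ ?_
    · rw [hmeas]
      exact hc.aestronglyMeasurable (MeasurableSet.univ.prod measurableSet_Ioo)
    · rw [hmeas]
      filter_upwards [ae_restrict_mem (MeasurableSet.univ.prod measurableSet_Ioo)] with p hp
      exact norm_heat_le (hF.bdd _ (sub_mem_Ioo_of hp.2.1 hp.2.2 hε.2)) _ _

/-- Restarting at time ε: the part τ < r sees only sources later than ε, and in the part τ > r a
factor e^(rΔ) can be pulled out. All regularity arguments rest on it, because smoothness is
available only after a positive time. -/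
theorem duhamel_add (hF : IsSource T F M) {ε r : ℝ} (hε : 0 < ε) (hr : 0 < r) (h : ε + r < T)
    (x : E3) : duhamel F (ε + r) x =
      heat r (duhamel F ε) x + duhamel (fun s => F (ε + s)) r x := by
  have hi := hF.intervalIntegrable_heat (by positivity : 0 ≤ ε + r) h x
  have h1 : IntervalIntegrable (fun τ => heat τ (F (ε + r - τ)) x) volume 0 r :=
    hi.mono_set (by
      rw [uIcc_of_le hr.le, uIcc_of_le (by positivity)]
      exact Icc_subset_Icc le_rfl (by linarith))
  have h2 : IntervalIntegrable (fun τ => heat τ (F (ε + r - τ)) x) volume r (ε + r) :=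
    hi.mono_set (by
      rw [uIcc_of_le (by linarith), uIcc_of_le (by positivity)]
      exact Icc_subset_Icc hr.le le_rfl)
  rw [duhamel, ← intervalIntegral.integral_add_adjacent_intervals h1 h2,
    hF.heat_duhamel ⟨hε, by linarith⟩ hr, add_comm]
  congr 1
  · have := intervalIntegral.integral_comp_add_left
      (fun τ => heat τ (F (ε + r - τ)) x) r (a := 0) (b := ε)
    rw [add_zero, add_comm r ε] at this
    rw [← this]
    congr 1
    ext σ
    congr 2
    ring
  · rw [duhamel]
    congr 1
    ext τ
    congr 2
    ring

theorem shift (hF : IsSource T F M) {ε : ℝ} (hε : 0 < ε) :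
    IsSource (T - ε) (fun s => F (ε + s)) M := by
  refine ⟨?_, fun t ht => hF.bdd _ ⟨by linarith [ht.1], by linarith [ht.2]⟩⟩
  refine hF.cont.comp (f := fun p : ℝ × E3 => (ε + p.1, p.2)) (by fun_prop) ?_
  exact fun p hp => ⟨⟨by linarith [hp.1.1], by linarith [hp.1.2]⟩, mem_univ _⟩

end IsSource

end QTensor
end

/-! ### The Laplacian as generator of the heat semigroup -/

noncomputable section


namespace QTensor

/-- The trace of a second derivative. -/
def secondTrace {E : Type*} [NormedAddCommGroup E] [NormedSpace ℝ E] :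
    (E3 →L[ℝ] E3 →L[ℝ] E) →L[ℝ] E :=
  ∑ i : Fin 3, (ContinuousLinearMap.apply ℝ E (EuclideanSpace.basisFun (Fin 3) ℝ i)).comp
    (ContinuousLinearMap.apply ℝ (E3 →L[ℝ] E) (EuclideanSpace.basisFun (Fin 3) ℝ i))

theorem secondTrace_apply {E : Type*} [NormedAddCommGroup E] [NormedSpace ℝ E]
    (L : E3 →L[ℝ] E3 →L[ℝ] E) : secondTrace L =
      ∑ i : Fin 3, L (EuclideanSpace.basisFun (Fin 3) ℝ i) (EuclideanSpace.basisFun (Fin 3) ℝ i) := by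
  simp [secondTrace]

theorem norm_secondTrace_le {E : Type*} [NormedAddCommGroup E] [NormedSpace ℝ E]
    (L : E3 →L[ℝ] E3 →L[ℝ] E) : ‖secondTrace L‖ ≤ 3 * ‖L‖ := by
  rw [secondTrace_apply]
  have hi : ∀ i : Fin 3, ‖L (EuclideanSpace.basisFun (Fin 3) ℝ i)
      (EuclideanSpace.basisFun (Fin 3) ℝ i)‖ ≤ ‖L‖ := fun i => ?_
  · exact (norm_sum_le _ _).trans ((Finset.sum_le_sum fun i _ => hi i).trans (by simp))
  have h : ‖EuclideanSpace.basisFun (Fin 3) ℝ i‖ = 1 :=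
    (EuclideanSpace.basisFun (Fin 3) ℝ).norm_eq_one i
  have := (L (EuclideanSpace.basisFun (Fin 3) ℝ i)).le_of_opNorm_le
    (L.le_opNorm _) (EuclideanSpace.basisFun (Fin 3) ℝ i)
  simpa [h] using this

theorem laplacian_eq_secondTrace {E : Type*} [NormedAddCommGroup E] [NormedSpace ℝ E]
    (f : E3 → E) (x : E3) :
    Laplacian.laplacian f x = secondTrace (fderiv ℝ (fderiv ℝ f) x) := by
  rw [InnerProductSpace.laplacian_eq_iteratedFDeriv_orthonormalBasis f
    (EuclideanSpace.basisFun (Fin 3) ℝ), secondTrace_apply]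
  simp [iteratedFDeriv_two_apply]

section HeatSecondOrder

variable {E : Type*} [NormedAddCommGroup E] [NormedSpace ℝ E]

/-- Gaussian integration by parts: the density K satisfies ⟨y, v⟩ K = -2 ∂ᵥK. -/
theorem integral_gauss_coord_smul [CompleteSpace E] {g : E3 → E} {g' : E3 → E3 →L[ℝ] E}
    (hg : IsBddMeas g) (hg' : IsBddMeas g') (h : ∀ x, HasFDerivAt g (g' x) x) (v : E3) :
    ∫ y, (inner ℝ y v : ℝ) • g y ∂gauss = (2 : ℝ) • ∫ y, g' y v ∂gauss := by
  obtain ⟨M, hM⟩ := hg.bdd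
  obtain ⟨M', hM'⟩ := hg'.bdd
  have hd : ∀ y, fderiv ℝ (heatKernel 1) y v = -(1 / 2) * heatKernel 1 y * inner ℝ y v := fun y => by
    rw [(hasFDerivAt_heatKernel one_ne_zero y).fderiv]; simp
  have hgd : ∀ y, fderiv ℝ g y = g' y := fun y => (h y).fderiv
  have i1 : Integrable (fun y => (inner ℝ y v : ℝ) • g y) gauss := by
    refine ((integrable_gauss_norm.mul_const ‖v‖).mul_const M).mono'
      ((by fun_prop : Continuous fun y : E3 => (inner ℝ y v : ℝ)).aestronglyMeasurable.smul
        hg.sm.aestronglyMeasurable) (ae_of_all _ fun y => ?_)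
    rw [norm_smul]
    exact mul_le_mul (norm_inner_le_norm y v) (hM y) (norm_nonneg _) (by positivity)
  have i2 : Integrable (fun y => g' y v) gauss := by
    refine Integrable.of_bound (C := M' * ‖v‖)
      ((ContinuousLinearMap.apply ℝ E v).continuous.comp_stronglyMeasurable
        hg'.sm).aestronglyMeasurable (ae_of_all _ fun y => ?_)
    exact (g' y).le_of_opNorm_le (hM' y) v
  have i3 : Integrable g gauss := Integrable.of_bound hg.sm.aestronglyMeasurable M (ae_of_all _ hM)
  rw [integrable_gauss_iff] at i1 i2 i3
  have key := integral_smul_fderiv_eq_neg_fderiv_smul_of_integrable (μ := (volume : Measure E3))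
    (f := heatKernel 1) (g := g) (v := v) ?_ ?_ i3
    (fun x _ => (hasFDerivAt_heatKernel one_ne_zero x).differentiableAt)
    (fun x _ => (h x).differentiableAt)
  · simp only [hgd, hd] at key
    rw [integral_gauss, integral_gauss, key, ← integral_neg, ← integral_smul]
    congr 1
    ext y
    simp only [smul_smul, ← neg_smul]
    congr 1
    ring
  · simp only [hd]
    convert! i1.smul (-(1 / 2) : ℝ) using 1
    ext y
    simp [smul_smul, mul_assoc]
  · simpa only [hgd] using i2

/-- The variable r = √t avoids the singularity of the square root. Differentiation produces f'(x -
ry)(-y); integrating the factor y by parts yields the Laplacian with the factor 2r, which cancels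
against dr/dt = 1/(2√t) in the heat equation. -/
theorem hasDerivAt_gauss_dilate [CompleteSpace E] {f : E3 → E} {f' : E3 → E3 →L[ℝ] E}
    {f'' : E3 → E3 →L[ℝ] E3 →L[ℝ] E} (hf : IsBddMeas f) (hf' : IsBddMeas f') (hf'' : IsBddMeas f'')
    (h1 : ∀ x, HasFDerivAt f (f' x) x) (h2 : ∀ x, HasFDerivAt f' (f'' x) x) (x : E3) (r : ℝ) :
    HasDerivAt (fun r : ℝ => ∫ y, f (x - r • y) ∂gauss)
      ((2 * r) • ∫ y, secondTrace (f'' (x - r • y)) ∂gauss) r := by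
  obtain ⟨M, hM⟩ := hf.bdd
  obtain ⟨M', hM'⟩ := hf'.bdd
  obtain ⟨M'', hM''⟩ := hf''.bdd
  set e := EuclideanSpace.basisFun (Fin 3) ℝ with he
  have hsm : ∀ s : ℝ, StronglyMeasurable fun y : E3 => f' (x - s • y) := fun s =>
    hf'.sm.comp_measurable (by fun_prop)
  have hsm2 : ∀ s : ℝ, StronglyMeasurable fun y : E3 => f'' (x - s • y) := fun s =>
    hf''.sm.comp_measurable (by fun_prop)
  have key := hasDerivAt_integral_of_dominated_loc_of_deriv_le (μ := gauss) (𝕜 := ℝ) (x₀ := r)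
    (F := fun r y => f (x - r • y)) (F' := fun r y => f' (x - r • y) (-y))
    (bound := fun y => M' * ‖y‖) (s := univ) univ_mem
    (Eventually.of_forall fun s =>
      (hf.sm.comp_measurable (g := fun y : E3 => x - s • y) (by fun_prop)).aestronglyMeasurable)
    (Integrable.of_bound
      (hf.sm.comp_measurable (g := fun y : E3 => x - r • y) (by fun_prop)).aestronglyMeasurable M
      (ae_of_all _ fun y => hM _))
    ?_ (ae_of_all _ fun y s _ => ?_) (integrable_gauss_norm.const_mul M')
    (ae_of_all _ fun y s _ => ?_)
  · refine key.2.congr_deriv ?_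
    have hexp : ∀ y : E3, f' (x - r • y) (-y) =
        ∑ i, (inner ℝ y (e i) : ℝ) • (-(f' (x - r • y) (e i))) := fun y => by
      generalize f' (x - r • y) = L
      conv_lhs => rw [← e.sum_repr' y]
      simp [map_sum, real_inner_comm]
    simp_rw [hexp]
    have hi : ∀ i, IsBddMeas fun y => -(f' (x - r • y) (e i)) := fun i =>
      ⟨((ContinuousLinearMap.apply ℝ E (e i)).continuous.comp_stronglyMeasurable (hsm r)).neg,
        M' * ‖e i‖, fun y => by rw [norm_neg]; exact (f' _).le_of_opNorm_le (hM' _) _⟩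
    have hi' : ∀ i, IsBddMeas fun y => r • ((ContinuousLinearMap.apply ℝ E (e i)).comp
        (f'' (x - r • y))) := fun i =>
      ⟨((ContinuousLinearMap.compL ℝ E3 (E3 →L[ℝ] E) E
          (ContinuousLinearMap.apply ℝ E (e i))).continuous.comp_stronglyMeasurable
          (hsm2 r)).const_smul r,
        ‖r‖ * (‖ContinuousLinearMap.apply ℝ E (e i)‖ * M''), fun y => by
          rw [norm_smul]
          gcongr
          exact (ContinuousLinearMap.opNorm_comp_le _ _).trans (by gcongr; exact hM'' _)⟩
    have hd : ∀ i y, HasFDerivAt (fun y => -(f' (x - r • y) (e i)))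
        (r • ((ContinuousLinearMap.apply ℝ E (e i)).comp (f'' (x - r • y)))) y := fun i y => by
      have a1 : HasFDerivAt (fun y : E3 => x - r • y) (-(r • ContinuousLinearMap.id ℝ E3)) y :=
        ((hasFDerivAt_id y).const_smul r).const_sub x
      have a2 := ((ContinuousLinearMap.apply ℝ E (e i)).hasFDerivAt.comp y
        ((h2 (x - r • y)).comp y a1)).neg
      refine a2.congr_fderiv ?_
      ext v
      simp
    rw [integral_finsetSum]
    · simp_rw [fun i => integral_gauss_coord_smul (hi i) (hi' i) (hd i) (e i)]
      simp_rw [secondTrace_apply]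
      rw [integral_finsetSum, Finset.smul_sum]
      · refine Finset.sum_congr rfl fun i _ => ?_
        simp only [smul_apply, ContinuousLinearMap.comp_apply, ContinuousLinearMap.apply_apply]
        rw [integral_smul, smul_smul]
      · intro i _
        refine Integrable.of_bound (C := M'' * ‖e i‖ * ‖e i‖)
          ((ContinuousLinearMap.apply ℝ E (e i)).continuous.comp_stronglyMeasurable
            ((ContinuousLinearMap.apply ℝ (E3 →L[ℝ] E) (e i)).continuous.comp_stronglyMeasurable
              (hsm2 r))).aestronglyMeasurable (ae_of_all _ fun y => ?_)
        exact (f'' (x - r • y) (e i)).le_of_opNorm_le ((f'' _).le_of_opNorm_le (hM'' _) _) _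
    · intro i _
      obtain ⟨C, hC⟩ := (hi i).bdd
      refine ((integrable_gauss_norm.mul_const ‖e i‖).mul_const C).mono'
        ((by fun_prop : Continuous fun y : E3 => (inner ℝ y (e i) : ℝ)).aestronglyMeasurable.smul
          (hi i).sm.aestronglyMeasurable) (ae_of_all _ fun y => ?_)
      rw [norm_smul]
      exact mul_le_mul (norm_inner_le_norm y _) (hC y) (norm_nonneg _) (by positivity)
  · exact (isBoundedBilinearMap_apply.continuous.comp_stronglyMeasurable
      ((hsm r).prodMk measurable_neg.stronglyMeasurable)).aestronglyMeasurable
  · exact ((f' (x - s • y)).le_of_opNorm_le (hM' _) _).trans_eq (by rw [norm_neg])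
  · have a1 : HasDerivAt (fun s : ℝ => x - s • y) (-y) s := by
      simpa using ((hasDerivAt_id s).smul_const y).const_sub x
    exact (h1 (x - s • y)).comp_hasDerivAt s a1

/-- The chain rule through √h works only for h > 0; the one-sided derivative at 0 is obtained as the
limit of the derivatives at h > 0. -/
theorem hasDerivWithinAt_heat_zero [CompleteSpace E] {f : E3 → E} {f' : E3 → E3 →L[ℝ] E}
    {f'' : E3 → E3 →L[ℝ] E3 →L[ℝ] E} (hf : IsBddMeas f) (hf' : IsBddMeas f') (hf'' : IsBddMeas f'')
    (h1 : ∀ x, HasFDerivAt f (f' x) x) (h2 : ∀ x, HasFDerivAt f' (f'' x) x) (hc : Continuous f'')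
    (x : E3) : HasDerivWithinAt (fun h => heat h f x) (secondTrace (f'' x)) (Ici 0) 0 := by
  have hg : IsBddMeas fun y => secondTrace (f'' y) := by
    obtain ⟨M'', hM''⟩ := hf''.bdd
    exact ⟨secondTrace.continuous.comp_stronglyMeasurable hf''.sm, 3 * M'',
      fun y => (norm_secondTrace_le _).trans (by gcongr; exact hM'' y)⟩
  have hfc : Continuous f := continuous_iff_continuousAt.2 fun y => (h1 y).continuousAt
  have hgc : Continuous fun y => secondTrace (f'' y) := by fun_prop
  have hd : ∀ h : ℝ, 0 < h →
      HasDerivAt (fun h => heat h f x) (heat h (fun y => secondTrace (f'' y)) x) h := fun h hh => by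
    have a := (hasDerivAt_gauss_dilate hf hf' hf'' h1 h2 x (√h)).scomp h
      (Real.hasDerivAt_sqrt hh.ne')
    refine a.congr_deriv ?_
    have : 0 < √h := Real.sqrt_pos.2 hh
    rw [smul_smul, show 1 / (2 * √h) * (2 * √h) = 1 by field_simp, one_smul]
    rfl
  refine hasDerivWithinAt_Ici_of_tendsto_deriv (s := Ioi 0)
    (fun h hh => (hd h hh).differentiableAt.differentiableWithinAt) ?_ self_mem_nhdsWithin ?_
  · exact ((continuousAt_heat_of_continuous hf hfc (0, x)).comp (f := fun h : ℝ => (h, x))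
      (by fun_prop)).continuousWithinAt
  · have a : Tendsto (fun h => heat h (fun y => secondTrace (f'' y)) x) (𝓝 0)
        (𝓝 (secondTrace (f'' x))) := by
      have := (continuousAt_heat_of_continuous hg hgc (0, x)).comp (f := fun h : ℝ => (h, x))
        (by fun_prop)
      simpa [ContinuousAt, heat_zero, Function.comp_def] using this
    refine (a.mono_left nhdsWithin_le_nhds).congr' ?_
    filter_upwards [self_mem_nhdsWithin] with h hh
    exact (hd h hh).deriv.symm

end HeatSecondOrder

end QTensor
end

/-! ### Mild solutions and the system for the gradient -/

noncomputable section


namespace QTensor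

/-- `u` is a bounded mild solution of `∂ₜ u = Δ u + G(u)` on `(0, T) × ℝ³` with datum `u₀`. -/
structure IsMild {E : Type} [NormedAddCommGroup E] [NormedSpace ℝ E]
    (G : E → E) (T : ℝ) (u₀ : E3 → E) (u : ℝ → E3 → E) : Prop where
  init : IsBddMeas u₀
  cont : ContinuousOn (fun p : ℝ × E3 => u p.1 p.2) (Ioo 0 T ×ˢ univ)
  bdd : ∃ M, ∀ t ∈ Ioo 0 T, ∀ x, ‖u t x‖ ≤ M
  eq : ∀ t ∈ Ioo 0 T, ∀ x, u t x = heat t u₀ x + duhamel (fun s y => G (u s y)) t x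

/-- The nonlinearity of the system solved by a solution together with its gradient. -/
def gradientSystem {E : Type} [NormedAddCommGroup E] [NormedSpace ℝ E]
    (G : E → E) (p : E × (E3 →L[ℝ] E)) : E × (E3 →L[ℝ] E) :=
  (G p.1, (fderiv ℝ G p.1).comp p.2)

variable {E : Type} [NormedAddCommGroup E] [NormedSpace ℝ E]

theorem contDiff_gradientSystem {G : E → E} (hG : ContDiff ℝ ∞ G) :
    ContDiff ℝ ∞ (gradientSystem G) :=
  (hG.comp contDiff_fst).prodMk
    (((hG.fderiv_right (m := ∞) (by simp)).comp contDiff_fst).clm_comp contDiff_snd)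

theorem isSource_comp [FiniteDimensional ℝ E] {W : Type*} [NormedAddCommGroup W] {G : E → W}
    (hG : Continuous G) {T : ℝ} {u : ℝ → E3 → E}
    (hc : ContinuousOn (fun p : ℝ × E3 => u p.1 p.2) (Ioo 0 T ×ˢ univ))
    (hb : ∃ M, ∀ t ∈ Ioo 0 T, ∀ x, ‖u t x‖ ≤ M) :
    ∃ M, IsSource T (fun s y => G (u s y)) M := by
  obtain ⟨M, hM⟩ := hb
  have := FiniteDimensional.proper ℝ E
  obtain ⟨C, hC⟩ := (isCompact_closedBall (0 : E) M).exists_bound_of_continuousOn hG.continuousOn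
  exact ⟨C, hG.comp_continuousOn hc, fun t ht x => hC _ (by simpa using hM t ht x)⟩

theorem heat_prodMk [CompleteSpace E] {W : Type*} [NormedAddCommGroup W] [NormedSpace ℝ W]
    [CompleteSpace W] {f : E3 → E} {g : E3 → W} (hf : IsBddMeas f) (hg : IsBddMeas g) (t : ℝ)
    (x : E3) : heat t (fun y => (f y, g y)) x = (heat t f x, heat t g x) :=
  integral_pair (hf.integrable t x) (hg.integrable t x)

namespace IsMild

variable {G : E → E} {T : ℝ} {u₀ : E3 → E} {u : ℝ → E3 → E}

theorem source [FiniteDimensional ℝ E] (h : IsMild G T u₀ u) (hG : Continuous G) :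
    ∃ M, IsSource T (fun s y => G (u s y)) M := isSource_comp hG h.cont h.bdd

theorem isSource (h : IsMild G T u₀ u) : ∃ M, IsSource T u M :=
  h.bdd.imp fun _ hM => ⟨h.cont, hM⟩

theorem shift [FiniteDimensional ℝ E] (h : IsMild G T u₀ u) (hG : Continuous G) {ε : ℝ}
    (hε : ε ∈ Ioo 0 T) : IsMild G (T - ε) (u ε) (fun s => u (ε + s)) := by
  obtain ⟨M, hM⟩ := h.source hG
  obtain ⟨M', hM'⟩ := h.isSource
  refine ⟨hM'.isBddMeas hε, (hM'.shift hε.1).cont, ⟨M', (hM'.shift hε.1).bdd⟩, fun r hr x => ?_⟩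
  have hsum : ε + r ∈ Ioo 0 T := ⟨by linarith [hε.1, hr.1], by linarith [hr.2]⟩
  have hd : IsBddMeas (duhamel (fun s y => G (u s y)) ε) := by
    refine ⟨Continuous.stronglyMeasurable ?_, _, hM.norm_duhamel_le hε⟩
    exact hM.continuousOn_duhamel.comp_continuous (f := fun x => (ε, x)) (by fun_prop)
      fun x => ⟨hε, mem_univ _⟩
  have e1 : u ε = fun y => heat ε u₀ y + duhamel (fun s y => G (u s y)) ε y :=
    funext fun y => h.eq ε hε y
  rw [h.eq _ hsum, hM.duhamel_add hε.1 hr.1 hsum.2, e1, heat_add (h.init.heat ε) hd,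
    heat_heat h.init hr.1.le hε.1.le, add_comm r ε, add_assoc]

theorem hasFDerivAt [FiniteDimensional ℝ E] (h : IsMild G T u₀ u) (hG : Continuous G) {t : ℝ}
    (ht : t ∈ Ioo 0 T) (x : E3) :
    HasFDerivAt (u t) (heatGrad t u₀ x + duhamelGrad (fun s y => G (u s y)) t x) x := by
  have := FiniteDimensional.complete ℝ E
  obtain ⟨M, hM⟩ := h.source hG
  exact ((hasFDerivAt_heat ht.1 h.init x).add (hM.hasFDerivAt_duhamel ht x)).congr_of_eventuallyEq
    (Eventually.of_forall fun y => h.eq t ht y)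

theorem differentiableAt [FiniteDimensional ℝ E] (h : IsMild G T u₀ u) (hG : Continuous G) {t : ℝ}
    (ht : t ∈ Ioo 0 T) (x : E3) : DifferentiableAt ℝ (u t) x :=
  (h.hasFDerivAt hG ht x).differentiableAt

theorem continuousOn_fderiv [FiniteDimensional ℝ E] (h : IsMild G T u₀ u) (hG : Continuous G) :
    ContinuousOn (fun p : ℝ × E3 => fderiv ℝ (u p.1) p.2) (Ioo 0 T ×ˢ univ) := by
  have := FiniteDimensional.complete ℝ E
  obtain ⟨M, hM⟩ := h.source hG
  have h1 : ContinuousOn (fun p : ℝ × E3 => heatGrad p.1 u₀ p.2) (Ioo 0 T ×ˢ univ) :=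
    fun p hp => (continuousAt_heatGrad h.init hp.1.1).continuousWithinAt
  exact (h1.add hM.continuousOn_duhamelGrad).congr fun p hp => (h.hasFDerivAt hG hp.1 p.2).fderiv

theorem exists_norm_fderiv_le [FiniteDimensional ℝ E] (h : IsMild G T u₀ u) (hG : Continuous G)
    {ε : ℝ} (hε : 0 < ε) : ∃ M, ∀ t ∈ Ico ε T, ∀ x, ‖fderiv ℝ (u t) x‖ ≤ M := by
  obtain ⟨M, hM⟩ := h.source hG
  obtain ⟨M₀, hM₀⟩ := h.init.bdd
  have h0 : 0 ≤ M₀ := (norm_nonneg _).trans (hM₀ 0)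
  refine ⟨gradConst * M₀ * ε ^ (-(1 / 2) : ℝ) +
    ∫ τ in Ioo 0 T, gradConst * M * τ ^ (-(1 / 2) : ℝ), fun t ht x => ?_⟩
  have htT : t ∈ Ioo 0 T := ⟨hε.trans_le ht.1, ht.2⟩
  rw [(h.hasFDerivAt hG htT x).fderiv]
  refine norm_add_le_of_le ((norm_heatGrad_le hM₀ htT.1 x).trans ?_) (hM.norm_duhamelGrad_le htT x)
  have := gradConst_nonneg
  gcongr ?_ * ?_
  exact Real.rpow_le_rpow_of_nonpos hε ht.1 (by norm_num)

/-- The engine of the regularity theory: whatever holds for every mild solution holds for the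
gradient as well. Time restarts at ε because the gradient is bounded only away from time 0. -/
theorem gradient [FiniteDimensional ℝ E] (h : IsMild G T u₀ u) (hG : ContDiff ℝ ∞ G) {ε : ℝ}
    (hε : ε ∈ Ioo 0 T) :
    IsMild (gradientSystem G) (T - ε) (fun y => (u ε y, fderiv ℝ (u ε) y))
      (fun s y => (u (ε + s) y, fderiv ℝ (u (ε + s)) y)) := by
  have := FiniteDimensional.complete ℝ E
  have hs := h.shift hG.continuous hε
  obtain ⟨M', hM'⟩ := hs.isSource
  obtain ⟨M, hM⟩ := h.exists_norm_fderiv_le hG.continuous hε.1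
  have hmaps : MapsTo (fun p : ℝ × E3 => (ε + p.1, p.2)) (Ioo 0 (T - ε) ×ˢ univ)
      (Ioo 0 T ×ˢ univ) := fun p hp =>
    ⟨⟨by linarith [hp.1.1, hε.1], by linarith [hp.1.2]⟩, mem_univ _⟩
  have hDs : IsSource (T - ε) (fun s y => fderiv ℝ (u (ε + s)) y) M :=
    ⟨(h.continuousOn_fderiv hG.continuous).comp (f := fun p : ℝ × E3 => (ε + p.1, p.2))
      (by fun_prop) hmaps,
      fun t ht x => hM _ ⟨by linarith [ht.1], by linarith [ht.2]⟩ x⟩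
  have hDε : IsBddMeas (fderiv ℝ (u ε)) := by
    refine ⟨Continuous.stronglyMeasurable ?_, M, hM ε ⟨le_rfl, hε.2⟩⟩
    exact (h.continuousOn_fderiv hG.continuous).comp_continuous (f := fun x => (ε, x))
      (by fun_prop) fun x => ⟨hε, mem_univ _⟩
  have hc : ContinuousOn (fun p : ℝ × E3 => (u (ε + p.1) p.2, fderiv ℝ (u (ε + p.1)) p.2))
      (Ioo 0 (T - ε) ×ˢ univ) := hM'.cont.prodMk hDs.cont
  have hb : ∃ C, ∀ t ∈ Ioo 0 (T - ε), ∀ x, ‖(u (ε + t) x, fderiv ℝ (u (ε + t)) x)‖ ≤ C :=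
    ⟨max M' M, fun t ht x => max_le_max (hM'.bdd t ht x) (hDs.bdd t ht x)⟩
  refine ⟨⟨hs.init.sm.prodMk hDε.sm, ?_⟩, hc, hb, fun r hr x => ?_⟩
  · obtain ⟨C, hC⟩ := hs.init.bdd
    exact ⟨max C M, fun x => max_le_max (hC x) (hM ε ⟨le_rfl, hε.2⟩ x)⟩
  · have hGc := contDiff_gradientSystem hG
    obtain ⟨K, hK⟩ := isSource_comp hGc.continuous hc hb
    obtain ⟨K1, hK1⟩ := isSource_comp (hG.continuous.comp continuous_fst) hc hb
    obtain ⟨K2, hK2⟩ := isSource_comp (G := fun p : E × (E3 →L[ℝ] E) =>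
      (fderiv ℝ G p.1).comp p.2) (continuous_snd.comp hGc.continuous) hc hb
    have hdu : ∀ s ∈ Ioo 0 (T - ε), ∀ y, HasFDerivAt (u (ε + s)) (fderiv ℝ (u (ε + s)) y) y :=
      fun s hs' y => (hs.differentiableAt hG.continuous hs' y).hasFDerivAt
    have hgrad : fderiv ℝ (u (ε + r)) x = heat r (fderiv ℝ (u ε)) x +
        duhamel (fun s y => (fderiv ℝ G (u (ε + s) y)).comp (fderiv ℝ (u (ε + s)) y)) r x := by
      rw [(hs.hasFDerivAt hG.continuous hr x).fderiv,
        heatGrad_eq_heat hs.init hDε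
          (fun y => (h.differentiableAt hG.continuous hε y).hasFDerivAt) hr.1]
      congr 1
      rw [duhamelGrad, duhamel, intervalIntegral.integral_of_le hr.1.le,
        intervalIntegral.integral_of_le hr.1.le, integral_Ioc_eq_integral_Ioo,
        integral_Ioc_eq_integral_Ioo]
      refine setIntegral_congr_fun measurableSet_Ioo fun τ hτ => ?_
      have hm := sub_mem_Ioo_of hτ.1 hτ.2 hr.2
      refine heatGrad_eq_heat (hK1.isBddMeas hm) (hK2.isBddMeas hm) (fun y => ?_) hτ.1 x
      exact ((hG.differentiable (by simp)) _).hasFDerivAt.comp y (hdu _ hm y)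
    have hpair : duhamel (fun s y => gradientSystem G (u (ε + s) y, fderiv ℝ (u (ε + s)) y)) r x =
        (duhamel (fun s y => G (u (ε + s) y)) r x,
          duhamel (fun s y => (fderiv ℝ G (u (ε + s) y)).comp (fderiv ℝ (u (ε + s)) y)) r x) := by
      simp only [duhamel, intervalIntegral.integral_of_le hr.1.le, integral_Ioc_eq_integral_Ioo]
      rw [← integral_pair]
      · refine setIntegral_congr_fun measurableSet_Ioo fun τ hτ => ?_
        have hm := sub_mem_Ioo_of hτ.1 hτ.2 hr.2
        exact heat_prodMk (hK1.isBddMeas hm) (hK2.isBddMeas hm) τ x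
      · exact (intervalIntegrable_iff_integrableOn_Ioo_of_le hr.1.le).1
          (hK1.intervalIntegrable_heat hr.1.le hr.2 x)
      · exact (intervalIntegrable_iff_integrableOn_Ioo_of_le hr.1.le).1
          (hK2.intervalIntegrable_heat hr.1.le hr.2 x)
    rw [hpair, hgrad, hs.eq r hr x, heat_prodMk hs.init hDε]
    rfl

theorem fderiv_gradient [FiniteDimensional ℝ E] (h : IsMild G T u₀ u) (hG : ContDiff ℝ ∞ G)
    {ε s : ℝ} (hε : ε ∈ Ioo 0 T) (hs : s ∈ Ioo 0 (T - ε)) (x : E3) :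
    HasFDerivAt (fderiv ℝ (u (ε + s))) ((ContinuousLinearMap.snd ℝ E (E3 →L[ℝ] E)).comp
      (fderiv ℝ (fun y => (u (ε + s) y, fderiv ℝ (u (ε + s)) y)) x)) x := by
  have h1 := ((h.gradient hG hε).differentiableAt (contDiff_gradientSystem hG).continuous hs
    x).hasFDerivAt
  exact (ContinuousLinearMap.snd ℝ E (E3 →L[ℝ] E)).hasFDerivAt.comp x h1

theorem hasFDerivAt_fderiv [FiniteDimensional ℝ E] (h : IsMild G T u₀ u) (hG : ContDiff ℝ ∞ G)
    {t : ℝ} (ht : t ∈ Ioo 0 T) (x : E3) :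
    HasFDerivAt (fderiv ℝ (u t)) (fderiv ℝ (fderiv ℝ (u t)) x) x := by
  have := h.fderiv_gradient hG (ε := t / 2) (s := t / 2) ⟨by linarith [ht.1], by linarith [ht.1, ht.2]⟩
    ⟨by linarith [ht.1], by linarith [ht.1, ht.2]⟩ x
  rw [add_halves] at this
  exact this.differentiableAt.hasFDerivAt

/-- The Hessian is a component of the gradient of the pair (u, ∇u), a mild solution once time is
restarted at t/2; continuity at t is local and does not notice the restart. -/
theorem continuousOn_fderiv_fderiv [FiniteDimensional ℝ E] (h : IsMild G T u₀ u)
    (hG : ContDiff ℝ ∞ G) :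
    ContinuousOn (fun p : ℝ × E3 => fderiv ℝ (fderiv ℝ (u p.1)) p.2) (Ioo 0 T ×ˢ univ) := by
  rintro ⟨t, x⟩ ⟨ht, -⟩
  refine ContinuousAt.continuousWithinAt ?_
  have hε : t / 2 ∈ Ioo 0 T := ⟨by linarith [ht.1], by linarith [ht.1, ht.2]⟩
  have h1 := (h.gradient hG hε).continuousOn_fderiv (contDiff_gradientSystem hG).continuous
  have hmem : ∀ᶠ p : ℝ × E3 in 𝓝 (t, x), p.1 - t / 2 ∈ Ioo 0 (T - t / 2) := by
    have : ContinuousAt (fun p : ℝ × E3 => p.1 - t / 2) (t, x) := by fun_prop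
    exact this.eventually (isOpen_Ioo.mem_nhds
      (⟨by simp only; linarith [ht.1], by simp only; linarith [ht.2]⟩))
  have h2 : ContinuousAt (fun p : ℝ × E3 => fderiv ℝ (fun y => (u (t / 2 + p.1) y,
      fderiv ℝ (u (t / 2 + p.1)) y)) p.2) (t - t / 2, x) :=
    h1.continuousAt ((isOpen_Ioo.prod isOpen_univ).mem_nhds
      ⟨⟨by simp only; linarith [ht.1], by simp only; linarith [ht.2]⟩, mem_univ _⟩)
  have h3 := h2.comp (f := fun p : ℝ × E3 => (p.1 - t / 2, p.2)) (x := (t, x)) (by fun_prop)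
  refine (((ContinuousLinearMap.compL ℝ E3 (E × (E3 →L[ℝ] E)) (E3 →L[ℝ] E)
    (ContinuousLinearMap.snd ℝ E (E3 →L[ℝ] E))).continuous.continuousAt).comp h3).congr ?_
  filter_upwards [hmem] with p hp
  have := (h.fderiv_gradient hG hε hp p.2).fderiv
  simp only [add_sub_cancel] at this
  simp [this]

theorem exists_norm_fderiv_fderiv_le [FiniteDimensional ℝ E] (h : IsMild G T u₀ u)
    (hG : ContDiff ℝ ∞ G) {ε : ℝ} (hε : 0 < ε) :
    ∃ M, ∀ t ∈ Ico ε T, ∀ x, ‖fderiv ℝ (fderiv ℝ (u t)) x‖ ≤ M := by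
  rcases le_or_gt T ε with hT | hT
  · exact ⟨0, fun t ht => absurd ht (by simp [hT])⟩
  have hε2 : ε / 2 ∈ Ioo 0 T := ⟨by linarith, by linarith⟩
  obtain ⟨M, hM⟩ := (h.gradient hG hε2).exists_norm_fderiv_le
    (contDiff_gradientSystem hG).continuous (half_pos hε)
  refine ⟨M, fun t ht x => ?_⟩
  have ht' : t - ε / 2 ∈ Ico (ε / 2) (T - ε / 2) := ⟨by linarith [ht.1], by linarith [ht.2]⟩
  have h1 := (h.fderiv_gradient hG hε2 ⟨by linarith [ht'.1], ht'.2⟩ x).fderiv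
  have h2 := hM _ ht' x
  simp only [add_sub_cancel] at h1 h2
  rw [h1]
  refine (ContinuousLinearMap.opNorm_comp_le _ _).trans ?_
  exact (mul_le_mul (ContinuousLinearMap.norm_snd_le ℝ E _) h2 (norm_nonneg _) zero_le_one).trans
    (by rw [one_mul])

end IsMild

end QTensor
end

/-! ### Time derivative and joint smoothness of mild solutions -/

noncomputable section


namespace QTensor

variable {E : Type} [NormedAddCommGroup E] [NormedSpace ℝ E]

theorem IsSource.hasDerivWithinAt_duhamel [CompleteSpace E] {T M : ℝ} {F : ℝ → E3 → E}
    (hF : IsSource T F M) {t : ℝ} (ht : t ∈ Ioo 0 T) (x : E3) :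
    HasDerivWithinAt (fun r => duhamel (fun s => F (t + s)) r x) (F t x) (Ici 0) 0 := by
  -- The integrand is jointly continuous in the elapsed heat time and in the source time, with value
  -- F t x when both increments vanish; averaging it over a short interval gives the derivative.
  have ht' := hF.tendsto_heat (X := ℝ × ℝ) (l := 𝓝 (0, 0)) (τ := Prod.fst) (s := fun p => t + p.2)
    (ξ := fun _ => x) ht (τ₀ := 0) (ξ₀ := x) continuousAt_fst
    (by simpa [ContinuousAt] using (by fun_prop : ContinuousAt (fun p : ℝ × ℝ => t + p.2) (0, 0)))
    tendsto_const_nhds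
  rw [heat_zero] at ht'
  rw [hasDerivWithinAt_iff_isLittleO, Asymptotics.isLittleO_iff]
  intro c hc
  obtain ⟨δ, hδ, hball⟩ := Metric.eventually_nhds_iff.1 ((Metric.tendsto_nhds.1 ht') c hc)
  have hev : ∀ᶠ r : ℝ in 𝓝[Ici 0] 0, r ∈ Ico 0 (min δ (T - t)) :=
    Ico_mem_nhdsGE (lt_min hδ (by linarith [ht.2]))
  filter_upwards [hev] with r hr
  have hrT : r < T - t := hr.2.trans_le (min_le_right _ _)
  have hrδ : r < δ := hr.2.trans_le (min_le_left _ _)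
  have h0 : duhamel (fun s => F (t + s)) 0 x = 0 := by simp [duhamel]
  have hconst : r • F t x = ∫ _ in (0 : ℝ)..r, F t x := by simp
  rw [h0, sub_zero, sub_zero, hconst, duhamel, ← intervalIntegral.integral_sub
    ((hF.shift ht.1).intervalIntegrable_heat hr.1 hrT x) (by simp)]
  refine (intervalIntegral.norm_integral_le_of_norm_le_const (C := c) fun τ hτ => ?_).trans
    (by simp)
  rw [uIoc_of_le hr.1] at hτ
  have := hball (y := (τ, r - τ)) (by
    rw [Prod.dist_eq, max_lt_iff]
    simp only [Real.dist_eq, sub_zero]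
    exact ⟨by rw [abs_of_pos hτ.1]; linarith [hτ.2],
      by rw [abs_of_nonneg (by linarith [hτ.2])]; linarith [hτ.1]⟩)
  rw [dist_eq_norm] at this
  exact this.le

namespace IsMild

variable {G : E → E} {T : ℝ} {u₀ : E3 → E} {u : ℝ → E3 → E}

/-- The time derivative prescribed by the equation. -/
theorem hasDerivWithinAt [FiniteDimensional ℝ E] (h : IsMild G T u₀ u) (hG : ContDiff ℝ ∞ G)
    {t : ℝ} (ht : t ∈ Ioo 0 T) (x : E3) : HasDerivWithinAt (fun s => u s x)
      (secondTrace (fderiv ℝ (fderiv ℝ (u t)) x) + G (u t x)) (Ici t) t := by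
  have := FiniteDimensional.complete ℝ E
  obtain ⟨M, hM⟩ := h.source hG.continuous
  obtain ⟨M₀, hM₀⟩ := h.isSource
  obtain ⟨M₁, hM₁⟩ := h.exists_norm_fderiv_le hG.continuous ht.1
  obtain ⟨M₂, hM₂⟩ := h.exists_norm_fderiv_fderiv_le hG ht.1
  have hc1 : Continuous (fderiv ℝ (u t)) :=
    (h.continuousOn_fderiv hG.continuous).comp_continuous (f := fun x => (t, x))
      (by fun_prop) fun x => ⟨ht, mem_univ _⟩
  have hc2 : Continuous (fderiv ℝ (fderiv ℝ (u t))) :=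
    (h.continuousOn_fderiv_fderiv hG).comp_continuous (f := fun x => (t, x))
      (by fun_prop) fun x => ⟨ht, mem_univ _⟩
  have hm : t ∈ Ico t T := ⟨le_rfl, ht.2⟩
  have d1 := hasDerivWithinAt_heat_zero (hM₀.isBddMeas ht) ⟨hc1.stronglyMeasurable, M₁, hM₁ t hm⟩
    ⟨hc2.stronglyMeasurable, M₂, hM₂ t hm⟩
    (fun x => (h.differentiableAt hG.continuous ht x).hasFDerivAt)
    (fun x => h.hasFDerivAt_fderiv hG ht x) hc2 x
  -- Restarted at t, the solution is e^(rΔ)u(t) plus a Duhamel integral over a time span r, so its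
  -- right derivative at r = 0 is the sum of the two.
  have d2 := d1.add (hM.hasDerivWithinAt_duhamel ht x)
  have hs := h.shift hG.continuous ht
  have d3 : HasDerivWithinAt (fun r => u (t + r) x)
      (secondTrace (fderiv ℝ (fderiv ℝ (u t)) x) + G (u t x)) (Ici 0) 0 := by
    refine d2.congr_of_eventuallyEq ?_ (by simp [heat_zero, duhamel])
    have hev : ∀ᶠ r : ℝ in 𝓝[Ici 0] 0, r ∈ Ico 0 (T - t) := Ico_mem_nhdsGE (by linarith [ht.2])
    filter_upwards [hev] with r hr
    rcases hr.1.eq_or_lt with rfl | hr0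
    · simp [heat_zero, duhamel]
    · exact hs.eq r ⟨hr0, hr.2⟩ x
  have d4 : HasDerivWithinAt (fun s : ℝ => s - t) 1 (Ici t) t :=
    ((hasDerivAt_id t).sub_const t).hasDerivWithinAt
  have d5 := HasDerivWithinAt.scomp (g₁ := fun r => u (t + r) x) (h := fun s : ℝ => s - t)
    (t' := Ici 0) t (by simpa using d3) d4 fun s hs => by simpa using hs
  simpa [Function.comp_def] using d5

theorem continuousOn_rhs [FiniteDimensional ℝ E] (h : IsMild G T u₀ u) (hG : ContDiff ℝ ∞ G) :
    ContinuousOn (fun p : ℝ × E3 =>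
      secondTrace (fderiv ℝ (fderiv ℝ (u p.1)) p.2) + G (u p.1 p.2)) (Ioo 0 T ×ˢ univ) :=
  (secondTrace.continuous.comp_continuousOn (h.continuousOn_fderiv_fderiv hG)).add
    (hG.continuous.comp_continuousOn h.cont)

/-- The integral equation yields only right derivatives. As these are continuous in time, the
solution is their integral, and the fundamental theorem of calculus makes the derivative two-sided.
-/
theorem hasDerivAt [FiniteDimensional ℝ E] (h : IsMild G T u₀ u) (hG : ContDiff ℝ ∞ G)
    {t : ℝ} (ht : t ∈ Ioo 0 T) (x : E3) : HasDerivAt (fun s => u s x)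
      (secondTrace (fderiv ℝ (fderiv ℝ (u t)) x) + G (u t x)) t := by
  have := FiniteDimensional.complete ℝ E
  set ψ : ℝ → E := fun s => secondTrace (fderiv ℝ (fderiv ℝ (u s)) x) + G (u s x) with hψ
  have hψc : ContinuousOn ψ (Ioo 0 T) :=
    (h.continuousOn_rhs hG).comp (f := fun s => (s, x)) (by fun_prop) fun s hs => ⟨hs, mem_univ _⟩
  have huc : ContinuousOn (fun s => u s x) (Ioo 0 T) :=
    h.cont.comp (f := fun s => (s, x)) (by fun_prop) fun s hs => ⟨hs, mem_univ _⟩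
  have hint : ∀ b ∈ Ico (t / 2) T, IntervalIntegrable ψ volume (t / 2) b := fun b hb =>
    (hψc.mono fun s hs => by
      rw [uIcc_of_le hb.1] at hs
      exact ⟨by linarith [hs.1, ht.1], by linarith [hs.2, hb.2]⟩).intervalIntegrable
  have hftc : ∀ b ∈ Ico (t / 2) T, u b x = u (t / 2) x + ∫ s in (t / 2)..b, ψ s := fun b hb => by
    rw [intervalIntegral.integral_eq_sub_of_hasDeriv_right_of_le hb.1
      (huc.mono fun s hs => ⟨by linarith [hs.1, ht.1], by linarith [hs.2, hb.2]⟩)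
      (fun s hs => (h.hasDerivWithinAt hG
        ⟨by linarith [hs.1, ht.1], by linarith [hs.2, hb.2]⟩ x).mono Ioi_subset_Ici_self)
      (hint b hb)]
    abel
  have hnhds : Ioo (t / 2) T ∈ 𝓝 t := isOpen_Ioo.mem_nhds ⟨by linarith [ht.1], ht.2⟩
  have htm : t ∈ Ico (t / 2) T := ⟨by linarith [ht.1], ht.2⟩
  have d := intervalIntegral.integral_hasDerivAt_right (hint t htm)
    (hψc.stronglyMeasurableAtFilter isOpen_Ioo t ht) (hψc.continuousAt (isOpen_Ioo.mem_nhds ht))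
  refine (d.const_add (u (t / 2) x)).congr_of_eventuallyEq ?_
  filter_upwards [hnhds] with b hb
  exact hftc b ⟨hb.1.le, hb.2⟩

theorem hasFDerivAt_uncurry [FiniteDimensional ℝ E] (h : IsMild G T u₀ u) (hG : ContDiff ℝ ∞ G)
    {p : ℝ × E3} (hp : p ∈ Ioo 0 T ×ˢ (univ : Set E3)) :
    HasFDerivAt (fun p : ℝ × E3 => u p.1 p.2)
      ((ContinuousLinearMap.smulRightL ℝ ℝ E (1 : ℝ →L[ℝ] ℝ)
          (secondTrace (fderiv ℝ (fderiv ℝ (u p.1)) p.2) + G (u p.1 p.2))).coprod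
        (fderiv ℝ (u p.1) p.2)) p := by
  have hopen : IsOpen (Ioo 0 T ×ˢ (univ : Set E3)) := isOpen_Ioo.prod isOpen_univ
  refine (hasStrictFDerivAt_uncurry_coprod (𝕜 := ℝ) (f := u) (u := p)
    (f₁ := fun t x => ContinuousLinearMap.smulRightL ℝ ℝ E (1 : ℝ →L[ℝ] ℝ)
      (secondTrace (fderiv ℝ (fderiv ℝ (u t)) x) + G (u t x)))
    (f₂ := fun t x => fderiv ℝ (u t) x) ?_ ?_ ?_ ?_).hasFDerivAt
  · filter_upwards [hopen.mem_nhds hp] with q hq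
    exact (h.hasDerivAt hG hq.1 q.2).hasFDerivAt
  · filter_upwards [hopen.mem_nhds hp] with q hq
    exact (h.differentiableAt hG.continuous hq.1 q.2).hasFDerivAt
  · exact ((ContinuousLinearMap.smulRightL ℝ ℝ E (1 : ℝ →L[ℝ] ℝ)).continuous.comp_continuousOn
      (h.continuousOn_rhs hG)).continuousAt (hopen.mem_nhds hp)
  · exact (h.continuousOn_fderiv hG.continuous).continuousAt (hopen.mem_nhds hp)

end IsMild

/-- The total derivative is assembled from ∇u and from ∂ₜu = Δu + G(u). Both ∇u and the Hessian are
Cⁿ by the inductive hypothesis applied to the gradient system, once and twice. The induction thus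
runs over all target spaces and nonlinearities simultaneously. -/
theorem contDiffOn_nat_of_isMild (n : ℕ) : ∀ (E : Type) [NormedAddCommGroup E] [NormedSpace ℝ E]
    [FiniteDimensional ℝ E] (G : E → E) (T : ℝ) (u₀ : E3 → E) (u : ℝ → E3 → E),
    IsMild G T u₀ u → ContDiff ℝ ∞ G →
      ContDiffOn ℝ n (fun p : ℝ × E3 => u p.1 p.2) (Ioo 0 T ×ˢ univ) := by
  induction n with
  | zero =>
    intro E _ _ _ G T u₀ u h _
    exact contDiffOn_zero.2 h.cont
  | succ n ih =>
    intro E _ _ _ G T u₀ u h hG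
    have hopen : IsOpen (Ioo 0 T ×ˢ (univ : Set E3)) := isOpen_Ioo.prod isOpen_univ
    -- Smoothness is local, so it may be checked after restarting at half of the given time.
    have key : ∀ (W : Type) [NormedAddCommGroup W] [NormedSpace ℝ W] (g : ℝ → E3 → W),
        (∀ ε ∈ Ioo 0 T, ContDiffOn ℝ n (fun p : ℝ × E3 => g (ε + p.1) p.2)
          (Ioo 0 (T - ε) ×ˢ univ)) →
        ContDiffOn ℝ n (fun p : ℝ × E3 => g p.1 p.2) (Ioo 0 T ×ˢ univ) := by
      intro W _ _ g hg p hp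
      have h1 : p.1 / 2 ∈ Ioo 0 T := ⟨by linarith [hp.1.1], by linarith [hp.1.1, hp.1.2]⟩
      have hm : (p.1 - p.1 / 2, p.2) ∈ Ioo 0 (T - p.1 / 2) ×ˢ (univ : Set E3) :=
        ⟨⟨by simp only; linarith [hp.1.1], by simp only; linarith [hp.1.2]⟩, mem_univ _⟩
      have h2 := (hg _ h1).contDiffAt ((isOpen_Ioo.prod isOpen_univ).mem_nhds hm)
      have h3 := h2.comp (f := fun q : ℝ × E3 => (q.1 - p.1 / 2, q.2)) p (by fun_prop)
      simpa [Function.comp_def] using h3.contDiffWithinAt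
    have hgrad : ContDiffOn ℝ n (fun p : ℝ × E3 => (u p.1 p.2, fderiv ℝ (u p.1) p.2))
        (Ioo 0 T ×ˢ univ) :=
      key _ (fun t x => (u t x, fderiv ℝ (u t) x)) fun ε hε =>
        ih _ _ _ _ _ (h.gradient hG hε) (contDiff_gradientSystem hG)
    have hhess : ContDiffOn ℝ n (fun p : ℝ × E3 => fderiv ℝ (fderiv ℝ (u p.1)) p.2)
        (Ioo 0 T ×ˢ univ) := by
      refine key _ (fun t x => fderiv ℝ (fderiv ℝ (u t)) x) fun ε hε => ?_
      have hh := h.gradient hG hε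
      have hGG := contDiff_gradientSystem hG
      have h1 : ContDiffOn ℝ n (fun p : ℝ × E3 => fderiv ℝ (fun y => (u (ε + p.1) y,
          fderiv ℝ (u (ε + p.1)) y)) p.2) (Ioo 0 (T - ε) ×ˢ univ) := by
        intro p hp
        have e1 : p.1 / 2 ∈ Ioo 0 (T - ε) := ⟨by linarith [hp.1.1], by linarith [hp.1.1, hp.1.2]⟩
        have hm : (p.1 - p.1 / 2, p.2) ∈ Ioo 0 (T - ε - p.1 / 2) ×ˢ (univ : Set E3) :=
          ⟨⟨by simp only; linarith [hp.1.1], by simp only; linarith [hp.1.2]⟩, mem_univ _⟩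
        have h2 := ((ih _ _ _ _ _ (hh.gradient hGG e1) (contDiff_gradientSystem hGG)).snd).contDiffAt
          ((isOpen_Ioo.prod isOpen_univ).mem_nhds hm)
        have h3 := h2.comp (f := fun q : ℝ × E3 => (q.1 - p.1 / 2, q.2)) p (by fun_prop)
        simpa [Function.comp_def] using h3.contDiffWithinAt
      refine ((ContinuousLinearMap.compL ℝ E3 (E × (E3 →L[ℝ] E)) (E3 →L[ℝ] E)
        (ContinuousLinearMap.snd ℝ E (E3 →L[ℝ] E))).contDiff.comp_contDiffOn h1).congr fun p hp => ?_
      exact (h.fderiv_gradient hG hε hp.1 p.2).fderiv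
    rw [Nat.cast_succ, contDiffOn_succ_iff_fderiv_of_isOpen hopen]
    refine ⟨fun p hp => (h.hasFDerivAt_uncurry hG hp).differentiableAt.differentiableWithinAt,
      by simp, ?_⟩
    have h1 : ContDiffOn ℝ n (fun p : ℝ × E3 =>
        (ContinuousLinearMap.smulRightL ℝ ℝ E (1 : ℝ →L[ℝ] ℝ)
          (secondTrace (fderiv ℝ (fderiv ℝ (u p.1)) p.2) + G (u p.1 p.2))).comp
            (ContinuousLinearMap.fst ℝ ℝ E3) +
        (fderiv ℝ (u p.1) p.2).comp (ContinuousLinearMap.snd ℝ ℝ E3)) (Ioo 0 T ×ˢ univ) := by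
      refine ContDiffOn.add (ContDiffOn.clm_comp ?_ contDiffOn_const)
        (hgrad.snd.clm_comp contDiffOn_const)
      refine (ContinuousLinearMap.smulRightL ℝ ℝ E
        (1 : ℝ →L[ℝ] ℝ)).contDiff.comp_contDiffOn (ContDiffOn.add ?_ ?_)
      · exact secondTrace.contDiff.comp_contDiffOn hhess
      · exact (hG.of_le (by exact_mod_cast le_top)).comp_contDiffOn hgrad.fst
    refine h1.congr fun p hp => ?_
    rw [(h.hasFDerivAt_uncurry hG hp).fderiv]
    ext <;> simp

theorem IsMild.contDiffOn [FiniteDimensional ℝ E] {G : E → E} {T : ℝ} {u₀ : E3 → E}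
    {u : ℝ → E3 → E} (h : IsMild G T u₀ u) (hG : ContDiff ℝ ∞ G) :
    ContDiffOn ℝ ∞ (fun p : ℝ × E3 => u p.1 p.2) (Ioo 0 T ×ˢ univ) :=
  contDiffOn_infty.2 fun n => contDiffOn_nat_of_isMild n E G T u₀ u h hG

end QTensor
end

/-! ### Picard iteration under a caloric majorant -/

noncomputable section

set_option linter.unusedSectionVars false

namespace QTensor

variable {E : Type} [NormedAddCommGroup E] [NormedSpace ℝ E]

theorem integral_exp_neg_mul_sub_le {a t : ℝ} (ha : 0 < a) :
    ∫ τ in (0 : ℝ)..t, Real.exp (-a * (t - τ)) ≤ 1 / a := by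
  have h : ∀ τ ∈ uIcc 0 t, HasDerivAt (fun τ => Real.exp (-a * (t - τ)) / a)
      (Real.exp (-a * (t - τ))) τ := fun τ _ => by
    have := ((((hasDerivAt_id τ).const_sub t).const_mul (-a)).exp).div_const a
    refine this.congr_deriv ?_
    simp only [id]
    field_simp
  rw [intervalIntegral.integral_eq_sub_of_hasDerivAt h
    (Continuous.intervalIntegrable (by fun_prop) _ _), sub_self, mul_zero, Real.exp_zero]
  have : 0 ≤ Real.exp (-a * (t - 0)) / a := by positivity
  linarith

theorem heat_nonneg {ρ : E3 → ℝ} (h : ∀ x, 0 ≤ ρ x) (t : ℝ) (x : E3) : 0 ≤ heat t ρ x :=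
  integral_nonneg fun _ => h _

/-- A source dominated by `e^(-as)` times a caloric function gives a Duhamel integral dominated by
that caloric function. -/
theorem norm_duhamel_le_heat {T : ℝ} {S : ℝ → E3 → E} {ρ : E3 → ℝ}
    (hρ : IsBddMeas ρ) (hρ0 : ∀ x, 0 ≤ ρ x) {a k : ℝ} (ha : 0 < a) (hk : 0 ≤ k)
    (h : ∀ s ∈ Ioo 0 T, ∀ y, ‖S s y‖ ≤ k * Real.exp (-a * s) * heat s ρ y) {t : ℝ}
    (ht : t ∈ Ioo 0 T) (x : E3) : ‖duhamel S t x‖ ≤ k / a * heat t ρ x := by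
  have h1 : ∀ τ ∈ Ioo 0 t,
      ‖heat τ (S (t - τ)) x‖ ≤ Real.exp (-a * (t - τ)) * (k * heat t ρ x) := fun τ hτ => by
    have hb : IsBddMeas fun y => k * Real.exp (-a * (t - τ)) * heat (t - τ) ρ y := by
      obtain ⟨C, hC⟩ := (hρ.heat (t - τ)).bdd
      refine ⟨(hρ.heat (t - τ)).sm.const_mul _, |k * Real.exp (-a * (t - τ))| * C, fun y => ?_⟩
      rw [norm_mul, Real.norm_eq_abs]
      gcongr
      exact hC y
    refine (norm_heat_le_heat hb (h _ (sub_mem_Ioo_of hτ.1 hτ.2 ht.2)) τ x).trans_eq ?_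
    -- The semigroup law reassembles the majorant at time t, independent of τ; only the exponential
    -- remains to be integrated.
    rw [heat_const_mul, heat_heat hρ hτ.1.le (by linarith [hτ.2]), add_sub_cancel]
    ring
  have hi : IntervalIntegrable (fun τ => Real.exp (-a * (t - τ)) * (k * heat t ρ x)) volume 0 t :=
    Continuous.intervalIntegrable (by fun_prop) _ _
  calc ‖duhamel S t x‖ ≤ ∫ τ in (0 : ℝ)..t, Real.exp (-a * (t - τ)) * (k * heat t ρ x) := by
        simp only [duhamel, intervalIntegral.integral_of_le ht.1.le, integral_Ioc_eq_integral_Ioo]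
        refine norm_integral_le_of_norm_le
          ((intervalIntegrable_iff_integrableOn_Ioo_of_le ht.1.le).1 hi) ?_
        filter_upwards [ae_restrict_mem measurableSet_Ioo] with τ hτ using h1 τ hτ
    _ ≤ 1 / a * (k * heat t ρ x) := by
        rw [intervalIntegral.integral_mul_const]
        have := heat_nonneg hρ0 t x
        gcongr
        exact integral_exp_neg_mul_sub_le ha
    _ = _ := by ring

theorem IsSource.duhamel_sub {T M M' : ℝ} {S S' : ℝ → E3 → E} (h : IsSource T S M)
    (h' : IsSource T S' M') {t : ℝ} (ht : t ∈ Ioo 0 T) (x : E3) :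
    duhamel (fun s y => S s y - S' s y) t x = duhamel S t x - duhamel S' t x := by
  rw [duhamel, duhamel, duhamel, ← intervalIntegral.integral_sub
    (h.intervalIntegrable_heat ht.1.le ht.2 x) (h'.intervalIntegrable_heat ht.1.le ht.2 x)]
  simp only [intervalIntegral.integral_of_le ht.1.le, integral_Ioc_eq_integral_Ioo]
  refine setIntegral_congr_fun measurableSet_Ioo fun τ hτ => ?_
  have hm := sub_mem_Ioo_of hτ.1 hτ.2 ht.2
  exact heat_sub (h.isBddMeas hm) (h'.isBddMeas hm) τ x

/-- A time-dependent nonlinearity that decays like `e^(-as)` and is at least quadratic at `0`. -/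
structure IsDecayingNonlinearity (F : ℝ → E → E) (a L : ℝ) : Prop where
  pos : 0 < a
  nonneg : 0 ≤ L
  cont : Continuous fun p : ℝ × E => F p.1 p.2
  zero : ∀ s, F s 0 = 0
  lip : ∀ s, 0 ≤ s → ∀ v w : E, ‖v‖ ≤ 1 → ‖w‖ ≤ 1 →
    ‖F s v - F s w‖ ≤ L * Real.exp (-a * s) * (‖v‖ + ‖w‖) * ‖v - w‖

/-- Continuous functions on `(0, ∞) × ℝ³` dominated by `2 η` times the caloric extension of `ρ`. -/
structure IsDominated (ρ : E3 → ℝ) (η : ℝ) (w : ℝ → E3 → E) : Prop where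
  cont : ContinuousOn (fun p : ℝ × E3 => w p.1 p.2) (Ioi 0 ×ˢ univ)
  le : ∀ t, 0 < t → ∀ x, ‖w t x‖ ≤ 2 * η * heat t ρ x

/-- A weight with values in `[0, 1]`. -/
structure IsWeight (ρ : E3 → ℝ) : Prop where
  meas : StronglyMeasurable ρ
  nonneg : ∀ x, 0 ≤ ρ x
  le_one : ∀ x, ρ x ≤ 1

theorem IsWeight.isBddMeas {ρ : E3 → ℝ} (h : IsWeight ρ) : IsBddMeas ρ :=
  ⟨h.meas, 1, fun x => by rw [Real.norm_of_nonneg (h.nonneg x)]; exact h.le_one x⟩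

theorem IsWeight.heat_le_one {ρ : E3 → ℝ} (h : IsWeight ρ) (t : ℝ) (x : E3) : heat t ρ x ≤ 1 :=
  (le_abs_self _).trans (norm_heat_le
    (fun x => by rw [Real.norm_of_nonneg (h.nonneg x)]; exact h.le_one x) t x)

/-- One step of the Picard iteration. -/
def picard (F : ℝ → E → E) (R : E3 → E) (w : ℝ → E3 → E) (t : ℝ) (x : E3) : E :=
  heat t R x + duhamel (fun s y => F s (w s y)) t x

section Picard

variable {F : ℝ → E → E} {a L η : ℝ} {ρ : E3 → ℝ} {R R' : E3 → E} {w w' : ℝ → E3 → E}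

theorem IsDominated.norm_le (hη : 0 ≤ η) (hρ : IsWeight ρ)
    (hw : IsDominated ρ η w) {t : ℝ} (ht : 0 < t) (x : E3) : ‖w t x‖ ≤ 2 * η :=
  (hw.le t ht x).trans (mul_le_of_le_one_right (by positivity) (hρ.heat_le_one t x))

theorem IsDecayingNonlinearity.norm_le (hF : IsDecayingNonlinearity F a L) {s : ℝ} (hs : 0 ≤ s)
    {v : E} (hv : ‖v‖ ≤ 1) : ‖F s v‖ ≤ L * Real.exp (-a * s) * ‖v‖ * ‖v‖ := by
  have := hF.lip s hs v 0 hv (by simp)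
  simpa [hF.zero] using this

theorem IsDominated.isSource (hη : 0 ≤ η) (hη1 : 2 * η ≤ 1) (hρ : IsWeight ρ)
    (hF : IsDecayingNonlinearity F a L) (hw : IsDominated ρ η w) (T : ℝ) :
    IsSource T (fun s y => F s (w s y)) L := by
  refine ⟨hF.cont.comp_continuousOn (continuousOn_fst.prodMk (hw.cont.mono ?_)), fun t ht x => ?_⟩
  · exact prod_mono (fun t ht => ht.1) le_rfl
  · have h1 : ‖w t x‖ ≤ 1 := (hw.norm_le hη hρ ht.1 x).trans hη1
    refine (hF.norm_le ht.1.le h1).trans ?_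
    have h2 : Real.exp (-a * t) ≤ 1 := Real.exp_le_one_iff.2 (by nlinarith [hF.pos, ht.1])
    have := hF.nonneg
    calc _ ≤ L * 1 * 1 * 1 := by gcongr
      _ = L := by ring

theorem IsDominated.picard [CompleteSpace E] (hη : 0 ≤ η) (hη1 : 2 * η ≤ 1) (hκ : 16 * η * L ≤ a)
    (hρ : IsWeight ρ)
    (hF : IsDecayingNonlinearity F a L) (hR : StronglyMeasurable R) (hRρ : ∀ x, ‖R x‖ ≤ η * ρ x)
    (hw : IsDominated ρ η w) : IsDominated ρ η (picard F R w) := by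
  have hRb : IsBddMeas R := ⟨hR, η, fun x => (hRρ x).trans
    (mul_le_of_le_one_right hη (hρ.le_one x))⟩
  refine ⟨ContinuousOn.add (fun p hp => (continuousAt_heat hRb hp.1).continuousWithinAt) ?_,
    fun t ht x => ?_⟩
  · rintro ⟨t, x⟩ ⟨ht, -⟩
    have hm : t ∈ Ioo 0 (t + 1) := ⟨ht, by linarith⟩
    exact ((hw.isSource hη hη1 hρ hF (t + 1)).continuousOn_duhamel.continuousAt
      ((isOpen_Ioo.prod isOpen_univ).mem_nhds ⟨hm, mem_univ _⟩)).continuousWithinAt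
  · have hm : t ∈ Ioo 0 (t + 1) := ⟨ht, by linarith⟩
    have h1 : ‖heat t R x‖ ≤ η * heat t ρ x := by
      rw [← heat_const_mul]
      refine norm_heat_le_heat ⟨hρ.meas.const_mul η, η, fun x => ?_⟩ hRρ t x
      rw [norm_mul, Real.norm_of_nonneg hη, Real.norm_of_nonneg (hρ.nonneg x)]
      exact mul_le_of_le_one_right hη (hρ.le_one x)
    have hL := hF.nonneg
    -- Of the two factors |w| in the source, one is bounded by the constant 2η and the other by the
    -- majorant 2η e^(sΔ)ρ. The Duhamel term is then at most (4Lη²/a) e^(tΔ)ρ, within the remaining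
    -- budget η e^(tΔ)ρ.
    have h2 := norm_duhamel_le_heat (S := fun s y => F s (w s y)) hρ.isBddMeas hρ.nonneg
      hF.pos (k := L * (2 * η) * (2 * η)) (by positivity) (fun s hs y => ?_) hm x
    · refine (norm_add_le_of_le h1 h2).trans ?_
      have h3 : L * (2 * η) * (2 * η) / a ≤ η := by
        rw [div_le_iff₀ hF.pos]
        nlinarith [mul_le_mul_of_nonneg_left hκ hη, mul_nonneg hL (mul_nonneg hη hη)]
      nlinarith [heat_nonneg hρ.nonneg t x]
    · have hle := hw.norm_le hη hρ hs.1 y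
      refine (hF.norm_le hs.1.le (hle.trans hη1)).trans ?_
      calc L * Real.exp (-a * s) * ‖w s y‖ * ‖w s y‖ ≤
          L * Real.exp (-a * s) * (2 * η) * (2 * η * heat s ρ y) := by
            gcongr
            exact hw.le s hs.1 y
        _ = _ := by ring

/-- The contraction step: the factor is 4ηL/a ≤ 1/4. Measuring differences by an arbitrary caloric
function e^(tΔ)g serves two purposes: constant g gives the uniform convergence of the iteration, and
g built from ‖R - R'‖ gives pointwise dependence on the data. -/
theorem norm_picard_sub_le (hη : 0 ≤ η) (hη1 : 2 * η ≤ 1)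
    (hκ : 16 * η * L ≤ a) (hρ : IsWeight ρ)
    (hF : IsDecayingNonlinearity F a L) (hR : IsBddMeas R) (hR' : IsBddMeas R')
    (hw : IsDominated ρ η w) (hw' : IsDominated ρ η w') {g : E3 → ℝ} (hg : IsBddMeas g)
    (hg0 : ∀ x, 0 ≤ g x) (h : ∀ t, 0 < t → ∀ x, ‖w t x - w' t x‖ ≤ heat t g x) {t : ℝ}
    (ht : 0 < t) (x : E3) : ‖picard F R w t x - picard F R' w' t x‖ ≤
      heat t (fun y => ‖R y - R' y‖ + 1 / 4 * g y) x := by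
  have hm : t ∈ Ioo 0 (t + 1) := ⟨ht, by linarith⟩
  have hL := hF.nonneg
  have hd : IsBddMeas fun y => ‖R y - R' y‖ := by
    obtain ⟨C, hC⟩ := hR.bdd
    obtain ⟨C', hC'⟩ := hR'.bdd
    exact ⟨(hR.sm.sub hR'.sm).norm, C + C', fun y => by
      rw [norm_norm]; exact norm_sub_le_of_le (hC y) (hC' y)⟩
  have hg4 : IsBddMeas fun y => 1 / 4 * g y := by
    obtain ⟨C, hC⟩ := hg.bdd
    exact ⟨hg.sm.const_mul _, 1 / 4 * C, fun y => by
      rw [norm_mul, Real.norm_of_nonneg (by norm_num)]; gcongr; exact hC y⟩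
  have hs := hw.isSource hη hη1 hρ hF (t + 1)
  have hs' := hw'.isSource hη hη1 hρ hF (t + 1)
  have h2 := norm_duhamel_le_heat (S := fun s y => F s (w s y) - F s (w' s y)) hg hg0
      hF.pos (k := L * (4 * η)) (by positivity) (fun s hs y => ?_) hm x
  · rw [heat_add hd hg4, heat_const_mul]
    have e : picard F R w t x - picard F R' w' t x = (heat t (fun y => R y - R' y) x) +
        duhamel (fun s y => F s (w s y) - F s (w' s y)) t x := by
      rw [heat_sub hR hR', hs.duhamel_sub hs' hm, picard, picard]
      abel
    rw [e]
    refine norm_add_le_of_le (norm_heat_le_heat hd (fun _ => le_rfl) t x) (h2.trans ?_)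
    have h4 : L * (4 * η) / a ≤ 1 / 4 := by rw [div_le_iff₀ hF.pos]; linarith
    exact mul_le_mul_of_nonneg_right h4 (heat_nonneg hg0 t x)
  · have hle := hw.norm_le hη hρ hs.1 y
    have hle' := hw'.norm_le hη hρ hs.1 y
    refine (hF.lip s hs.1.le _ _ (hle.trans hη1) (hle'.trans hη1)).trans ?_
    calc L * Real.exp (-a * s) * (‖w s y‖ + ‖w' s y‖) * ‖w s y - w' s y‖ ≤
        L * Real.exp (-a * s) * (2 * η + 2 * η) * heat s g y := by
          gcongr
          exact h s hs.1 y
      _ = _ := by ring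

/-- Solutions of the integral equation depend on the data in a Lipschitz way, pointwise under the
heat flow. -/
theorem norm_sub_le_heat (hη : 0 ≤ η) (hη1 : 2 * η ≤ 1)
    (hκ : 16 * η * L ≤ a) (hρ : IsWeight ρ)
    (hF : IsDecayingNonlinearity F a L) (hR : IsBddMeas R) (hR' : IsBddMeas R')
    (hw : IsDominated ρ η w) (hw' : IsDominated ρ η w')
    (he : ∀ t, 0 < t → ∀ x, w t x = picard F R w t x)
    (he' : ∀ t, 0 < t → ∀ x, w' t x = picard F R' w' t x) {t : ℝ} (ht : 0 < t) (x : E3) :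
    ‖w t x - w' t x‖ ≤ 4 / 3 * heat t (fun y => ‖R y - R' y‖) x := by
  have hd : IsBddMeas fun y => ‖R y - R' y‖ := by
    obtain ⟨C, hC⟩ := hR.bdd
    obtain ⟨C', hC'⟩ := hR'.bdd
    exact ⟨(hR.sm.sub hR'.sm).norm, C + C', fun y => by
      rw [norm_norm]; exact norm_sub_le_of_le (hC y) (hC' y)⟩
  have hb : ∀ β : ℝ, IsBddMeas fun y => 4 / 3 * ‖R y - R' y‖ + β := fun β => by
    obtain ⟨C, hC⟩ := hd.bdd
    refine ⟨(hd.sm.const_mul _).add stronglyMeasurable_const, 4 / 3 * C + |β|, fun y => ?_⟩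
    refine norm_add_le_of_le ?_ le_rfl
    rw [norm_mul, Real.norm_of_nonneg (by norm_num)]
    gcongr
    exact hC y
  -- The contraction is iterated from the crude bound 2. The coefficient 4/3 is the fixed point of β
  -- ↦ 1 + β/4, so only the term 2 (1/4)^n changes, and it tends to 0.
  have hn : ∀ n : ℕ, ∀ t, 0 < t → ∀ x, ‖w t x - w' t x‖ ≤
      heat t (fun y => 4 / 3 * ‖R y - R' y‖ + 2 * (1 / 4) ^ n) x := by
    intro n
    induction n with
    | zero =>
      intro t ht x
      have h1 := (hw.norm_le hη hρ ht x).trans hη1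
      have h2 := (hw'.norm_le hη hρ ht x).trans hη1
      refine (norm_sub_le_of_le h1 h2).trans ?_
      have hc : IsBddMeas fun _ : E3 => (2 : ℝ) := ⟨stronglyMeasurable_const, 2, by simp⟩
      calc (1 : ℝ) + 1 = heat t (fun _ => (2 : ℝ)) x := by rw [heat_const]; norm_num
        _ ≤ _ := heat_mono hc (hb _) (fun y => by
          simp only [pow_zero, mul_one, le_add_iff_nonneg_left]; positivity) t x
    | succ n ih =>
      intro t ht x
      rw [he t ht x, he' t ht x]
      refine (norm_picard_sub_le hη hη1 hκ hρ hF hR hR' hw hw' (hb _) (fun y => by positivity)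
        ih ht x).trans_eq ?_
      congr 1
      ext y
      ring
  have hlim : Tendsto (fun n : ℕ => 4 / 3 * heat t (fun y => ‖R y - R' y‖) x + 2 * (1 / 4 : ℝ) ^ n)
      atTop (𝓝 (4 / 3 * heat t (fun y => ‖R y - R' y‖) x)) := by
    have := ((tendsto_pow_atTop_nhds_zero_of_lt_one (r := (1 / 4 : ℝ)) (by norm_num)
      (by norm_num)).const_mul 2).const_add (4 / 3 * heat t (fun y => ‖R y - R' y‖) x)
    simpa using this
  refine ge_of_tendsto hlim (Eventually.of_forall fun n => (hn n t ht x).trans_eq ?_)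
  have h43 : IsBddMeas fun y => 4 / 3 * ‖R y - R' y‖ := by simpa using hb 0
  rw [heat_add h43 ⟨stronglyMeasurable_const, |2 * (1 / 4) ^ n|, fun _ => le_rfl⟩, heat_const_mul,
    heat_const]

/-- Small data have a global solution of the integral equation. -/
theorem exists_isDominated_eq_picard [CompleteSpace E] (hη : 0 ≤ η) (hη1 : 2 * η ≤ 1)
    (hκ : 16 * η * L ≤ a) (hρ : IsWeight ρ)
    (hF : IsDecayingNonlinearity F a L) (hR : StronglyMeasurable R) (hRρ : ∀ x, ‖R x‖ ≤ η * ρ x) :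
    ∃ w : ℝ → E3 → E, IsDominated ρ η w ∧ ∀ t, 0 < t → ∀ x, w t x = picard F R w t x := by
  have hRb : IsBddMeas R := ⟨hR, η, fun x => (hRρ x).trans
    (mul_le_of_le_one_right hη (hρ.le_one x))⟩
  have hcb : ∀ c : ℝ, IsBddMeas fun _ : E3 => c := fun c =>
    ⟨stronglyMeasurable_const, |c|, fun _ => le_rfl⟩
  set v : ℕ → ℝ → E3 → E := fun n => (picard F R)^[n] (fun _ _ => 0) with hv
  have hsucc : ∀ n, v (n + 1) = picard F R (v n) := fun n => Function.iterate_succ_apply' _ _ _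
  have hdom : ∀ n, IsDominated ρ η (v n) := by
    intro n
    induction n with
    | zero =>
      refine ⟨continuousOn_const, fun t ht x => ?_⟩
      have := heat_nonneg hρ.nonneg t x
      simp only [hv, Function.iterate_zero, id, norm_zero]
      positivity
    | succ n ih => rw [hsucc]; exact ih.picard hη hη1 hκ hρ hF hR hRρ
  have hstep : ∀ n t, 0 < t → ∀ x, ‖v n t x - v (n + 1) t x‖ ≤ 2 * (1 / 4) ^ n := by
    intro n
    induction n with
    | zero =>
      intro t ht x
      have h1 := ((hdom 0).norm_le hη hρ ht x).trans hη1
      have h2 := ((hdom 1).norm_le hη hρ ht x).trans hη1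
      exact (norm_sub_le_of_le h1 h2).trans (by norm_num)
    | succ n ih =>
      intro t ht x
      rw [hsucc, hsucc (n + 1)]
      refine (norm_picard_sub_le hη hη1 hκ hρ hF hRb hRb (hdom n) (hdom (n + 1))
        (hcb (2 * (1 / 4) ^ n)) (fun _ => by positivity)
        (fun s hs y => (ih s hs y).trans_eq (heat_const _ _ _).symm) ht x).trans_eq ?_
      simp only [sub_self, norm_zero, zero_add]
      rw [heat_const]
      ring
  have hcauchy : ∀ t, 0 < t → ∀ x, CauchySeq fun n => v n t x := fun t ht x =>
    cauchySeq_of_le_geometric (1 / 4) 2 (by norm_num) fun n => by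
      rw [dist_eq_norm]; exact hstep n t ht x
  -- The iteration is controlled only for t > 0; elsewhere the value 0 is a default that plays no
  -- role.
  have hex : ∀ t x, ∃ l, 0 < t → Tendsto (fun n => v n t x) atTop (𝓝 l) := fun t x => by
    by_cases ht : 0 < t
    · obtain ⟨l, hl⟩ := cauchySeq_tendsto_of_complete (hcauchy t ht x)
      exact ⟨l, fun _ => hl⟩
    · exact ⟨0, fun h => absurd h ht⟩
  choose w hw using hex
  have hdist : ∀ n t, 0 < t → ∀ x, ‖v n t x - w t x‖ ≤ 8 / 3 * (1 / 4) ^ n := fun n t ht x => by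
    have := dist_le_of_le_geometric_of_tendsto (1 / 4) 2 (by norm_num)
      (fun n => by rw [dist_eq_norm]; exact hstep n t ht x) (hw t x ht) n
    rw [dist_eq_norm] at this
    exact this.trans_eq (by ring)
  have hgeo : Tendsto (fun n : ℕ => 8 / 3 * (1 / 4 : ℝ) ^ n) atTop (𝓝 0) := by
    simpa using (tendsto_pow_atTop_nhds_zero_of_lt_one (r := (1 / 4 : ℝ)) (by norm_num)
      (by norm_num)).const_mul (8 / 3)
  have hwd : IsDominated ρ η w := by
    refine ⟨?_, fun t ht x => le_of_tendsto (hw t x ht).norm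
      (Eventually.of_forall fun n => (hdom n).le t ht x)⟩
    refine TendstoUniformlyOn.continuousOn (F := fun n (p : ℝ × E3) => v n p.1 p.2) (p := atTop)
      ?_ (Frequently.of_forall fun n => (hdom n).cont)
    rw [Metric.tendstoUniformlyOn_iff]
    intro ε hε
    filter_upwards [(tendsto_order.1 hgeo).2 ε hε] with n hn p hp
    rw [dist_comm, dist_eq_norm]
    exact (hdist n p.1 hp.1 p.2).trans_lt hn
  refine ⟨w, hwd, fun t ht x => tendsto_nhds_unique
    ((tendsto_add_atTop_iff_nat 1).2 (hw t x ht)) ?_⟩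
  rw [tendsto_iff_norm_sub_tendsto_zero]
  refine squeeze_zero (fun _ => norm_nonneg _) (fun n => ?_) hgeo
  rw [hsucc]
  refine (norm_picard_sub_le hη hη1 hκ hρ hF hRb hRb (hdom n) hwd
    (hcb (8 / 3 * (1 / 4) ^ n)) (fun _ => by positivity)
    (fun s hs y => (hdist n s hs y).trans_eq (heat_const _ _ _).symm) ht x).trans ?_
  simp only [sub_self, norm_zero, zero_add]
  rw [heat_const]
  have : (0 : ℝ) ≤ (1 / 4) ^ n := by positivity
  linarith

end Picard

end QTensor
end

/-! ### The reaction term and smoothness of the constructed solution -/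

noncomputable section

set_option linter.unusedSectionVars false
set_option maxSynthPendingDepth 3

namespace QTensor

theorem Sym0.mat_injective : Function.Injective Sym0.mat := by
  intro A B h
  ext p
  exact congrFun (congrFun h p.1) p.2

theorem Sym0.mat_ofMat (M : Matrix (Fin 3) (Fin 3) ℝ) (h : M.transpose = M) (h' : M.trace = 0) :
    (Sym0.ofMat M h h').mat = M := rfl

theorem Sym0.mat_add (A B : Sym0) : (A + B).mat = A.mat + B.mat := rfl

theorem Sym0.mat_sub (A B : Sym0) : (A - B).mat = A.mat - B.mat := rfl

theorem Sym0.mat_neg (A : Sym0) : (-A).mat = -A.mat := rfl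

theorem Sym0.mat_smul (k : ℝ) (A : Sym0) : (k • A).mat = k • A.mat := rfl

theorem Sym0.trace_mul (A B : Sym0) : (A.mat * B.mat).trace = inner ℝ A B := by
  rw [Submodule.coe_inner, PiLp.inner_apply, Fintype.sum_prod_type]
  simp only [Matrix.trace, Matrix.diag, Matrix.mul_apply, Sym0.mat, Matrix.of_apply]
  refine Finset.sum_congr rfl fun i _ => Finset.sum_congr rfl fun j _ => ?_
  rw [B.2.1 j i]
  simp [mul_comm]

theorem Sym0.trace_sq (A : Sym0) : (A.mat ^ 2).trace = ‖A‖ ^ 2 := by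
  rw [sq, Sym0.trace_mul, real_inner_self_eq_norm_sq]

/-- The trace-free symmetric product on `Sym₀(3)`, as a linear map in each argument. -/
def symProdLinear : Sym0 →ₗ[ℝ] Sym0 →ₗ[ℝ] Sym0 :=
  LinearMap.mk₂ ℝ (fun P Q => Sym0.ofMat
    ((1 / 2 : ℝ) • (P.mat * Q.mat + Q.mat * P.mat) -
      ((1 / 3 : ℝ) * (P.mat * Q.mat).trace) • (1 : Matrix (Fin 3) (Fin 3) ℝ))
    (by
      simp only [Matrix.transpose_sub, Matrix.transpose_smul, Matrix.transpose_add,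
        Matrix.transpose_mul, Sym0.mat_transpose, Matrix.transpose_one]
      rw [add_comm])
    (by
      simp only [Matrix.trace_sub, Matrix.trace_smul, Matrix.trace_add, Matrix.trace_one,
        Matrix.trace_mul_comm Q.mat P.mat, smul_eq_mul]
      simp
      ring))
    (fun P P' Q => Sym0.mat_injective (by
      simp only [Sym0.mat_ofMat, Sym0.mat_add, add_mul, mul_add, Matrix.trace_add]
      module))
    (fun k P Q => Sym0.mat_injective (by
      simp only [Sym0.mat_ofMat, Sym0.mat_smul, Matrix.smul_mul, Matrix.mul_smul,
        Matrix.trace_smul, smul_eq_mul]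
      module))
    (fun P Q Q' => Sym0.mat_injective (by
      simp only [Sym0.mat_ofMat, Sym0.mat_add, add_mul, mul_add, Matrix.trace_add]
      module))
    (fun k P Q => Sym0.mat_injective (by
      simp only [Sym0.mat_ofMat, Sym0.mat_smul, Matrix.smul_mul, Matrix.mul_smul,
        Matrix.trace_smul, smul_eq_mul]
      module))

/-- The trace-free symmetric product on `Sym₀(3)`. -/
def symProd : Sym0 →L[ℝ] Sym0 →L[ℝ] Sym0 :=
  LinearMap.toContinuousLinearMap
    ((LinearMap.toContinuousLinearMap (𝕜 := ℝ) (E := Sym0) (F' := Sym0)).toLinearMap ∘ₗ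
      symProdLinear)

theorem mat_symProd_self (Q : Sym0) : (symProd Q Q).mat =
    Q.mat ^ 2 - ((1 / 3 : ℝ) * (Q.mat ^ 2).trace) • (1 : Matrix (Fin 3) (Fin 3) ℝ) := by
  change (1 / 2 : ℝ) • (Q.mat * Q.mat + Q.mat * Q.mat) -
      ((1 / 3 : ℝ) * (Q.mat * Q.mat).trace) • (1 : Matrix (Fin 3) (Fin 3) ℝ) = _
  rw [sq]
  module

theorem reaction_eq (a b c : ℝ) (Q : Sym0) :
    reaction a b c Q = -(a • Q) + b • symProd Q Q - (c * ‖Q‖ ^ 2) • Q := by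
  apply Sym0.mat_injective
  rw [reaction, Sym0.mat_ofMat, Sym0.mat_sub, Sym0.mat_add, Sym0.mat_neg, Sym0.mat_smul,
    Sym0.mat_smul, Sym0.mat_smul, mat_symProd_self, ← Sym0.trace_sq]

theorem norm_symProd_sub_le (v w : Sym0) :
    ‖symProd v v - symProd w w‖ ≤ ‖symProd‖ * (‖v‖ + ‖w‖) * ‖v - w‖ := by
  have e : symProd v v - symProd w w = symProd (v - w) v + symProd w (v - w) := by
    simp only [map_sub, sub_apply]
    abel
  rw [e]
  have h1 := symProd.le_opNorm₂ (v - w) v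
  have h2 := symProd.le_opNorm₂ w (v - w)
  exact (norm_add_le_of_le h1 h2).trans_eq (by ring)

theorem norm_cubic_sub_le (v w : Sym0) :
    ‖‖v‖ ^ 2 • v - ‖w‖ ^ 2 • w‖ ≤ (‖v‖ ^ 2 + (‖v‖ + ‖w‖) * ‖w‖) * ‖v - w‖ := by
  have e : ‖v‖ ^ 2 • v - ‖w‖ ^ 2 • w = ‖v‖ ^ 2 • (v - w) + (‖v‖ ^ 2 - ‖w‖ ^ 2) • w := by module
  rw [e]
  refine (norm_add_le _ _).trans ?_
  rw [norm_smul, norm_smul, Real.norm_of_nonneg (by positivity : 0 ≤ ‖v‖ ^ 2)]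
  have h : ‖‖v‖ ^ 2 - ‖w‖ ^ 2‖ ≤ (‖v‖ + ‖w‖) * ‖v - w‖ := by
    rw [sq_sub_sq, norm_mul, Real.norm_of_nonneg (by positivity : 0 ≤ ‖v‖ + ‖w‖)]
    gcongr
    exact abs_norm_sub_norm_le v w
  nlinarith [norm_nonneg w, mul_le_mul_of_nonneg_right h (norm_nonneg w)]

/-- One-sided Lipschitz bound for the reaction term. -/
theorem inner_reaction_sub_le (a b c : ℝ) (ha : 0 < a) (hb : 0 < b) (hc : 0 < c) (v w : Sym0) :
    inner ℝ (reaction a b c v - reaction a b c w) (v - w) ≤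
      (b * ‖symProd‖) ^ 2 / c * ‖v - w‖ ^ 2 := by
  have e : reaction a b c v - reaction a b c w = (-a) • (v - w) +
      b • (symProd v v - symProd w w) - c • (‖v‖ ^ 2 • v - ‖w‖ ^ 2 • w) := by
    rw [reaction_eq, reaction_eq]; module
  rw [e, inner_sub_left, inner_add_left, real_inner_smul_left, real_inner_smul_left,
    real_inner_smul_left, real_inner_self_eq_norm_sq]
  have h1 : inner ℝ (symProd v v - symProd w w) (v - w) ≤
      ‖symProd‖ * (‖v‖ + ‖w‖) * ‖v - w‖ ^ 2 := by
    refine (real_inner_le_norm _ _).trans ?_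
    calc _ ≤ ‖symProd‖ * (‖v‖ + ‖w‖) * ‖v - w‖ * ‖v - w‖ := by
          gcongr; exact norm_symProd_sub_le v w
      _ = _ := by ring
  have h2 : 1 / 2 * (‖v‖ ^ 2 + ‖w‖ ^ 2) * ‖v - w‖ ^ 2 ≤
      inner ℝ (‖v‖ ^ 2 • v - ‖w‖ ^ 2 • w) (v - w) := by
    have e2 : inner ℝ (‖v‖ ^ 2 • v - ‖w‖ ^ 2 • w) (v - w) =
        1 / 2 * (‖v‖ ^ 2 + ‖w‖ ^ 2) * ‖v - w‖ ^ 2 + 1 / 2 * (‖v‖ ^ 2 - ‖w‖ ^ 2) ^ 2 := by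
      rw [norm_sub_sq_real]
      simp only [inner_sub_left, inner_sub_right, real_inner_smul_left,
        real_inner_self_eq_norm_sq, real_inner_comm v w]
      ring
    rw [e2]
    nlinarith [sq_nonneg (‖v‖ ^ 2 - ‖w‖ ^ 2)]
  set k := b * ‖symProd‖ with hk
  -- Completing squares: the Lipschitz factor of the quadratic term, which grows linearly, is
  -- absorbed by the monotone cubic term. The resulting constant does not depend on the sizes of v
  -- and w, so uniqueness needs no sup bound on the solutions.
  have h3 : k * (‖v‖ + ‖w‖) ≤ k ^ 2 / c + c * (1 / 2 * (‖v‖ ^ 2 + ‖w‖ ^ 2)) := by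
    have : k ^ 2 / c + c * (1 / 2 * (‖v‖ ^ 2 + ‖w‖ ^ 2)) - k * (‖v‖ + ‖w‖) =
        ((k - c * ‖v‖) ^ 2 + (k - c * ‖w‖) ^ 2) / (2 * c) := by field_simp; ring
    have : 0 ≤ ((k - c * ‖v‖) ^ 2 + (k - c * ‖w‖) ^ 2) / (2 * c) := by positivity
    linarith
  have h4 := mul_le_mul_of_nonneg_right h3 (sq_nonneg ‖v - w‖)
  nlinarith [mul_le_mul_of_nonneg_left h1 hb.le, mul_le_mul_of_nonneg_left h2 hc.le,
    mul_nonneg ha.le (sq_nonneg ‖v - w‖)]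

/-- The nonlinearity of the equation for `w = e^(at) Q`. -/
def scaledReaction (a b c : ℝ) (s : ℝ) (w : Sym0) : Sym0 :=
  (b * Real.exp (-a * s)) • symProd w w - (c * Real.exp (-a * s) ^ 2 * ‖w‖ ^ 2) • w

/-- The Lipschitz constant of `scaledReaction`. -/
def reactionConst (b c : ℝ) : ℝ := b * ‖symProd‖ + 2 * c

theorem isDecayingNonlinearity_scaledReaction {a b c : ℝ} (ha : 0 < a) (hb : 0 < b) (hc : 0 < c) :
    IsDecayingNonlinearity (scaledReaction a b c) a (reactionConst b c) where
  pos := ha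
  nonneg := by unfold reactionConst; positivity
  cont := by unfold scaledReaction; fun_prop
  zero s := by simp [scaledReaction]
  lip s hs v w hv hw := by
    have he0 : 0 < Real.exp (-a * s) := Real.exp_pos _
    have he1 : Real.exp (-a * s) ≤ 1 := Real.exp_le_one_iff.2 (by nlinarith)
    set e := Real.exp (-a * s) with he
    have e1 : scaledReaction a b c s v - scaledReaction a b c s w =
        (b * e) • (symProd v v - symProd w w) - (c * e ^ 2) • (‖v‖ ^ 2 • v - ‖w‖ ^ 2 • w) := by
      rw [scaledReaction, scaledReaction]; module
    rw [e1]
    refine (norm_sub_le _ _).trans ?_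
    rw [norm_smul, norm_smul, Real.norm_of_nonneg (by positivity : 0 ≤ b * e),
      Real.norm_of_nonneg (by positivity : 0 ≤ c * e ^ 2)]
    have h2 : ‖‖v‖ ^ 2 • v - ‖w‖ ^ 2 • w‖ ≤ 2 * (‖v‖ + ‖w‖) * ‖v - w‖ := by
      refine (norm_cubic_sub_le v w).trans ?_
      gcongr
      nlinarith [norm_nonneg v, norm_nonneg w]
    have h3 : c * e ^ 2 ≤ c * e := by gcongr; nlinarith
    calc _ ≤ b * e * (‖symProd‖ * (‖v‖ + ‖w‖) * ‖v - w‖) +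
          c * e * (2 * (‖v‖ + ‖w‖) * ‖v - w‖) := by
          gcongr
          exact norm_symProd_sub_le v w
      _ = _ := by unfold reactionConst; ring

/-- The autonomous system for the pair `(w, e^(-at))`. -/
def extendedReaction (a b c : ℝ) (p : Sym0 × ℝ) : Sym0 × ℝ :=
  ((b * p.2) • symProd p.1 p.1 - (c * p.2 ^ 2 * ‖p.1‖ ^ 2) • p.1, -a * p.2)

theorem contDiff_extendedReaction (a b c : ℝ) : ContDiff ℝ ∞ (extendedReaction a b c) := by
  have h1 : ContDiff ℝ ∞ fun p : Sym0 × ℝ => b * p.2 := by fun_prop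
  have h2 : ContDiff ℝ ∞ fun p : Sym0 × ℝ => c * p.2 ^ 2 := by fun_prop
  have h3 : ContDiff ℝ ∞ fun p : Sym0 × ℝ => -a * p.2 := by fun_prop
  exact ((h1.smul ((symProd.contDiff.comp contDiff_fst).clm_apply contDiff_fst)).sub
    ((h2.mul ((contDiff_norm_sq ℝ).comp contDiff_fst)).smul contDiff_fst)).prodMk h3

theorem two_le_infty : (2 : WithTop ℕ∞) ≤ ((⊤ : ℕ∞) : WithTop ℕ∞) :=
  WithTop.coe_le_coe.2 (le_top : (2 : ℕ∞) ≤ ⊤)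

section Classical

variable {a b c η : ℝ} {ρ : E3 → ℝ} {R : E3 → Sym0} {w : ℝ → E3 → Sym0}

/-- The regularity theory is for autonomous equations. Adjoining z = e^(-at), which is constant in
space and satisfies z' = -az, removes the explicit time dependence at the cost of one more unknown.
-/
theorem isMild_extended (ha : 0 < a) (hb : 0 < b) (hc : 0 < c) (hη : 0 ≤ η) (hη1 : 2 * η ≤ 1)
    (hρ : IsWeight ρ) (hR : IsBddMeas R) (hw : IsDominated ρ η w)
    (he : ∀ t, 0 < t → ∀ x, w t x = picard (scaledReaction a b c) R w t x) (T : ℝ) :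
    IsMild (extendedReaction a b c) T (fun x => (R x, 1)) (fun t x => (w t x, Real.exp (-a * t))) := by
  have hF := isDecayingNonlinearity_scaledReaction ha hb hc
  have hs := hw.isSource hη hη1 hρ hF T
  have hz : IsSource T (fun (s : ℝ) (_ : E3) => -a * Real.exp (-a * s)) a := by
    refine ⟨by fun_prop, fun t ht x => ?_⟩
    rw [norm_mul, norm_neg, Real.norm_of_nonneg ha.le, Real.norm_of_nonneg (Real.exp_pos _).le]
    exact mul_le_of_le_one_right ha.le (Real.exp_le_one_iff.2 (by nlinarith [ht.1]))
  have h1 : IsBddMeas fun _ : E3 => (1 : ℝ) := ⟨stronglyMeasurable_const, 1, by simp⟩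
  refine ⟨⟨hR.sm.prodMk stronglyMeasurable_const, ?_⟩, ?_, ⟨max 1 1, fun t ht x => ?_⟩,
    fun t ht x => ?_⟩
  · obtain ⟨M, hM⟩ := hR.bdd
    exact ⟨max M 1, fun x => max_le_max (hM x) (by simp)⟩
  · exact (hw.cont.mono (prod_mono (fun t ht => ht.1) le_rfl)).prodMk (by fun_prop)
  · refine max_le_max ((hw.norm_le hη hρ ht.1 x).trans hη1) ?_
    rw [Real.norm_of_nonneg (Real.exp_pos _).le]
    exact Real.exp_le_one_iff.2 (by nlinarith [ht.1])
  · have hpair : duhamel (fun s y => extendedReaction a b c (w s y, Real.exp (-a * s))) t x =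
        (duhamel (fun s y => scaledReaction a b c s (w s y)) t x,
          duhamel (fun s (_ : E3) => -a * Real.exp (-a * s)) t x) := by
      simp only [duhamel, intervalIntegral.integral_of_le ht.1.le, integral_Ioc_eq_integral_Ioo]
      rw [← integral_pair]
      · refine setIntegral_congr_fun measurableSet_Ioo fun τ hτ => ?_
        have hm := sub_mem_Ioo_of hτ.1 hτ.2 ht.2
        exact heat_prodMk (hs.isBddMeas hm) (hz.isBddMeas hm) τ x
      · exact (intervalIntegrable_iff_integrableOn_Ioo_of_le ht.1.le).1
          (hs.intervalIntegrable_heat ht.1.le ht.2 x)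
      · exact (intervalIntegrable_iff_integrableOn_Ioo_of_le ht.1.le).1
          (hz.intervalIntegrable_heat ht.1.le ht.2 x)
    rw [hpair, heat_prodMk hR h1, heat_const, Prod.mk_add_mk, ← picard, ← he t ht.1 x]
    congr 1
    simp only [duhamel, heat_const]
    have hd : ∀ τ ∈ uIcc 0 t, HasDerivAt (fun τ => -Real.exp (-a * (t - τ)))
        (-a * Real.exp (-a * (t - τ))) τ := fun τ _ => by
      refine ((((hasDerivAt_id τ).const_sub t).const_mul (-a)).exp).neg.congr_deriv ?_
      simp only [id]
      ring
    rw [intervalIntegral.integral_eq_sub_of_hasDerivAt hd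
      (Continuous.intervalIntegrable (by fun_prop) _ _)]
    simp

theorem contDiffOn_of_picard (ha : 0 < a) (hb : 0 < b) (hc : 0 < c) (hη : 0 ≤ η) (hη1 : 2 * η ≤ 1)
    (hρ : IsWeight ρ) (hR : IsBddMeas R) (hw : IsDominated ρ η w)
    (he : ∀ t, 0 < t → ∀ x, w t x = picard (scaledReaction a b c) R w t x) :
    ContDiffOn ℝ ∞ (fun p : ℝ × E3 => w p.1 p.2) (Ioi 0 ×ˢ univ) := by
  rintro ⟨t, x⟩ ⟨ht, -⟩
  have h := (isMild_extended ha hb hc hη hη1 hρ hR hw he (t + 1)).contDiffOn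
    (contDiff_extendedReaction a b c)
  exact (h.fst.contDiffAt ((isOpen_Ioo.prod isOpen_univ).mem_nhds
    ⟨⟨ht, by simp⟩, mem_univ _⟩)).contDiffWithinAt

theorem hasDerivAt_of_picard (ha : 0 < a) (hb : 0 < b) (hc : 0 < c) (hη : 0 ≤ η) (hη1 : 2 * η ≤ 1)
    (hρ : IsWeight ρ) (hR : IsBddMeas R) (hw : IsDominated ρ η w)
    (he : ∀ t, 0 < t → ∀ x, w t x = picard (scaledReaction a b c) R w t x) {t : ℝ} (ht : 0 < t)
    (x : E3) : HasDerivAt (fun s => w s x)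
      (Laplacian.laplacian (w t) x + scaledReaction a b c t (w t x)) t := by
  have hm : t ∈ Ioo 0 (t + 1) := ⟨ht, by simp⟩
  have h := isMild_extended ha hb hc hη hη1 hρ hR hw he (t + 1)
  have hG := contDiff_extendedReaction a b c
  have h1 := (ContinuousLinearMap.fst ℝ Sym0 ℝ).hasFDerivAt.comp_hasDerivAt t (h.hasDerivAt hG hm x)
  refine h1.congr_deriv ?_
  rw [map_add, ← laplacian_eq_secondTrace]
  congr 1
  have hcd : ContDiffAt ℝ 2 (fun x => (w t x, Real.exp (-a * t))) x := by
    have := (h.contDiffOn hG).contDiffAt ((isOpen_Ioo.prod isOpen_univ).mem_nhds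
      (show (t, x) ∈ Ioo 0 (t + 1) ×ˢ (univ : Set E3) from ⟨hm, mem_univ _⟩))
    exact (this.of_le two_le_infty).comp (f := fun x => (t, x)) x (by fun_prop)
  exact (hcd.laplacian_CLM_comp_left (l := ContinuousLinearMap.fst ℝ Sym0 ℝ)).symm

theorem isClassicalSolution_of_picard (ha : 0 < a) (hb : 0 < b) (hc : 0 < c) (hη : 0 ≤ η)
    (hη1 : 2 * η ≤ 1) (hρ : IsWeight ρ) (hR : IsBddMeas R) (hw : IsDominated ρ η w)
    (he : ∀ t, 0 < t → ∀ x, w t x = picard (scaledReaction a b c) R w t x) :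
    IsClassicalSolution a b c (fun t x => Real.exp (-a * t) • w t x) := by
  have hcd := contDiffOn_of_picard ha hb hc hη hη1 hρ hR hw he
  have hexp' : ContDiff ℝ ∞ fun p : ℝ × E3 => Real.exp (-a * p.1) := by fun_prop
  refine ⟨hexp'.contDiffOn.smul hcd, fun t ht x => ?_⟩
  have hd := hasDerivAt_of_picard ha hb hc hη hη1 hρ hR hw he ht x
  have hexp : HasDerivAt (fun s : ℝ => Real.exp (-a * s)) (-a * Real.exp (-a * t)) t := by
    refine (((hasDerivAt_id t).const_mul (-a)).exp).congr_deriv ?_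
    simp only [id]
    ring
  refine (hexp.smul hd).congr_deriv ?_
  have hcx : ContDiffAt ℝ 2 (w t) x := by
    have := hcd.contDiffAt ((isOpen_Ioi.prod isOpen_univ).mem_nhds
      (show (t, x) ∈ Ioi (0 : ℝ) ×ˢ (univ : Set E3) from ⟨ht, mem_univ _⟩))
    exact (this.of_le two_le_infty).comp (f := fun x => (t, x)) x (by fun_prop)
  have hl : Laplacian.laplacian (fun y => Real.exp (-a * t) • w t y) x =
      Real.exp (-a * t) • Laplacian.laplacian (w t) x :=
    InnerProductSpace.laplacian_smul (Real.exp (-a * t)) hcx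
  rw [hl, reaction_eq, scaledReaction, norm_smul, Real.norm_of_nonneg (Real.exp_pos _).le]
  simp only [map_smul, smul_apply]
  module

end Classical

end QTensor
end

/-! ### Localized energy: integration by parts with a cutoff -/

noncomputable section

set_option linter.unusedSectionVars false
set_option maxSynthPendingDepth 3

namespace QTensor

/-- Integrating by parts twice gives -∫ φ|∇D|² + ½ ∫ Δφ |D|², and the first term has a sign. With
both derivatives on φ, no integrability of ∇D is required. -/
theorem integral_cutoff_inner_laplacian_le {V : Type*} [NormedAddCommGroup V]
    [InnerProductSpace ℝ V] [CompleteSpace V] {D : E3 → V} (hD : ContDiff ℝ ∞ D) {φ : E3 → ℝ}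
    (hφ : ContDiff ℝ ∞ φ) (hc : HasCompactSupport φ) (h0 : ∀ x, 0 ≤ φ x) :
    ∫ x, φ x * inner ℝ (D x) (Laplacian.laplacian D x) ≤
      1 / 2 * ∫ x, Laplacian.laplacian φ x * ‖D x‖ ^ 2 := by
  set e := EuclideanSpace.basisFun (Fin 3) ℝ with he
  have hD1 : ContDiff ℝ ∞ (fderiv ℝ D) := hD.fderiv_right (by simp)
  have hφ1 : ContDiff ℝ ∞ (fderiv ℝ φ) := hφ.fderiv_right (by simp)
  have hD2 : ContDiff ℝ ∞ (fderiv ℝ (fderiv ℝ D)) := hD1.fderiv_right (by simp)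
  have hφ2 : ContDiff ℝ ∞ (fderiv ℝ (fderiv ℝ φ)) := hφ1.fderiv_right (by simp)
  have cD := hD.continuous
  have cφ := hφ.continuous
  have cD1 := hD1.continuous
  have cφ1 := hφ1.continuous
  have cD2 := hD2.continuous
  have cφ2 := hφ2.continuous
  have hzero : ∀ x, x ∉ tsupport φ → φ x = 0 := fun x hx => image_eq_zero_of_notMem_tsupport hx
  have hc1 : ∀ v : E3, HasCompactSupport fun x => fderiv ℝ φ x v := fun v =>
    (hc.fderiv (𝕜 := ℝ)).comp_left (g := fun L : E3 →L[ℝ] ℝ => L v) (by simp)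
  have hc2 : ∀ v : E3, HasCompactSupport fun x => fderiv ℝ (fderiv ℝ φ) x v v := fun v =>
    ((hc.fderiv (𝕜 := ℝ)).fderiv (𝕜 := ℝ)).comp_left
      (g := fun L : E3 →L[ℝ] E3 →L[ℝ] ℝ => L v v) (by simp)
  have hdD : ∀ x, HasFDerivAt D (fderiv ℝ D x) x := fun x =>
    (hD.differentiable (by simp) x).hasFDerivAt
  have hdφ : ∀ x, HasFDerivAt φ (fderiv ℝ φ x) x := fun x =>
    (hφ.differentiable (by simp) x).hasFDerivAt
  have hdD1 : ∀ (v : E3) x, HasFDerivAt (fun x => fderiv ℝ D x v)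
      ((ContinuousLinearMap.apply ℝ V v).comp (fderiv ℝ (fderiv ℝ D) x)) x := fun v x =>
    (ContinuousLinearMap.apply ℝ V v).hasFDerivAt.comp x
      (hD1.differentiable (by simp) x).hasFDerivAt
  have hdφ1 : ∀ (v : E3) x, HasFDerivAt (fun x => fderiv ℝ φ x v)
      ((ContinuousLinearMap.apply ℝ ℝ v).comp (fderiv ℝ (fderiv ℝ φ) x)) x := fun v x =>
    (ContinuousLinearMap.apply ℝ ℝ v).hasFDerivAt.comp x
      (hφ1.differentiable (by simp) x).hasFDerivAt
  have hdv : ∀ x, HasFDerivAt (fun x => ‖D x‖ ^ 2)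
      (2 • (innerSL ℝ (D x)).comp (fderiv ℝ D x)) x := fun x => (hdD x).norm_sq
  have hint1 : ∀ v : E3, Integrable fun x => φ x * inner ℝ (D x) (fderiv ℝ (fderiv ℝ D) x v v) :=
    fun v => Continuous.integrable_of_hasCompactSupport (by fun_prop) hc.mul_right
  have hint2 : ∀ v : E3, Integrable fun x => fderiv ℝ (fderiv ℝ φ) x v v * ‖D x‖ ^ 2 :=
    fun v => Continuous.integrable_of_hasCompactSupport (by fun_prop) (hc2 v).mul_right
  have hint3 : ∀ v : E3, Integrable fun x => fderiv ℝ φ x v * inner ℝ (D x) (fderiv ℝ D x v) :=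
    fun v => Continuous.integrable_of_hasCompactSupport (by fun_prop) (hc1 v).mul_right
  have hint4 : ∀ v : E3, Integrable fun x => φ x * ‖fderiv ℝ D x v‖ ^ 2 :=
    fun v => Continuous.integrable_of_hasCompactSupport (by fun_prop) hc.mul_right
  have hint5 : ∀ v : E3, Integrable fun x => φ x * inner ℝ (D x) (fderiv ℝ D x v) :=
    fun v => Continuous.integrable_of_hasCompactSupport (by fun_prop) hc.mul_right
  have hint6 : ∀ v : E3, Integrable fun x => fderiv ℝ φ x v * ‖D x‖ ^ 2 :=
    fun v => Continuous.integrable_of_hasCompactSupport (by fun_prop) (hc1 v).mul_right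
  have key : ∀ v : E3, ∫ x, φ x * inner ℝ (D x) (fderiv ℝ (fderiv ℝ D) x v v) ≤
      1 / 2 * ∫ x, fderiv ℝ (fderiv ℝ φ) x v v * ‖D x‖ ^ 2 := by
    intro v
    have hprod : ∀ x, HasFDerivAt (fun x => φ x • D x)
        (φ x • fderiv ℝ D x + (fderiv ℝ φ x).smulRight (D x)) x := fun x =>
      (hdφ x).smul (hdD x)
    let B : V →L[ℝ] V →L[ℝ] ℝ := innerSL ℝ
    have hB : ∀ p q : V, B p q = inner ℝ p q := fun _ _ => rfl
    have i1 := integral_bilinear_hasFDerivAt_right_eq_neg_left_of_integrable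
      (μ := (volume : Measure E3)) (B := B)
      (f := fun x => φ x • D x) (g := fun x => fderiv ℝ D x v) (v := v)
      (f' := fun x => φ x • fderiv ℝ D x + (fderiv ℝ φ x).smulRight (D x))
      (g' := fun x => (ContinuousLinearMap.apply ℝ V v).comp (fderiv ℝ (fderiv ℝ D) x)) ?_ ?_ ?_
      (fun x _ => hprod x) (fun x _ => hdD1 v x)
    -- The cross term ∂ᵥφ ⟨D, ∂ᵥD⟩ is half of ∂ᵥφ ∂ᵥ|D|², which allows the second integration by
    -- parts.
    · have i2 := integral_mul_fderiv_eq_neg_fderiv_mul_of_integrable (μ := (volume : Measure E3))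
        (f := fun x => fderiv ℝ φ x v) (g := fun x => ‖D x‖ ^ 2) (v := v) ?_ ?_ (hint6 v)
        (fun x _ => (hdφ1 v x).differentiableAt) (fun x _ => (hdv x).differentiableAt)
      · simp only [(hdv _).fderiv, (hdφ1 v _).fderiv] at i2
        simp only [hB, innerSL_apply_apply, real_inner_smul_left, inner_add_left, add_apply,
          smul_apply, ContinuousLinearMap.smulRight_apply, ContinuousLinearMap.comp_apply,
          ContinuousLinearMap.apply_apply,
          real_inner_self_eq_norm_sq, nsmul_eq_mul, Nat.cast_ofNat] at i1 i2
        rw [i1, integral_add (hint4 v) (hint3 v)]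
        have i3 : ∫ x, fderiv ℝ φ x v * (2 * inner ℝ (D x) (fderiv ℝ D x v)) =
            2 * ∫ x, fderiv ℝ φ x v * inner ℝ (D x) (fderiv ℝ D x v) := by
          rw [← integral_const_mul]
          congr 1
          ext x
          ring
        have i4 : 0 ≤ ∫ x, φ x * ‖fderiv ℝ D x v‖ ^ 2 :=
          integral_nonneg fun x => mul_nonneg (h0 x) (by positivity)
        rw [i3] at i2
        linarith
      · simp only [(hdφ1 v _).fderiv]
        exact hint2 v
      · simp only [(hdv _).fderiv]
        refine ((hint3 v).const_mul 2).congr (ae_of_all _ fun x => ?_)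
        simp
        ring
    · refine ((hint4 v).add (hint3 v)).congr (ae_of_all _ fun x => ?_)
      simp [hB]
    · refine (hint1 v).congr (ae_of_all _ fun x => ?_)
      simp [hB]
    · refine (hint5 v).congr (ae_of_all _ fun x => ?_)
      simp [hB]
  simp only [laplacian_eq_secondTrace, secondTrace_apply, inner_sum, Finset.mul_sum, Finset.sum_mul]
  rw [integral_finsetSum _ fun i _ => hint1 _, integral_finsetSum _ fun i _ => hint2 _,
    Finset.mul_sum]
  exact Finset.sum_le_sum fun i _ => key _

theorem hasDerivAt_integral_cutoff {g : ℝ × E3 → ℝ}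
    (hg : ContDiffOn ℝ ∞ g (Ioi 0 ×ˢ univ)) {φ : E3 → ℝ} (hφ : Continuous φ)
    (hc : HasCompactSupport φ) {t : ℝ} (ht : 0 < t) :
    HasDerivAt (fun s => ∫ x, φ x * g (s, x)) (∫ x, φ x * fderiv ℝ g (t, x) (1, 0)) t := by
  have hopen : IsOpen (Ioi (0 : ℝ) ×ˢ (univ : Set E3)) := isOpen_Ioi.prod isOpen_univ
  have hg' : ContinuousOn (fun p => fderiv ℝ g p (1, 0)) (Ioi 0 ×ˢ univ) :=
    (hg.continuousOn_fderiv_of_isOpen hopen (by simp)).clm_apply continuousOn_const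
  have hgx : ∀ s : ℝ, 0 < s → Continuous fun x => g (s, x) := fun s hs =>
    hg.continuousOn.comp_continuous (f := fun x => (s, x)) (by fun_prop) fun x => ⟨hs, mem_univ _⟩
  have hgx' : ∀ s : ℝ, 0 < s → Continuous fun x => fderiv ℝ g (s, x) (1, 0) := fun s hs =>
    hg'.comp_continuous (f := fun x => (s, x)) (by fun_prop) fun x => ⟨hs, mem_univ _⟩
  have hK : IsCompact (Icc (t / 2) (2 * t) ×ˢ tsupport φ) := isCompact_Icc.prod hc
  obtain ⟨C, hC⟩ := hK.exists_bound_of_continuousOn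
    (f := fun p : ℝ × E3 => φ p.2 * fderiv ℝ g p (1, 0))
    (((hφ.comp continuous_snd).continuousOn).mul (hg'.mono fun p hp =>
      ⟨lt_of_lt_of_le (half_pos ht) hp.1.1, mem_univ _⟩))
  have hnear : Ioo (t / 2) (2 * t) ∈ 𝓝 t := isOpen_Ioo.mem_nhds ⟨by linarith, by linarith⟩
  refine (hasDerivAt_integral_of_dominated_loc_of_deriv_le (μ := (volume : Measure E3)) (𝕜 := ℝ)
    (F := fun s x => φ x * g (s, x)) (F' := fun s x => φ x * fderiv ℝ g (s, x) (1, 0))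
    (bound := (tsupport φ).indicator fun _ => C) hnear ?_ ?_ ?_ ?_ ?_ ?_).2
  · filter_upwards [hnear] with s hs
    exact (hφ.mul (hgx s (by linarith [hs.1]))).aestronglyMeasurable
  · exact (hφ.mul (hgx t ht)).integrable_of_hasCompactSupport hc.mul_right
  · exact (hφ.mul (hgx' t ht)).aestronglyMeasurable
  · refine ae_of_all _ fun x s hs => ?_
    by_cases hx : x ∈ tsupport φ
    · rw [indicator_of_mem hx]
      exact hC (s, x) ⟨⟨hs.1.le, hs.2.le⟩, hx⟩
    · rw [indicator_of_notMem hx, image_eq_zero_of_notMem_tsupport hx]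
      simp
  · exact (integrable_indicator_iff (isClosed_tsupport φ).measurableSet).2
      (integrableOn_const (hs := hc.measure_lt_top.ne))
  · refine ae_of_all _ fun x s hs => ?_
    have hs0 : 0 < s := by linarith [hs.1]
    have hd := ((hg.contDiffAt (hopen.mem_nhds (show (s, x) ∈ _ from
      ⟨hs0, mem_univ _⟩))).differentiableAt (by simp)).hasFDerivAt
    have hline : HasDerivAt (fun s : ℝ => (s, x)) ((1 : ℝ), (0 : E3)) s :=
      (hasDerivAt_id s).prodMk (hasDerivAt_const s x)
    exact (hd.comp_hasDerivAt s hline).const_mul (φ x)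

/-- A smooth cutoff at scale `R`. -/
def cutoff (R : ℝ) (x : E3) : ℝ := (⟨1, 2, one_pos, one_lt_two⟩ : ContDiffBump (0 : E3)) (R⁻¹ • x)

theorem contDiff_cutoff (R : ℝ) : ContDiff ℝ ∞ (cutoff R) :=
  (ContDiffBump.contDiff _).comp (contDiff_const_smul _)

theorem cutoff_nonneg (R : ℝ) (x : E3) : 0 ≤ cutoff R x := ContDiffBump.nonneg _

theorem cutoff_le_one (R : ℝ) (x : E3) : cutoff R x ≤ 1 := ContDiffBump.le_one _

theorem hasCompactSupport_cutoff {R : ℝ} (hR : 0 < R) : HasCompactSupport (cutoff R) :=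
  (ContDiffBump.hasCompactSupport _).comp_smul (inv_ne_zero hR.ne')

theorem tendsto_cutoff (x : E3) : Tendsto (fun R : ℝ => cutoff R x) atTop (𝓝 1) := by
  refine tendsto_const_nhds.congr' ?_
  filter_upwards [eventually_gt_atTop 0, eventually_ge_atTop ‖x‖] with R h0 hR
  refine (ContDiffBump.one_of_mem_closedBall _ ?_).symm
  rw [mem_closedBall_zero_iff, norm_smul, norm_inv, Real.norm_of_nonneg h0.le]
  exact inv_mul_le_one_of_le₀ hR h0.le

/-- Each derivative of the rescaled bump costs a factor R⁻¹; the factor R⁻² is what makes the cutoff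
error vanish as R → ∞. -/
theorem exists_laplacian_cutoff_le :
    ∃ C, 0 ≤ C ∧ ∀ R x, |Laplacian.laplacian (cutoff R) x| ≤ C * (R⁻¹) ^ 2 := by
  set f : ContDiffBump (0 : E3) := ⟨1, 2, one_pos, one_lt_two⟩
  have hf : ContDiff ℝ ∞ f := f.contDiff
  have h2 : Continuous (fderiv ℝ (fderiv ℝ f)) :=
    ((hf.fderiv_right (m := ∞) (by simp)).fderiv_right (m := ∞) (by simp)).continuous
  have hcs : HasCompactSupport (fderiv ℝ (fderiv ℝ f)) :=
    (f.hasCompactSupport.fderiv (𝕜 := ℝ)).fderiv (𝕜 := ℝ)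
  obtain ⟨C, hC⟩ := hcs.exists_bound_of_continuous h2
  refine ⟨3 * C, mul_nonneg (by norm_num) ((norm_nonneg _).trans (hC 0)), fun R x => ?_⟩
  have e1 : fderiv ℝ (cutoff R) = fun x => R⁻¹ • fderiv ℝ f (R⁻¹ • x) := by
    ext1 x
    exact fderiv_comp_smul (f := f) (c := R⁻¹) (x := x)
  have e2 : fderiv ℝ (fderiv ℝ (cutoff R)) x = (R⁻¹) ^ 2 • fderiv ℝ (fderiv ℝ f) (R⁻¹ • x) := by
    have hd : Differentiable ℝ (fderiv ℝ f) :=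
      (hf.fderiv_right (m := ∞) (by simp)).differentiable (by simp)
    have hd' : DifferentiableAt ℝ (fun x : E3 => fderiv ℝ f (R⁻¹ • x)) x :=
      (hd _).comp x (f := fun x : E3 => R⁻¹ • x) (by fun_prop)
    rw [e1, fderiv_fun_const_smul hd', fderiv_comp_smul (f := fderiv ℝ f), smul_smul, sq]
  rw [laplacian_eq_secondTrace, ← Real.norm_eq_abs]
  refine (norm_secondTrace_le _).trans ?_
  rw [e2, norm_smul, norm_pow, Real.norm_eq_abs, sq_abs]
  have := hC (R⁻¹ • x)
  nlinarith [sq_nonneg (R⁻¹)]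

end QTensor
end

/-! ### Uniqueness of trajectories -/

noncomputable section

set_option linter.unusedSectionVars false
set_option maxSynthPendingDepth 3

namespace QTensor

theorem norm_sq_eq_integral (f : Lp Sym0 2 (volume : Measure E3)) : ‖f‖ ^ 2 = ∫ x, ‖f x‖ ^ 2 := by
  rw [← real_inner_self_eq_norm_sq, L2.inner_def]
  simp only [real_inner_self_eq_norm_sq]

theorem integrable_norm_sq (f : Lp Sym0 2 (volume : Measure E3)) :
    Integrable fun x => ‖f x‖ ^ 2 := by
  have := L2.integrable_inner (𝕜 := ℝ) f f
  simpa only [real_inner_self_eq_norm_sq] using this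

theorem phase_ext {p q : H} (h : profile p =ᵐ[volume] profile q) : p = q := by
  apply Subtype.ext
  have h1 : p.1.1 = q.1.1 := Lp.ext h
  have hp : (p.1.1 : E3 → Sym0) =ᵐ[volume] p.1.2 := p.2
  have hq : (q.1.1 : E3 → Sym0) =ᵐ[volume] q.1.2 := q.2
  exact Prod.ext h1 (Lp.ext (hp.symm.trans (h.trans hq)))

theorem profile_sub (p q : H) : profile (p - q) =ᵐ[volume] fun x => profile p x - profile q x :=
  Lp.coeFn_sub p.1.1 q.1.1



theorem slice_contDiff {u : ℝ → E3 → Sym0}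
    (h : ContDiffOn ℝ ∞ (fun p : ℝ × E3 => u p.1 p.2) (Ioi (0 : ℝ) ×ˢ (univ : Set E3))) {t : ℝ}
    (ht : 0 < t) : ContDiff ℝ ∞ (u t) := by
  have : ContDiffOn ℝ ∞ (fun x : E3 => u t x) univ :=
    h.comp (t := Ioi (0 : ℝ) ×ˢ (univ : Set E3)) (f := fun x : E3 => (t, x))
      (contDiff_const.prodMk contDiff_id).contDiffOn fun x _ => ⟨ht, mem_univ _⟩
  exact contDiffOn_univ.1 this

theorem hasDerivAt_cutoff_energy {a b c : ℝ} {u v : ℝ → E3 → Sym0}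
    (hu : IsClassicalSolution a b c u) (hv : IsClassicalSolution a b c v) {φ : E3 → ℝ}
    (hφ : Continuous φ) (hc : HasCompactSupport φ) {t : ℝ} (ht : 0 < t) :
    HasDerivAt (fun s => ∫ x, φ x * ‖u s x - v s x‖ ^ 2)
      (2 * ∫ x, φ x * inner ℝ (u t x - v t x) (Laplacian.laplacian (fun y => u t y - v t y) x) +
        φ x * inner ℝ (u t x - v t x) (reaction a b c (u t x) - reaction a b c (v t x))) t := by
  have hD := hu.1.sub hv.1
  have hg := hD.norm_sq ℝ
  have hopen : IsOpen (Ioi (0 : ℝ) ×ˢ (univ : Set E3)) := isOpen_Ioi.prod isOpen_univ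
  convert hasDerivAt_integral_cutoff hg hφ hc ht using 1
  rw [← integral_const_mul]
  refine integral_congr_ae (ae_of_all _ fun x => ?_)
  have hd := ((hg.contDiffAt (hopen.mem_nhds (show (t, x) ∈ _ from
      ⟨ht, mem_univ _⟩))).differentiableAt (by simp)).hasFDerivAt
  have hline : HasDerivAt (fun s : ℝ => (s, x)) ((1 : ℝ), (0 : E3)) t :=
    (hasDerivAt_id t).prodMk (hasDerivAt_const t x)
  have h1 := hd.comp_hasDerivAt t hline
  have h2 := ((hu.2 t ht x).sub (hv.2 t ht x)).norm_sq
  have h3 := h1.unique h2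
  simp only at h3 ⊢
  rw [h3]
  have hl : Laplacian.laplacian (fun y => u t y - v t y) x =
      Laplacian.laplacian (u t) x - Laplacian.laplacian (v t) x :=
    ((slice_contDiff hu.1 ht).contDiffAt.of_le two_le_infty).laplacian_sub
      ((slice_contDiff hv.1 ht).contDiffAt.of_le two_le_infty)
  rw [hl, ← mul_add, ← inner_add_right]
  have : ∀ p q r s : Sym0, p + q - (r + s) = p - r + (q - s) := fun p q r s => by abel
  simp only [Pi.sub_apply, this]
  ring

set_option maxHeartbeats 800000 in
-- Grönwall for the cut-off energy I = ∫ φ_R |u - v|²: its derivative is at most C R⁻² S + 2K I,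
-- where S bounds ‖u - v‖² in L² on [0, t]. Such an S exists by continuity into H, and no growth or
-- gradient condition on the solutions enters. Then R → ∞.
theorem eqOn_of_isTrajectory {a b c : ℝ} (ha : 0 < a) (hb : 0 < b) (hc : 0 < c) {Q₀ : H}
    {q q' : ℝ → H} (hq : IsTrajectory a b c Q₀ q) (hq' : IsTrajectory a b c Q₀ q') :
    EqOn q q' (Ici 0) := by
  obtain ⟨hq0, hqc, u, hu, hqu⟩ := hq
  obtain ⟨hq'0, hqc', v, hv, hqv⟩ := hq'
  intro t ht
  rcases eq_or_lt_of_le (show 0 ≤ t from ht) with rfl | ht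
  · rw [hq0, hq'0]
  set K := (b * ‖symProd‖) ^ 2 / c
  have hdiff : ∀ s, 0 < s → (fun x => ((q s - q' s).1.1 : E3 → Sym0) x) =ᵐ[volume]
      fun x => u s x - v s x := fun s hs => by
    filter_upwards [profile_sub (q s) (q' s), hqu s hs, hqv s hs] with x h1 h2 h3
    rw [← h2, ← h3]; exact h1
  have hint : ∀ s, 0 < s → Integrable fun x => ‖u s x - v s x‖ ^ 2 := fun s hs =>
    (integrable_norm_sq (q s - q' s).1.1).congr ((hdiff s hs).mono fun x hx => by
      simp only at hx ⊢; rw [hx])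
  have hnorm : ∀ s, 0 < s → ∫ x, ‖u s x - v s x‖ ^ 2 = ‖(q s - q' s).1.1‖ ^ 2 := fun s hs => by
    rw [norm_sq_eq_integral]
    exact integral_congr_ae ((hdiff s hs).mono fun x hx => by simp only at hx ⊢; rw [hx])
  have hcont : ContinuousOn (fun s => ‖(q s - q' s).1.1‖ ^ 2) (Ici 0) := by
    have : Continuous fun p : H => ‖p.1.1‖ ^ 2 := by fun_prop
    exact this.comp_continuousOn (hqc.sub hqc')
  obtain ⟨S, hS⟩ := isCompact_Icc.exists_bound_of_continuousOn
    (hcont.mono (Icc_subset_Ici_self : Icc 0 t ⊆ _))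
  have hS' : ∀ s, 0 < s → s ≤ t → ∫ x, ‖u s x - v s x‖ ^ 2 ≤ S := fun s hs hst => by
    rw [hnorm s hs]
    exact (Real.le_norm_self _).trans (hS s ⟨hs.le, hst⟩)
  have hS0 : 0 ≤ S := (norm_nonneg _).trans (hS t ⟨ht.le, le_rfl⟩)
  obtain ⟨C, hC0, hC⟩ := exists_laplacian_cutoff_le
  have hI0 : ∀ R s, 0 < s → ∫ x, cutoff R x * ‖u s x - v s x‖ ^ 2 ≤ ‖(q s - q' s).1.1‖ ^ 2 := by
    intro R s hs
    rw [← hnorm s hs]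
    refine integral_mono_of_nonneg (ae_of_all _ fun x => ?_) (hint s hs) (ae_of_all _ fun x => ?_)
    · exact mul_nonneg (cutoff_nonneg _ _) (by positivity)
    · exact mul_le_of_le_one_left (by positivity) (cutoff_le_one _ _)
  have hmain : ∀ R, 0 < R → Real.exp (-(2 * K) * t) * ∫ x, cutoff R x * ‖u t x - v t x‖ ^ 2 ≤
      C * (R⁻¹) ^ 2 * S * t := by
    intro R hR
    have hcs := hasCompactSupport_cutoff hR
    have hcd := contDiff_cutoff R
    set I : ℝ → ℝ := fun s => ∫ x, cutoff R x * ‖u s x - v s x‖ ^ 2 with hI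
    have hder : ∀ s, 0 < s → s ≤ t → ∃ I', HasDerivAt I I' s ∧
        I' ≤ C * (R⁻¹) ^ 2 * S + 2 * K * I s := by
      intro s hs hst
      refine ⟨_, hasDerivAt_cutoff_energy hu hv hcd.continuous hcs hs, ?_⟩
      have cu := slice_contDiff hu.1 hs
      have cv := slice_contDiff hv.1 hs
      have cD : ContDiff ℝ ∞ fun y => u s y - v s y := cu.sub cv
      have cDc := cD.continuous
      have cuc := cu.continuous
      have cvc := cv.continuous
      have cL : Continuous (Laplacian.laplacian fun y => u s y - v s y) := by
        have : Continuous fun x => secondTrace (fderiv ℝ (fderiv ℝ fun y => u s y - v s y) x) :=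
          secondTrace.continuous.comp
            ((cD.fderiv_right (m := ∞) (by simp)).fderiv_right (m := ∞) (by simp)).continuous
        convert this using 1
        ext1 x
        exact laplacian_eq_secondTrace _ _
      have cN : Continuous fun x => reaction a b c (u s x) - reaction a b c (v s x) := by
        simp only [reaction_eq]
        fun_prop
      have cφ := hcd.continuous
      have i1 : Integrable fun x => cutoff R x *
          inner ℝ (u s x - v s x) (Laplacian.laplacian (fun y => u s y - v s y) x) :=
        Continuous.integrable_of_hasCompactSupport (by fun_prop) hcs.mul_right
      have i2 : Integrable fun x => cutoff R x *
          inner ℝ (u s x - v s x) (reaction a b c (u s x) - reaction a b c (v s x)) :=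
        Continuous.integrable_of_hasCompactSupport (by fun_prop) hcs.mul_right
      have i3 : Integrable fun x => cutoff R x * ‖u s x - v s x‖ ^ 2 :=
        Continuous.integrable_of_hasCompactSupport (by fun_prop) hcs.mul_right
      rw [integral_add i1 i2]
      have e1 := integral_cutoff_inner_laplacian_le cD hcd hcs (cutoff_nonneg R)
      have e2 : ∫ x, cutoff R x * inner ℝ (u s x - v s x)
          (reaction a b c (u s x) - reaction a b c (v s x)) ≤ K * I s := by
        rw [hI, ← integral_const_mul]
        refine integral_mono i2 (i3.const_mul _) fun x => ?_
        have := inner_reaction_sub_le a b c ha hb hc (u s x) (v s x)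
        rw [real_inner_comm] at this
        calc _ ≤ cutoff R x * (K * ‖u s x - v s x‖ ^ 2) :=
              mul_le_mul_of_nonneg_left this (cutoff_nonneg _ _)
          _ = _ := by ring
      have e3 : ∫ x, Laplacian.laplacian (cutoff R) x * ‖u s x - v s x‖ ^ 2 ≤
          C * (R⁻¹) ^ 2 * S := by
        calc _ ≤ ∫ x, C * (R⁻¹) ^ 2 * ‖u s x - v s x‖ ^ 2 := by
              refine (Real.le_norm_self _).trans (norm_integral_le_of_norm_le
                ((hint s hs).const_mul _) (ae_of_all _ fun x => ?_))
              rw [norm_mul, Real.norm_eq_abs, Real.norm_of_nonneg (by positivity : 0 ≤ ‖_‖ ^ 2)]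
              exact mul_le_mul_of_nonneg_right (hC R x) (by positivity)
          _ = C * (R⁻¹) ^ 2 * ∫ x, ‖u s x - v s x‖ ^ 2 := integral_const_mul _ _
          _ ≤ _ := by gcongr; exact hS' s hs hst
      linarith
    -- Integrating factor and subtracted cutoff error make J nonincreasing on (0, t].
    set J : ℝ → ℝ := fun s => Real.exp (-(2 * K) * s) * I s - C * (R⁻¹) ^ 2 * S * s with hJ
    have hK0 : 0 ≤ K := by positivity
    have hJd : ∀ s, 0 < s → s ≤ t → ∃ J', HasDerivAt J J' s ∧ J' ≤ 0 := by
      intro s hs hst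
      obtain ⟨I', h1, h2⟩ := hder s hs hst
      have hE : HasDerivAt (fun s => Real.exp (-(2 * K) * s))
          (Real.exp (-(2 * K) * s) * (-(2 * K) * 1)) s :=
        ((hasDerivAt_id s).const_mul _).exp
      refine ⟨_, (hE.mul h1).sub ((hasDerivAt_id s).const_mul _), ?_⟩
      have h3 : Real.exp (-(2 * K) * s) ≤ 1 := Real.exp_le_one_iff.2 (by nlinarith)
      have h4 : 0 ≤ C * (R⁻¹) ^ 2 * S := by positivity
      have h5 := (Real.exp_pos (-(2 * K) * s)).le
      nlinarith [mul_le_mul_of_nonneg_left h2 h5, mul_le_mul_of_nonneg_right h3 h4]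
    have hanti : ∀ s, 0 < s → s ≤ t → J t ≤ J s := by
      intro s hs hst
      refine antitoneOn_of_deriv_nonpos (convex_Icc s t) (fun r hr => ?_) (fun r hr => ?_)
        (fun r hr => ?_) ⟨le_rfl, hst⟩ ⟨hst, le_rfl⟩ hst
      · obtain ⟨J', h1, -⟩ := hJd r (hs.trans_le hr.1) hr.2
        exact h1.continuousAt.continuousWithinAt
      · rw [interior_Icc] at hr
        obtain ⟨J', h1, -⟩ := hJd r (hs.trans hr.1) hr.2.le
        exact h1.differentiableAt.differentiableWithinAt
      · rw [interior_Icc] at hr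
        obtain ⟨J', h1, h2⟩ := hJd r (hs.trans hr.1) hr.2.le
        rwa [h1.deriv]
    -- The equation holds only for positive times; the common initial datum enters through
    -- continuity into H at 0.
    have hlim : Tendsto (fun s => ‖(q s - q' s).1.1‖ ^ 2) (𝓝[>] 0) (𝓝 0) := by
      have := (hcont 0 self_mem_Ici).mono_left (nhdsWithin_mono 0 Ioi_subset_Ici_self)
      have e : (fun s => ‖(q s - q' s).1.1‖ ^ 2) 0 = 0 := by
        simp only [hq0, hq'0, sub_self, ZeroMemClass.coe_zero, Prod.fst_zero, norm_zero]
        norm_num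
      rwa [e] at this
    have : J t ≤ 0 := by
      refine ge_of_tendsto hlim ?_
      filter_upwards [Ioc_mem_nhdsGT ht] with s hs
      refine (hanti s hs.1 hs.2).trans ?_
      have h1 := hI0 R s hs.1
      have h2 : 0 ≤ I s := integral_nonneg fun x =>
        mul_nonneg (cutoff_nonneg _ _) (by positivity)
      have h3 : Real.exp (-(2 * K) * s) ≤ 1 := Real.exp_le_one_iff.2 (by nlinarith [hs.1])
      have h4 : 0 ≤ C * (R⁻¹) ^ 2 * S * s := mul_nonneg (by positivity) hs.1.le
      have h5 := mul_le_mul_of_nonneg_right h3 h2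
      change Real.exp (-(2 * K) * s) * I s - C * (R⁻¹) ^ 2 * S * s ≤ _
      linarith
    have hJt : Real.exp (-(2 * K) * t) * I t - C * (R⁻¹) ^ 2 * S * t ≤ 0 := this
    linarith
  have hzero : ∫ x, ‖u t x - v t x‖ ^ 2 ≤ 0 := by
    have l1 : Tendsto (fun R => ∫ x, cutoff R x * ‖u t x - v t x‖ ^ 2) atTop
        (𝓝 (∫ x, ‖u t x - v t x‖ ^ 2)) := by
      refine tendsto_integral_filter_of_dominated_convergence _ (Eventually.of_forall fun R => ?_)
        (Eventually.of_forall fun R => ae_of_all _ fun x => ?_) (hint t ht)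
        (ae_of_all _ fun x => ?_)
      · exact (contDiff_cutoff R).continuous.aestronglyMeasurable.mul (hint t ht).1
      · rw [Real.norm_of_nonneg (mul_nonneg (cutoff_nonneg _ _) (by positivity))]
        exact mul_le_of_le_one_left (by positivity) (cutoff_le_one _ _)
      · simpa using (tendsto_cutoff x).mul_const (‖u t x - v t x‖ ^ 2)
    have l2 : Tendsto (fun R : ℝ => C * (R⁻¹) ^ 2 * S * t) atTop (𝓝 0) := by
      have := ((((tendsto_inv_atTop_zero (𝕜 := ℝ)).pow 2).const_mul C).mul_const S).mul_const t
      simpa using this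
    have := le_of_tendsto_of_tendsto (l1.const_mul (Real.exp (-(2 * K) * t))) l2
      ((eventually_gt_atTop 0).mono hmain)
    by_contra! hpos
    nlinarith [mul_pos (Real.exp_pos (-(2 * K) * t)) hpos]
  rw [hnorm t ht] at hzero
  have h0 : (q t - q' t).1.1 = 0 := by
    rw [← norm_eq_zero]
    exact pow_eq_zero_iff two_ne_zero |>.1 (le_antisymm hzero (by positivity))
  refine phase_ext ?_
  have : (q t).1.1 = (q' t).1.1 := sub_eq_zero.1 h0
  rw [profile, this]; rfl

end QTensor
end

/-! ### Polynomial weights and decay of heat flows with zero mean -/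

noncomputable section

set_option linter.unusedSectionVars false
set_option maxSynthPendingDepth 3

namespace QTensor

/-- The weight `(1 + |x|)^(-p)`. -/
def weight (p : ℝ) (x : E3) : ℝ := (1 + ‖x‖) ^ (-p)

theorem weight_pos (p : ℝ) (x : E3) : 0 < weight p x := by unfold weight; positivity

theorem continuous_weight (p : ℝ) : Continuous (weight p) :=
  (by fun_prop : Continuous fun y : E3 => 1 + ‖y‖).rpow_const fun y => Or.inl (by positivity)

theorem isWeight_weight {p : ℝ} (hp : 0 ≤ p) : IsWeight (weight p) :=
  ⟨(continuous_weight p).stronglyMeasurable, fun x => (weight_pos p x).le, fun x =>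
    Real.rpow_le_one_of_one_le_of_nonpos (by linarith [norm_nonneg x]) (by linarith)⟩

theorem integrable_weight {p : ℝ} (hp : 3 < p) : Integrable (weight p) :=
  integrable_one_add_norm (by simpa using hp)

theorem weight_mono {p q : ℝ} (h : p ≤ q) (x : E3) : weight q x ≤ weight p x :=
  Real.rpow_le_rpow_of_exponent_le (by linarith [norm_nonneg x]) (by linarith)

theorem weight_mul_rpow (p q : ℝ) (x : E3) : weight p x * (1 + ‖x‖) ^ q = weight (p - q) x := by
  rw [weight, weight, ← Real.rpow_add (by positivity)]; congr 1; ring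

/-- Peetre's inequality. -/
theorem weight_le_mul {p : ℝ} (hp : 0 ≤ p) (x y : E3) {r : ℝ} (h : ‖x - y‖ ≤ r) :
    weight p y ≤ (1 + r) ^ p * weight p x := by
  have hr : 0 ≤ r := (norm_nonneg _).trans h
  have h1 : 1 + ‖x‖ ≤ (1 + r) * (1 + ‖y‖) := by
    have : ‖x‖ ≤ ‖x - y‖ + ‖y‖ := by simpa using norm_add_le (x - y) y
    nlinarith [norm_nonneg y]
  have h2 := Real.rpow_le_rpow (by positivity) h1 hp
  rw [Real.mul_rpow (by positivity) (by positivity)] at h2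
  rw [weight, weight, Real.rpow_neg (by positivity), Real.rpow_neg (by positivity),
    ← div_eq_mul_inv, le_div_iff₀ (by positivity), inv_mul_le_iff₀ (by positivity)]
  linarith

/-- Moments of the Gaussian measure. -/
def gaussMoment (p : ℝ) : ℝ := ∫ y, (1 + ‖y‖) ^ p ∂gauss

theorem gaussMoment_nonneg (p : ℝ) : 0 ≤ gaussMoment p := integral_nonneg fun _ => by positivity

theorem heat_weight_le {p : ℝ} (hp : 0 ≤ p) (t : ℝ) (x : E3) :
    heat t (weight p) x ≤ gaussMoment p * (1 + √t) ^ p * weight p x := by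
  have h : ∀ y : E3, weight p (x - √t • y) ≤ (1 + ‖y‖) ^ p * ((1 + √t) ^ p * weight p x) := by
    intro y
    refine (weight_le_mul hp x _ (r := √t * ‖y‖) ?_).trans ?_
    · rw [sub_sub_cancel, norm_smul, Real.norm_of_nonneg (Real.sqrt_nonneg t)]
    · rw [← mul_assoc, ← Real.mul_rpow (by positivity) (by positivity)]
      have := weight_pos p x
      have h0 := Real.sqrt_nonneg t
      gcongr
      nlinarith [norm_nonneg y]
  calc _ ≤ ∫ y : E3, (1 + ‖y‖) ^ p * ((1 + √t) ^ p * weight p x) ∂gauss :=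
        integral_mono ((isWeight_weight hp).isBddMeas.integrable t x)
          ((integrable_gauss_pow p).mul_const _) h
    _ = _ := by rw [integral_mul_const, gaussMoment, mul_assoc]

theorem exists_heatKernel_one_le (p : ℝ) :
    ∃ C, 0 ≤ C ∧ ∀ x, heatKernel 1 x ≤ C * weight p x := by
  obtain ⟨C, hC⟩ := exists_exp_neg_sq_mul_rpow_le p
  have hC0 : 0 ≤ C := le_trans (by positivity) (hC 0 le_rfl)
  refine ⟨((4 * Real.pi * 1) ^ (3 / 2 : ℝ))⁻¹ * C, by positivity, fun x => ?_⟩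
  have h1 : Real.exp (-(1 / (4 * 1)) * ‖x‖ ^ 2) ≤ Real.exp (-(1 / 8) * ‖x‖ ^ 2) :=
    Real.exp_le_exp.2 (by nlinarith [sq_nonneg ‖x‖])
  have h2 := hC ‖x‖ (norm_nonneg x)
  rw [heatKernel_eq, mul_assoc _ C, mul_comm]
  gcongr
  refine h1.trans ?_
  rw [weight, Real.rpow_neg (by positivity), ← div_eq_mul_inv, le_div_iff₀ (by positivity)]
  exact h2

/-- Mean value inequality on the segment from z to z - h. The kernel is bounded with one extra power
of the weight to absorb the factor |y| in its gradient, and Peetre's inequality moves the weight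
back to z. -/
theorem exists_heatKernel_one_sub_le {p : ℝ} (hp : 0 ≤ p) : ∃ C, 0 ≤ C ∧ ∀ z h : E3,
    |heatKernel 1 (z - h) - heatKernel 1 z| ≤ C * (‖h‖ * (1 + ‖h‖) ^ p) * weight p z := by
  obtain ⟨C, hC0, hC⟩ := exists_heatKernel_one_le (p + 1)
  refine ⟨C, hC0, fun z h => ?_⟩
  have hd : ∀ y : E3, ‖(-(1 / (2 * 1)) * heatKernel 1 y) • innerSL ℝ y‖ ≤ C * weight p y := by
    intro y
    rw [norm_smul, innerSL_apply_norm, norm_mul, Real.norm_of_nonneg (heatKernel_pos one_pos y).le]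
    have h1 : weight (p + 1) y * (1 + ‖y‖) = weight p y := by
      simpa using weight_mul_rpow (p + 1) 1 y
    have h2 := hC y
    have h3 := heatKernel_pos one_pos y
    have h4 : ‖-(1 / (2 * 1) : ℝ)‖ = 1 / 2 := by norm_num
    rw [h4, ← h1]
    nlinarith [norm_nonneg y, mul_le_mul_of_nonneg_right h2 (norm_nonneg y)]
  have := (convex_segment z (z - h)).norm_image_sub_le_of_norm_hasFDerivWithin_le
    (f := heatKernel 1) (C := C * ((1 + ‖h‖) ^ p * weight p z))
    (fun y _ => (hasFDerivAt_heatKernel one_ne_zero y).hasFDerivWithinAt)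
    (fun y hy => (hd y).trans ?_) (left_mem_segment ℝ z (z - h)) (right_mem_segment ℝ z (z - h))
  · rw [Real.norm_eq_abs] at this
    refine this.trans_eq ?_
    rw [sub_sub_cancel_left, norm_neg]
    ring
  · refine mul_le_mul_of_nonneg_left (weight_le_mul hp z y ?_) hC0
    have := norm_sub_le_of_mem_segment hy
    rwa [sub_sub_cancel_left, norm_neg, norm_sub_rev] at this

/-- The decay rate `(t + 1)^(-2) (1 + |x| / √(t + 1))^(-p)`. -/
def decay (p t : ℝ) (x : E3) : ℝ := ((t + 1) ^ 2)⁻¹ * (1 + ‖x‖ / √(t + 1)) ^ (-p)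

theorem decay_nonneg (p t : ℝ) (x : E3) : 0 ≤ decay p t x := by
  unfold decay; positivity

theorem mul_decay (p : ℝ) {t : ℝ} (ht : 0 ≤ t) (x : E3) :
    (1 + ‖x‖ / √(t + 1)) ^ p * (t + 1) ^ 2 * decay p t x = 1 := by
  rw [decay, Real.rpow_neg (by positivity)]
  field_simp

theorem rpow_neg_one_add_div_le {p r s t : ℝ} (hp : 0 ≤ p) (hr : 0 ≤ r) (hs : 0 < s) (hst : s ≤ t) :
    (1 + r / s) ^ (-p) ≤ (1 + r / t) ^ (-p) := by
  have : 0 < t := hs.trans_le hst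
  exact Real.rpow_le_rpow_of_nonpos (by positivity) (by gcongr) (by linarith)

theorem decay_le_add {p t s : ℝ} (hp : 0 ≤ p) (ht : 0 ≤ t) (hs : 0 ≤ s) (x : E3) :
    decay p t x ≤ (1 + s) ^ 2 * decay p (t + s) x := by
  unfold decay
  have h1 := rpow_neg_one_add_div_le hp (norm_nonneg x) (Real.sqrt_pos.2 (by linarith : 0 < t + 1))
    (Real.sqrt_le_sqrt (by linarith : t + 1 ≤ t + s + 1))
  have h2 : ((t + 1) ^ 2)⁻¹ ≤ (1 + s) ^ 2 * ((t + s + 1) ^ 2)⁻¹ := by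
    rw [← div_eq_mul_inv, le_div_iff₀ (by positivity), inv_mul_le_iff₀ (by positivity), ← mul_pow]
    gcongr
    nlinarith
  calc _ ≤ ((1 + s) ^ 2 * ((t + s + 1) ^ 2)⁻¹) * (1 + ‖x‖ / √(t + s + 1)) ^ (-p) := by gcongr
    _ = _ := by ring

theorem weight_le_decay {p t : ℝ} (hp : 0 ≤ p) (ht : 0 ≤ t) (ht1 : t ≤ 1) (x : E3) :
    weight p x ≤ 4 * decay p t x := by
  unfold decay weight
  have h1 := rpow_neg_one_add_div_le hp (norm_nonneg x) one_pos
    (Real.one_le_sqrt.2 (by linarith : 1 ≤ t + 1))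
  rw [div_one] at h1
  have h2 : 1 ≤ 4 * ((t + 1) ^ 2)⁻¹ := by
    rw [← div_eq_mul_inv, le_div_iff₀ (by positivity)]; nlinarith
  calc _ ≤ 1 * (1 + ‖x‖ / √(t + 1)) ^ (-p) := by rw [one_mul]; exact h1
    _ ≤ (4 * ((t + 1) ^ 2)⁻¹) * (1 + ‖x‖ / √(t + 1)) ^ (-p) := by gcongr
    _ = _ := by ring

theorem heatKernel_eq_smul {t : ℝ} (ht : 0 < t) (x : E3) :
    heatKernel t x = t ^ (-(3 / 2) : ℝ) * heatKernel 1 ((√t)⁻¹ • x) := by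
  rw [← heatKernel_smul ht, smul_inv_smul₀ (Real.sqrt_pos.2 ht).ne']

theorem weight_smul_le_decay {p t : ℝ} (hp : 0 ≤ p) (ht : 1 ≤ t) (x : E3) :
    (t ^ 2)⁻¹ * weight p ((√t)⁻¹ • x) ≤ 4 * decay p t x := by
  unfold weight decay
  have h1 := rpow_neg_one_add_div_le hp (norm_nonneg x) (Real.sqrt_pos.2 (by linarith : 0 < t))
    (Real.sqrt_le_sqrt (by linarith : t ≤ t + 1))
  have h2 : (t ^ 2)⁻¹ ≤ 4 * ((t + 1) ^ 2)⁻¹ := by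
    rw [← div_eq_mul_inv, le_div_iff₀ (by positivity), inv_mul_le_iff₀ (by positivity)]; nlinarith
  rw [norm_smul, norm_inv, Real.norm_of_nonneg (Real.sqrt_nonneg t), inv_mul_eq_div (√t),
    ← mul_assoc]
  exact mul_le_mul h2 h1 (by positivity) (by positivity)

theorem sqrt_pow_eq {t : ℝ} (ht : 0 < t) : t ^ (-(3 / 2) : ℝ) * (√t)⁻¹ = (t ^ 2)⁻¹ := by
  rw [Real.sqrt_eq_rpow, ← Real.rpow_neg ht.le, ← Real.rpow_add ht, ← Real.rpow_natCast,
    ← Real.rpow_neg ht.le]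
  norm_num

variable {E : Type} [NormedAddCommGroup E] [NormedSpace ℝ E] [CompleteSpace E]

/-- Decay of the heat flow of a function with vanishing integral. -/
theorem exists_norm_heat_le_decay {p N : ℝ} (hp : 0 ≤ p) (hN : p + 4 < N) :
    ∃ C, 0 ≤ C ∧ ∀ (k : ℝ) (g : E3 → E), StronglyMeasurable g →
      (∀ x, ‖g x‖ ≤ k * weight N x) → ∫ x, g x = 0 → ∀ t, 0 ≤ t → ∀ x,
      ‖heat t g x‖ ≤ C * k * decay p t x := by
  obtain ⟨C, hC0, hC⟩ := exists_heatKernel_one_sub_le hp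
  have hN0 : 0 ≤ N := by linarith
  set I := ∫ y, weight (N - (p + 1)) y with hI
  have hI0 : 0 ≤ I := integral_nonneg fun y => (weight_pos _ y).le
  have hG := gaussMoment_nonneg N
  refine ⟨gaussMoment N * 2 ^ N * 4 + 4 * (C * I), by positivity, fun k g hg hgk hg0 t ht x => ?_⟩
  have hk : 0 ≤ k := by
    have := (norm_nonneg _).trans (hgk 0)
    by_contra! hk
    nlinarith [weight_pos N 0]
  have hd := decay_nonneg p t x
  rcases le_total t 1 with ht1 | ht1
  · have h1 : ‖heat t g x‖ ≤ k * heat t (weight N) x := by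
      rw [← heat_const_mul]
      refine norm_heat_le_heat ⟨(continuous_weight N).stronglyMeasurable.const_mul k, k,
        fun y => ?_⟩ hgk t x
      rw [norm_mul, Real.norm_of_nonneg hk, Real.norm_of_nonneg (weight_pos N y).le]
      exact mul_le_of_le_one_right hk ((isWeight_weight hN0).le_one y)
    have h2 := heat_weight_le hN0 t x
    have h3 : (1 + √t) ^ N ≤ 2 ^ N := by
      have := Real.sqrt_le_one.2 ht1
      gcongr
      linarith
    have h4 : weight N x ≤ 4 * decay p t x :=
      (weight_mono (by linarith) x).trans (weight_le_decay hp ht ht1 x)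
    calc _ ≤ k * (gaussMoment N * 2 ^ N * (4 * decay p t x)) := by
          refine h1.trans (mul_le_mul_of_nonneg_left (h2.trans ?_) hk)
          have := weight_pos N x
          gcongr
      _ ≤ _ := by nlinarith [mul_nonneg (mul_nonneg (mul_nonneg hC0 hI0) hk) hd]
  · have ht0 : 0 < t := by linarith
    have hgi : Integrable g := ((integrable_weight (by linarith : 3 < N)).const_mul k).mono'
      hg.aestronglyMeasurable (ae_of_all _ hgk)
    have hKg : Integrable fun y => heatKernel t (x - y) • g y := by
      obtain ⟨C', hC'0, hC'⟩ := exists_heatKernel_one_le 0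
      have hc : Continuous fun y => heatKernel t (x - y) :=
        (continuous_heatKernel t).comp (continuous_const.sub continuous_id)
      refine hgi.bdd_smul (t ^ (-(3 / 2) : ℝ) * C') hc.aestronglyMeasurable
        (ae_of_all _ fun y => ?_)
      rw [Real.norm_of_nonneg (heatKernel_pos ht0 _).le, heatKernel_eq_smul ht0]
      gcongr
      simpa [weight] using hC' ((√t)⁻¹ • (x - y))
    -- The zero integral allows subtracting the kernel at x. The difference gains |y|/√t, so the
    -- rate improves from t^(-3/2) to t^(-2); for t ≤ 1 no gain is needed.
    have e : heat t g x = ∫ y, (heatKernel t (x - y) - heatKernel t x) • g y := by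
      simp only [sub_smul]
      have hKx : Integrable fun y => heatKernel t x • g y := hgi.smul _
      rw [integral_sub hKg hKx, integral_smul, hg0, smul_zero, sub_zero,
        heat_eq_integral' ht0]
    have hpt : ∀ y, ‖(heatKernel t (x - y) - heatKernel t x) • g y‖ ≤
        4 * (C * k * decay p t x) * weight (N - (p + 1)) y := by
      intro y
      have hs1 : (√t)⁻¹ ≤ 1 := inv_le_one_of_one_le₀ (Real.one_le_sqrt.2 ht1)
      have hs0 : 0 < (√t)⁻¹ := inv_pos.2 (Real.sqrt_pos.2 ht0)
      have h1 := hC ((√t)⁻¹ • x) ((√t)⁻¹ • y)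
      rw [← smul_sub] at h1
      have hny : ‖(√t)⁻¹ • y‖ = (√t)⁻¹ * ‖y‖ := by rw [norm_smul, Real.norm_of_nonneg hs0.le]
      have h2 : ‖(√t)⁻¹ • y‖ * (1 + ‖(√t)⁻¹ • y‖) ^ p ≤ (√t)⁻¹ * (1 + ‖y‖) ^ (p + 1) := by
        rw [hny, Real.rpow_add (by positivity), Real.rpow_one]
        have a1 : (1 + (√t)⁻¹ * ‖y‖) ^ p ≤ (1 + ‖y‖) ^ p := by
          gcongr; exact mul_le_of_le_one_left (norm_nonneg y) hs1
        calc _ ≤ (√t)⁻¹ * ‖y‖ * (1 + ‖y‖) ^ p := by gcongr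
          _ ≤ (√t)⁻¹ * (1 + ‖y‖) * (1 + ‖y‖) ^ p := by gcongr; linarith
          _ = _ := by ring
      have hw := weight_pos p ((√t)⁻¹ • x)
      have hwN := weight_pos N y
      rw [norm_smul, Real.norm_eq_abs, heatKernel_eq_smul ht0 (x - y), heatKernel_eq_smul ht0 x,
        ← mul_sub, abs_mul, abs_of_pos (by positivity : 0 < t ^ (-(3 / 2) : ℝ))]
      calc _ ≤ t ^ (-(3 / 2) : ℝ) * (C * ((√t)⁻¹ * (1 + ‖y‖) ^ (p + 1)) *
            weight p ((√t)⁻¹ • x)) * (k * weight N y) := by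
            gcongr
            · exact h1.trans (by gcongr)
            · exact hgk y
        _ = C * k * ((t ^ (-(3 / 2) : ℝ) * (√t)⁻¹) * weight p ((√t)⁻¹ • x)) *
            (weight N y * (1 + ‖y‖) ^ (p + 1)) := by ring
        _ ≤ C * k * (4 * decay p t x) * weight (N - (p + 1)) y := by
            rw [weight_mul_rpow, sqrt_pow_eq ht0]
            have := weight_pos (N - (p + 1)) y
            have h5 := weight_smul_le_decay hp ht1 x
            gcongr
        _ = _ := by ring
    rw [e]
    -- The gain and Peetre's inequality cost p + 1 powers of the weight in y; what is left is
    -- integrable on ℝ³ because N - (p + 1) > 3.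
    refine (norm_integral_le_of_norm_le
      ((integrable_weight (by linarith : 3 < N - (p + 1))).const_mul _) (ae_of_all _ hpt)).trans ?_
    rw [integral_const_mul, ← hI]
    nlinarith [mul_nonneg (mul_nonneg hG (by positivity : (0 : ℝ) ≤ 2 ^ N)) (mul_nonneg hk hd)]

end QTensor
end

/-! ### Large-time asymptotics and the limiting mass -/

noncomputable section

set_option linter.unusedSectionVars false
set_option maxSynthPendingDepth 3

namespace QTensor

theorem exists_exp_neg_mul_rpow_le {a : ℝ} (ha : 0 < a) (q : ℝ) : ∃ C, 0 ≤ C ∧ ∀ s, 0 ≤ s →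
    Real.exp (-a * s) * (1 + s) ^ q ≤ C * Real.exp (-(a / 2) * s) := by
  obtain ⟨n, hn⟩ := exists_nat_ge q
  refine ⟨n.factorial * Real.exp (a / 2) / (a / 2) ^ n, by positivity, fun s hs => ?_⟩
  have h1 : (1 + s) ^ q ≤ (1 + s) ^ n := by
    rw [← Real.rpow_natCast]; exact Real.rpow_le_rpow_of_exponent_le (by linarith) hn
  have h2 := Real.pow_div_factorial_le_exp (a / 2 * (1 + s)) (by positivity) n
  rw [div_le_iff₀ (by positivity), mul_pow] at h2
  have h3 : (1 + s) ^ n ≤ n.factorial * Real.exp (a / 2) / (a / 2) ^ n * Real.exp (a / 2 * s) := by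
    rw [div_mul_eq_mul_div, le_div_iff₀ (by positivity), mul_assoc, ← Real.exp_add]
    calc _ = (a / 2) ^ n * (1 + s) ^ n := mul_comm _ _
      _ ≤ _ := h2.trans_eq (by ring_nf)
  calc _ ≤ Real.exp (-a * s) *
        (n.factorial * Real.exp (a / 2) / (a / 2) ^ n * Real.exp (a / 2 * s)) := by
        gcongr; exact h1.trans h3
    _ = n.factorial * Real.exp (a / 2) / (a / 2) ^ n *
        (Real.exp (-a * s) * Real.exp (a / 2 * s)) := by ring
    _ = _ := by rw [← Real.exp_add]; ring_nf

theorem one_add_sqrt_rpow_le {N s : ℝ} (hN : 0 ≤ N) (hs : 0 ≤ s) :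
    (1 + √s) ^ N ≤ 2 ^ N * (1 + s) ^ N := by
  rw [← Real.mul_rpow (by norm_num) (by positivity)]
  gcongr
  nlinarith [Real.sq_sqrt hs, sq_nonneg (√s - 1)]

theorem exists_heatKernel_le_weight {N : ℝ} (hN : 0 ≤ N) : ∃ C, 0 ≤ C ∧ ∀ s, 0 ≤ s → ∀ x,
    heatKernel (s + 1) x ≤ C * (1 + s) ^ N * weight N x := by
  obtain ⟨C, hC0, hC⟩ := exists_heatKernel_one_le N
  have hG := gaussMoment_nonneg N
  refine ⟨C * (1 + gaussMoment N * 2 ^ N), by positivity, fun s hs x => ?_⟩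
  have hw := weight_pos N x
  have h1 : 1 ≤ (1 + s) ^ N := Real.one_le_rpow (by linarith) hN
  rcases eq_or_lt_of_le hs with rfl | hs
  · rw [zero_add, add_zero, Real.one_rpow, mul_one]
    refine (hC x).trans ?_
    gcongr
    exact le_mul_of_one_le_right hC0 (by linarith [mul_nonneg hG (by positivity : (0 : ℝ) ≤ 2 ^ N)])
  · have hb : IsBddMeas fun x => C * weight N x :=
      ⟨(continuous_weight N).stronglyMeasurable.const_mul C, C, fun y => by
        rw [norm_mul, Real.norm_of_nonneg hC0, Real.norm_of_nonneg (weight_pos N y).le]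
        exact mul_le_of_le_one_right hC0 ((isWeight_weight hN).le_one y)⟩
    have hb' : IsBddMeas (heatKernel 1) := ⟨(continuous_heatKernel 1).stronglyMeasurable, C,
      fun y => by
        rw [Real.norm_of_nonneg (heatKernel_pos one_pos y).le]
        exact (hC y).trans (mul_le_of_le_one_right hC0 ((isWeight_weight hN).le_one y))⟩
    rw [← heat_heatKernel hs one_pos]
    refine (heat_mono hb' hb hC s x).trans ?_
    rw [heat_const_mul]
    have h2 := heat_weight_le hN s x
    have h3 := one_add_sqrt_rpow_le hN hs.le
    calc _ ≤ C * (gaussMoment N * (2 ^ N * (1 + s) ^ N) * weight N x) := by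
          refine mul_le_mul_of_nonneg_left (h2.trans ?_) hC0
          gcongr
      _ = C * (0 + gaussMoment N * 2 ^ N) * (1 + s) ^ N * weight N x := by ring
      _ ≤ _ := by gcongr; norm_num

theorem exists_heatKernel_le_decay (p : ℝ) : ∃ C, 0 ≤ C ∧ ∀ t, 0 ≤ t → ∀ x,
    heatKernel (t + 1) x ≤ C * (1 + t) ^ (1 / 2 : ℝ) * decay p t x := by
  obtain ⟨C, hC0, hC⟩ := exists_heatKernel_one_le p
  refine ⟨C, hC0, fun t ht x => ?_⟩
  have ht1 : 0 < t + 1 := by linarith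
  have hs := Real.sqrt_pos.2 ht1
  rw [heatKernel_eq_smul ht1, decay, add_comm 1 t]
  have h1 := hC ((√(t + 1))⁻¹ • x)
  rw [weight, norm_smul, norm_inv, Real.norm_of_nonneg hs.le, inv_mul_eq_div (√(t + 1))] at h1
  have h2 : (t + 1) ^ (-(3 / 2) : ℝ) = (t + 1) ^ (1 / 2 : ℝ) * ((t + 1) ^ 2)⁻¹ := by
    rw [← Real.rpow_natCast, ← Real.rpow_neg ht1.le, ← Real.rpow_add ht1]
    norm_num
  rw [h2]
  calc _ ≤ (t + 1) ^ (1 / 2 : ℝ) * ((t + 1) ^ 2)⁻¹ * (C * (1 + ‖x‖ / √(t + 1)) ^ (-p)) := by gcongr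
    _ = _ := by ring

variable {E : Type} [NormedAddCommGroup E] [NormedSpace ℝ E] [CompleteSpace E]

theorem isBddMeas_of_le_weight {N k : ℝ} (hN : 0 ≤ N) {g : E3 → E} (hg : StronglyMeasurable g)
    (h : ∀ x, ‖g x‖ ≤ k * weight N x) : IsBddMeas g := by
  have hk : 0 ≤ k := by
    have := (norm_nonneg _).trans (h 0)
    by_contra! hk
    nlinarith [weight_pos N 0]
  exact ⟨hg, k, fun x => (h x).trans
    (mul_le_of_le_one_right hk ((isWeight_weight hN).le_one x))⟩

theorem integrable_of_le_weight {N k : ℝ} (hN : 3 < N) {g : E3 → E} (hg : StronglyMeasurable g)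
    (h : ∀ x, ‖g x‖ ≤ k * weight N x) : Integrable g :=
  ((integrable_weight hN).const_mul k).mono' hg.aestronglyMeasurable (ae_of_all _ h)

/-- The heat flow of a decaying function is close to a multiple of the heat kernel. -/
theorem exists_norm_heat_sub_le_decay {p N : ℝ} (hp : 0 ≤ p) (hN : p + 4 < N) :
    ∃ C, 0 ≤ C ∧ ∀ (k : ℝ) (g : E3 → E), StronglyMeasurable g →
      (∀ x, ‖g x‖ ≤ k * weight N x) → ∀ s, 0 ≤ s → ∀ t, 0 < t → ∀ x,
      ‖heat t g x - heatKernel (t + s + 1) x • ∫ y, g y‖ ≤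
        C * k * (1 + s) ^ (N + 2) * decay p (t + s) x := by
  have hN0 : 0 ≤ N := by linarith
  obtain ⟨C, hC0, hC⟩ := exists_norm_heat_le_decay (E := E) hp hN
  obtain ⟨D, hD0, hD⟩ := exists_heatKernel_le_weight hN0
  set I := ∫ y, weight N y with hI
  have hI0 : 0 ≤ I := integral_nonneg fun y => (weight_pos _ y).le
  refine ⟨C * (1 + D * I), by positivity, fun k g hg hk s hs t ht x => ?_⟩
  have hk0 : 0 ≤ k := by
    have := (norm_nonneg _).trans (hk 0)
    by_contra! hk
    nlinarith [weight_pos N 0]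
  set m := ∫ y, g y with hm
  have hgi := integrable_of_le_weight (by linarith) hg hk
  have hmk : ‖m‖ ≤ k * I := by
    refine (norm_integral_le_of_norm_le ((integrable_weight (by linarith)).const_mul k)
      (ae_of_all _ hk)).trans_eq ?_
    rw [integral_const_mul]
  have hs1 : 0 < s + 1 := by linarith
  have h1 : 1 ≤ (1 + s) ^ N := Real.one_le_rpow (by linarith) hN0
  have hKm : ∀ y, ‖heatKernel (s + 1) y • m‖ ≤ (k * (D * I) * (1 + s) ^ N) * weight N y := by
    intro y
    rw [norm_smul, Real.norm_of_nonneg (heatKernel_pos hs1 y).le]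
    have hw := weight_pos N y
    calc _ ≤ (D * (1 + s) ^ N * weight N y) * (k * I) := by
          gcongr
          exact hD s hs y
      _ = _ := by ring
  have hKs : StronglyMeasurable fun y => heatKernel (s + 1) y • m :=
    ((continuous_heatKernel _).smul continuous_const).stronglyMeasurable
  -- The subtracted kernel has the same mass as g, so the difference has zero integral. Taking it at
  -- time s + 1 makes every source, whatever its time s, comparable after the remaining heat time
  -- with the same final kernel.
  have key := hC (k * (1 + D * I) * (1 + s) ^ N) (fun y => g y - heatKernel (s + 1) y • m)
    (hg.sub hKs) (fun y => ?_) ?_ t ht.le x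
  · rw [heat_sub (isBddMeas_of_le_weight hN0 hg hk) (isBddMeas_of_le_weight hN0 hKs hKm),
      heat_smul_const, heat_heatKernel ht hs1, ← add_assoc] at key
    refine key.trans ?_
    have hd := decay_le_add hp ht.le hs x
    have e : (1 + s) ^ (N + 2) = (1 + s) ^ N * (1 + s) ^ 2 := by
      rw [Real.rpow_add (by linarith)]; norm_cast
    rw [e]
    calc _ ≤ C * (k * (1 + D * I) * (1 + s) ^ N) * ((1 + s) ^ 2 * decay p (t + s) x) := by gcongr
      _ = _ := by ring
  · refine (norm_sub_le_of_le (hk y) (hKm y)).trans ?_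
    have hw := weight_pos N y
    have h5 : k * weight N y ≤ (1 + s) ^ N * (k * weight N y) :=
      le_mul_of_one_le_left (by positivity) h1
    calc _ ≤ (1 + s) ^ N * (k * weight N y) + k * (D * I) * (1 + s) ^ N * weight N y := by
          linarith
      _ = _ := by ring
  · rw [integral_sub hgi ((integrable_heatKernel hs1).smul_const m), integral_smul_const,
      integral_heatKernel hs1, one_smul, sub_self]

/-- The limiting mass of a solution of the integral equation. -/
def massLimit (F : ℝ → E → E) (R : E3 → E) (w : ℝ → E3 → E) : E :=
  (∫ x, R x) + ∫ s in Ioi 0, ∫ x, F s (w s x)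

section

variable {F : ℝ → E → E} {a L η N : ℝ}

/-- The heat flow spreads the weight by a factor of order (1+s)^N, which half of the exponential
rate absorbs. One factor |w| of the quadratic bound is replaced by 1. The constant precedes `w`,
which makes the later asymptotics uniform in the data. -/
theorem exists_norm_source_le (hη : 0 ≤ η) (hη1 : 2 * η ≤ 1) (hN : 0 ≤ N)
    (hF : IsDecayingNonlinearity F a L) : ∃ C, 0 ≤ C ∧ ∀ w, IsDominated (weight N) η w →
      ∀ s, 0 < s → ∀ x, ‖F s (w s x)‖ ≤ C * Real.exp (-(a / 2) * s) * weight N x := by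
  obtain ⟨C, hC0, hC⟩ := exists_exp_neg_mul_rpow_le hF.pos N
  have hG := gaussMoment_nonneg N
  have hL := hF.nonneg
  refine ⟨L * gaussMoment N * 2 ^ N * C, by positivity, fun w hw s hs x => ?_⟩
  have hle := (hw.norm_le hη (isWeight_weight hN) hs x).trans hη1
  have hle' : ‖w s x‖ ≤ heat s (weight N) x := (hw.le s hs x).trans
    (mul_le_of_le_one_left (heat_nonneg (isWeight_weight hN).nonneg s x) hη1)
  have h2 := heat_weight_le hN s x
  have h3 := one_add_sqrt_rpow_le hN hs.le
  have hwt := weight_pos N x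
  calc _ ≤ L * Real.exp (-a * s) * ‖w s x‖ * ‖w s x‖ := hF.norm_le hs.le hle
    _ ≤ L * Real.exp (-a * s) * 1 * (gaussMoment N * (2 ^ N * (1 + s) ^ N) * weight N x) := by
        gcongr
        exact hle'.trans (h2.trans (by gcongr))
    _ = L * gaussMoment N * 2 ^ N * (Real.exp (-a * s) * (1 + s) ^ N) * weight N x := by ring
    _ ≤ L * gaussMoment N * 2 ^ N * (C * Real.exp (-(a / 2) * s)) * weight N x := by
        have h5 := hC s hs.le
        gcongr L * gaussMoment N * 2 ^ N * ?_ * weight N x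
    _ = _ := by ring

theorem continuous_source (hF : IsDecayingNonlinearity F a L) {ρ : E3 → ℝ} {w : ℝ → E3 → E}
    (hw : IsDominated ρ η w) {s : ℝ} (hs : 0 < s) : Continuous fun x => F s (w s x) := by
  have h : ContinuousOn (fun p : ℝ × E3 => F p.1 (w p.1 p.2)) (Ioi 0 ×ˢ univ) :=
    hF.cont.comp_continuousOn (continuousOn_fst.prodMk hw.cont)
  exact h.comp_continuous (f := fun x => (s, x)) (by fun_prop) fun x => ⟨hs, mem_univ _⟩

theorem integrable_source (hη : 0 ≤ η) (hη1 : 2 * η ≤ 1) (hN : 3 < N)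
    (hF : IsDecayingNonlinearity F a L) {w : ℝ → E3 → E} (hw : IsDominated (weight N) η w) {s : ℝ}
    (hs : 0 < s) : Integrable fun x => F s (w s x) := by
  obtain ⟨C, -, hC⟩ := exists_norm_source_le hη hη1 (by linarith : 0 ≤ N) hF
  exact integrable_of_le_weight hN (continuous_source hF hw hs).stronglyMeasurable (hC w hw s hs)

theorem continuousOn_integral_source (hη : 0 ≤ η) (hη1 : 2 * η ≤ 1) (hN : 3 < N)
    (hF : IsDecayingNonlinearity F a L) {w : ℝ → E3 → E} (hw : IsDominated (weight N) η w) :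
    ContinuousOn (fun s => ∫ x, F s (w s x)) (Ioi 0) := by
  obtain ⟨C, hC0, hC⟩ := exists_norm_source_le hη hη1 (by linarith) hF
  have h : ContinuousOn (fun p : ℝ × E3 => F p.1 (w p.1 p.2)) (Ioi 0 ×ˢ univ) :=
    hF.cont.comp_continuousOn (continuousOn_fst.prodMk hw.cont)
  refine continuousOn_of_dominated (bound := fun x => C * weight N x)
    (fun s hs => (continuous_source hF hw hs).aestronglyMeasurable)
    (fun s hs => ae_of_all _ fun x => (hC w hw s hs x).trans ?_)
    ((integrable_weight hN).const_mul C) (ae_of_all _ fun x => ?_)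
  · have h2 : Real.exp (-(a / 2) * s) ≤ 1 :=
      Real.exp_le_one_iff.2 (by nlinarith [hF.pos, show (0 : ℝ) < s from hs])
    have := weight_pos N x
    gcongr
    exact mul_le_of_le_one_right hC0 h2
  · exact h.comp (f := fun s => (s, x)) (by fun_prop) fun s hs => ⟨hs, mem_univ _⟩

theorem norm_integral_source_le (hN : 3 < N) {w : ℝ → E3 → E} {C : ℝ}
    (hC : ∀ s, 0 < s → ∀ x, ‖F s (w s x)‖ ≤ C * Real.exp (-(a / 2) * s) * weight N x) {s : ℝ}
    (hs : 0 < s) : ‖∫ x, F s (w s x)‖ ≤ C * (∫ x, weight N x) * Real.exp (-(a / 2) * s) := by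
  refine (norm_integral_le_of_norm_le ((integrable_weight hN).const_mul _)
    (ae_of_all _ (hC s hs))).trans_eq ?_
  rw [integral_const_mul]
  ring

theorem integrableOn_integral_source (hη : 0 ≤ η) (hη1 : 2 * η ≤ 1) (hN : 3 < N)
    (hF : IsDecayingNonlinearity F a L) {w : ℝ → E3 → E} (hw : IsDominated (weight N) η w) :
    IntegrableOn (fun s => ∫ x, F s (w s x)) (Ioi 0) := by
  obtain ⟨C, hC0, hC⟩ := exists_norm_source_le hη hη1 (by linarith) hF
  have ha := hF.pos
  refine ((integrableOn_exp_mul_Ioi (a := -(a / 2)) (by linarith) 0).const_mul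
    (C * ∫ x, weight N x)).mono' ((continuousOn_integral_source hη hη1 hN hF hw
      ).aestronglyMeasurable measurableSet_Ioi) ?_
  filter_upwards [ae_restrict_mem measurableSet_Ioi] with s hs
  exact norm_integral_source_le hN (hC w hw) hs

/-- Large-time asymptotics of the solutions of the integral equation, uniform for small data. -/
theorem exists_norm_sub_massLimit_le_decay {p : ℝ} (hp : 0 ≤ p) (hN : p + 4 < N) (hη : 0 ≤ η)
    (hη1 : 2 * η ≤ 1) (hF : IsDecayingNonlinearity F a L) :
    ∃ M, 0 ≤ M ∧ ∀ (R : E3 → E) (w : ℝ → E3 → E), StronglyMeasurable R →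
      (∀ x, ‖R x‖ ≤ η * weight N x) → IsDominated (weight N) η w →
      (∀ t, 0 < t → ∀ x, w t x = picard F R w t x) → ∀ t, 0 < t → ∀ x,
      ‖w t x - heatKernel (t + 1) x • massLimit F R w‖ ≤ M * decay p t x := by
  have ha := hF.pos
  have hN3 : 3 < N := by linarith
  have hN0 : 0 ≤ N := by linarith
  obtain ⟨C₁, hC₁0, hC₁⟩ := exists_norm_heat_sub_le_decay (E := E) hp hN
  obtain ⟨C₂, hC₂0, hC₂⟩ := exists_norm_source_le hη hη1 hN0 hF
  obtain ⟨C₃, hC₃0, hC₃⟩ := exists_exp_neg_mul_rpow_le (half_pos ha) (N + 2)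
  obtain ⟨C₄, hC₄0, hC₄⟩ := exists_heatKernel_le_decay p
  obtain ⟨C₅, hC₅0, hC₅⟩ := exists_exp_neg_mul_rpow_le (half_pos ha) (1 / 2)
  set I := ∫ y, weight N y with hI
  have hI0 : 0 ≤ I := integral_nonneg fun y => (weight_pos _ y).le
  refine ⟨C₁ * η + C₁ * C₂ * C₃ * (4 / a) + C₄ * (C₂ * I * (2 / a)) * C₅, by positivity,
    fun R w hR hRη hw he t ht x => ?_⟩
  have hd := decay_nonneg p t x
  set m : ℝ → E := fun s => ∫ x, F s (w s x) with hm
  have hmi : IntegrableOn m (Ioi 0) := integrableOn_integral_source hη hη1 hN3 hF hw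
  have hsrc := hw.isSource hη hη1 (isWeight_weight hN0) hF (t + 1)
  have hi1 := hsrc.intervalIntegrable_heat ht.le (by linarith : t < t + 1) x
  have hi2 : IntervalIntegrable m volume 0 t :=
    (intervalIntegrable_iff_integrableOn_Ioc_of_le ht.le).2 (hmi.mono_set Ioc_subset_Ioi_self)
  have hi3 : IntervalIntegrable (fun τ => m (t - τ)) volume 0 t := by
    have := (hi2.comp_sub_left t).symm
    simpa using this
  have hi4 : IntervalIntegrable (fun τ => heatKernel (t + 1) x • m (t - τ)) volume 0 t :=
    hi3.smul _
  have hsplit : ∫ s in Ioi 0, m s = (∫ τ in (0 : ℝ)..t, m (t - τ)) + ∫ s in Ioi t, m s := by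
    rw [intervalIntegral.integral_comp_sub_left, sub_self, sub_zero]
    exact (intervalIntegral.integral_interval_add_Ioi hmi
      (hmi.mono_set (Ioi_subset_Ioi ht.le))).symm
  set K := heatKernel (t + 1) x with hK
  have hK0 : 0 < K := heatKernel_pos (by linarith) x
  -- Three errors: that of the linear flow, that of each source before time t, and the mass produced
  -- by the nonlinearity after time t.
  have e : w t x - K • massLimit F R w = (heat t R x - K • ∫ y, R y) +
      (∫ τ in (0 : ℝ)..t, (heat τ (fun y => F (t - τ) (w (t - τ) y)) x - K • m (t - τ))) -
      K • ∫ s in Ioi t, m s := by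
    rw [he t ht x, picard, duhamel, massLimit, hsplit, intervalIntegral.integral_sub hi1
      hi4, intervalIntegral.integral_smul]
    module
  have b1 : ‖heat t R x - K • ∫ y, R y‖ ≤ C₁ * η * decay p t x := by
    simpa using hC₁ η R hR hRη 0 le_rfl t ht x
  have b2 : ‖∫ τ in (0 : ℝ)..t, (heat τ (fun y => F (t - τ) (w (t - τ) y)) x - K • m (t - τ))‖ ≤
      C₁ * C₂ * C₃ * (4 / a) * decay p t x := by
    have hpt : ∀ τ ∈ Ioo 0 t, ‖heat τ (fun y => F (t - τ) (w (t - τ) y)) x - K • m (t - τ)‖ ≤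
        Real.exp (-(a / 4) * (t - τ)) * (C₁ * C₂ * C₃ * decay p t x) := by
      intro τ hτ
      have hs : 0 < t - τ := by linarith [hτ.2]
      have h1 := hC₁ (C₂ * Real.exp (-(a / 2) * (t - τ))) (fun y => F (t - τ) (w (t - τ) y))
        (continuous_source hF hw hs).stronglyMeasurable (hC₂ w hw _ hs) (t - τ) hs.le τ hτ.1 x
      rw [add_sub_cancel] at h1
      refine h1.trans ?_
      have h2 := hC₃ (t - τ) hs.le
      calc _ = C₁ * C₂ * (Real.exp (-(a / 2) * (t - τ)) * (1 + (t - τ)) ^ (N + 2)) *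
            decay p t x := by ring
        _ ≤ C₁ * C₂ * (C₃ * Real.exp (-(a / 2 / 2) * (t - τ))) * decay p t x := by gcongr
        _ = _ := by rw [show a / 2 / 2 = a / 4 by ring]; ring
    have hi : IntervalIntegrable (fun τ => Real.exp (-(a / 4) * (t - τ)) *
        (C₁ * C₂ * C₃ * decay p t x)) volume 0 t := Continuous.intervalIntegrable (by fun_prop) _ _
    calc _ ≤ ∫ τ in (0 : ℝ)..t, Real.exp (-(a / 4) * (t - τ)) * (C₁ * C₂ * C₃ * decay p t x) := by
          simp only [intervalIntegral.integral_of_le ht.le, integral_Ioc_eq_integral_Ioo]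
          refine norm_integral_le_of_norm_le
            ((intervalIntegrable_iff_integrableOn_Ioo_of_le ht.le).1 hi) ?_
          filter_upwards [ae_restrict_mem measurableSet_Ioo] with τ hτ using hpt τ hτ
      _ ≤ 1 / (a / 4) * (C₁ * C₂ * C₃ * decay p t x) := by
          rw [intervalIntegral.integral_mul_const]
          gcongr
          exact integral_exp_neg_mul_sub_le (by linarith)
      _ = _ := by field_simp
  -- The kernel is larger than the target rate only by (1+t)^(1/2), while the mass produced after
  -- time t is exponentially small.
  have b3 : ‖K • ∫ s in Ioi t, m s‖ ≤ C₄ * (C₂ * I * (2 / a)) * C₅ * decay p t x := by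
    have h1 : ‖∫ s in Ioi t, m s‖ ≤ C₂ * I * (2 / a) * Real.exp (-(a / 2) * t) := by
      refine (norm_integral_le_of_norm_le ((integrableOn_exp_mul_Ioi (a := -(a / 2))
        (by linarith) t).const_mul (C₂ * I)) ?_).trans_eq ?_
      · filter_upwards [ae_restrict_mem measurableSet_Ioi] with s hs
        exact norm_integral_source_le hN3 (hC₂ w hw) (ht.trans hs)
      · rw [integral_const_mul, integral_exp_mul_Ioi (by linarith)]
        field_simp
    rw [norm_smul, Real.norm_of_nonneg hK0.le]
    have h2 := hC₄ t ht.le x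
    have h3 := hC₅ t ht.le
    have h4 : Real.exp (-(a / 2 / 2) * t) ≤ 1 := Real.exp_le_one_iff.2 (by nlinarith)
    calc _ ≤ (C₄ * (1 + t) ^ (1 / 2 : ℝ) * decay p t x) *
          (C₂ * I * (2 / a) * Real.exp (-(a / 2) * t)) := by gcongr
      _ = C₄ * (C₂ * I * (2 / a)) * (Real.exp (-(a / 2) * t) * (1 + t) ^ (1 / 2 : ℝ)) *
          decay p t x := by ring
      _ ≤ C₄ * (C₂ * I * (2 / a)) * (C₅ * 1) * decay p t x := by
          have h5 := h3.trans (mul_le_mul_of_nonneg_left h4 hC₅0)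
          gcongr C₄ * (C₂ * I * (2 / a)) * ?_ * decay p t x
      _ = _ := by ring
  rw [e]
  refine (norm_sub_le_of_le (norm_add_le_of_le b1 b2) b3).trans_eq ?_
  ring

/-- The limiting mass is close to the initial mass, in a Lipschitz sense. -/
theorem norm_massLimit_sub_le (hN : 3 < N) (hη : 0 ≤ η) (hη1 : 2 * η ≤ 1) (hκ : 16 * η * L ≤ a)
    (hF : IsDecayingNonlinearity F a L) {R R' : E3 → E} {w w' : ℝ → E3 → E}
    (hR : StronglyMeasurable R) (hR' : StronglyMeasurable R') (hRη : ∀ x, ‖R x‖ ≤ η * weight N x)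
    (hRη' : ∀ x, ‖R' x‖ ≤ η * weight N x) (hw : IsDominated (weight N) η w)
    (hw' : IsDominated (weight N) η w') (he : ∀ t, 0 < t → ∀ x, w t x = picard F R w t x)
    (he' : ∀ t, 0 < t → ∀ x, w' t x = picard F R' w' t x) :
    ‖massLimit F R w - massLimit F R' w' - ∫ x, (R x - R' x)‖ ≤ 1 / 3 * ∫ x, ‖R x - R' x‖ := by
  have hN0 : 0 ≤ N := by linarith
  have ha := hF.pos
  have hL := hF.nonneg
  have hRi := integrable_of_le_weight hN hR hRη
  have hRi' := integrable_of_le_weight hN hR' hRη'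
  set J := ∫ x, ‖R x - R' x‖ with hJ
  have hJ0 : 0 ≤ J := integral_nonneg fun _ => norm_nonneg _
  have hm := integrableOn_integral_source hη hη1 hN hF hw
  have hm' := integrableOn_integral_source hη hη1 hN hF hw'
  have hdi : Integrable fun x => ‖R x - R' x‖ := (hRi.sub hRi').norm
  have hds : StronglyMeasurable fun x => ‖R x - R' x‖ := (hR.sub hR').norm
  -- The pointwise bound 4/3 · e^(sΔ)‖R - R'‖ is integrated in space, where the heat flow preserves
  -- the integral. The constant is 16/3 η = 4η · 4/3, and 16ηL ≤ a turns the time integral into 1/3.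
  have hpt : ∀ s, 0 < s → ‖(∫ x, F s (w s x)) - ∫ x, F s (w' s x)‖ ≤
      L * (16 / 3 * η) * J * Real.exp (-a * s) := by
    intro s hs
    rw [← integral_sub (integrable_source hη hη1 hN hF hw hs)
      (integrable_source hη hη1 hN hF hw' hs)]
    refine (norm_integral_le_of_norm_le ((integrable_heat hdi hds s).const_mul
      (L * (16 / 3 * η) * Real.exp (-a * s))) (ae_of_all _ fun x => ?_)).trans_eq ?_
    · have hle := hw.norm_le hη (isWeight_weight hN0) hs x
      have hle' := hw'.norm_le hη (isWeight_weight hN0) hs x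
      have h1 := norm_sub_le_heat hη hη1 hκ (isWeight_weight hN0) hF
        (isBddMeas_of_le_weight hN0 hR hRη) (isBddMeas_of_le_weight hN0 hR' hRη') hw hw' he he' hs x
      refine (hF.lip s hs.le _ _ (hle.trans hη1) (hle'.trans hη1)).trans ?_
      calc _ ≤ L * Real.exp (-a * s) * (2 * η + 2 * η) *
            (4 / 3 * heat s (fun y => ‖R y - R' y‖) x) := by gcongr
        _ = _ := by ring
    · rw [integral_const_mul, integral_heat hdi hds]
      ring
  have e : massLimit F R w - massLimit F R' w' - ∫ x, (R x - R' x) =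
      ∫ s in Ioi 0, ((∫ x, F s (w s x)) - ∫ x, F s (w' s x)) := by
    rw [integral_sub hm hm', integral_sub hRi hRi', massLimit, massLimit]
    abel
  rw [e]
  refine (norm_integral_le_of_norm_le ((integrableOn_exp_mul_Ioi (a := -a)
        (by linarith) 0).const_mul (L * (16 / 3 * η) * J)) ?_).trans ?_
  · filter_upwards [ae_restrict_mem measurableSet_Ioi] with s hs using hpt s hs
  · rw [integral_const_mul, integral_exp_mul_Ioi (by linarith), mul_zero, Real.exp_zero]
    have h1 : L * (16 / 3 * η) / a ≤ 1 / 3 := by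
      rw [div_le_iff₀ ha]; linarith
    calc _ = L * (16 / 3 * η) / a * J := by field_simp
      _ ≤ _ := by gcongr

end

end QTensor
end

/-! ### Continuity of the heat flow in L² and the phase space -/

noncomputable section

set_option linter.unusedSectionVars false
set_option maxSynthPendingDepth 3

namespace QTensor

section Translate

/-- Translation of an `L²` class. -/
def translate (h : E3) : Lp Sym0 2 (volume : Measure E3) →ₗᵢ[ℝ] Lp Sym0 2 (volume : Measure E3) :=
  Lp.compMeasurePreservingₗᵢ ℝ (fun x => x + h) (measurePreserving_add_right volume h)

theorem coeFn_translate (h : E3) (f : Lp Sym0 2 (volume : Measure E3)) :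
    translate h f =ᵐ[volume] fun x => f (x + h) :=
  Lp.coeFn_compMeasurePreserving f (measurePreserving_add_right volume h)

theorem continuous_translate (f : Lp Sym0 2 (volume : Measure E3)) :
    Continuous fun h => translate h f := by
  let g : C(E3, C(E3, E3)) := (ContinuousMap.mk (fun p : E3 × E3 => p.2 + p.1) (by fun_prop)).curry
  exact (continuous_const (y := f)).compMeasurePreservingLp g.continuous
    (fun h => measurePreserving_add_right volume h) (by norm_num)

theorem translate_zero (f : Lp Sym0 2 (volume : Measure E3)) : translate 0 f = f := by
  refine Lp.ext ((coeFn_translate 0 f).trans ?_)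
  simp

end Translate

theorem sq_integral_le {g : E3 → ℝ} (hg : Integrable g gauss)
    (hg2 : Integrable (fun y => g y ^ 2) gauss) :
    (∫ y, g y ∂gauss) ^ 2 ≤ ∫ y, g y ^ 2 ∂gauss := by
  set m := ∫ y, g y ∂gauss with hm
  have h : 0 ≤ ∫ y, (g y - m) ^ 2 ∂gauss := integral_nonneg fun _ => by positivity
  have e : ∫ y, (g y - m) ^ 2 ∂gauss = (∫ y, g y ^ 2 ∂gauss) - m ^ 2 := by
    have : ∀ y, (g y - m) ^ 2 = g y ^ 2 - (2 * m) * g y + m ^ 2 := fun y => by ring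
    simp only [this]
    have i1 : Integrable (fun y => 2 * m * g y) gauss := hg.const_mul _
    have i2 : Integrable (fun y => g y ^ 2 - 2 * m * g y) gauss := hg2.sub i1
    rw [integral_add i2 (integrable_const _), integral_sub hg2 i1, integral_const_mul, ← hm]
    simp
    ring
  linarith

theorem sq_heat_le {g : E3 → ℝ} (hg : IsBddMeas g) (t : ℝ) (x : E3) :
    heat t g x ^ 2 ≤ heat t (fun y => g y ^ 2) x := by
  obtain ⟨C, hC⟩ := hg.bdd
  have hg2 : IsBddMeas fun y => g y ^ 2 := ⟨hg.sm.pow 2, C ^ 2, fun y => by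
    rw [norm_pow]; gcongr; exact hC y⟩
  exact sq_integral_le (hg.integrable t x) (hg2.integrable t x)

/-- The heat flow contracts the `L²` norm. -/
theorem integral_sq_heat_le {g : E3 → ℝ} (hg : IsBddMeas g) (hi : Integrable fun x => g x ^ 2)
    (t : ℝ) : ∫ x, heat t g x ^ 2 ≤ ∫ x, g x ^ 2 := by
  rw [← integral_heat hi (hg.sm.pow 2) t]
  exact integral_mono_of_nonneg (ae_of_all _ fun x => by positivity)
    (integrable_heat hi (hg.sm.pow 2) t) (ae_of_all _ (sq_heat_le hg t))

theorem integrable_norm_sq_of_le_weight {E : Type} [NormedAddCommGroup E] {N k : ℝ} (hN : 3 < N)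
    {g : E3 → E} (hg : StronglyMeasurable g) (h : ∀ x, ‖g x‖ ≤ k * weight N x) :
    Integrable fun x => ‖g x‖ ^ 2 := by
  refine ((integrable_weight hN).const_mul (k ^ 2)).mono' (hg.norm.pow 2).aestronglyMeasurable
    (ae_of_all _ fun x => ?_)
  have h0 := weight_pos N x
  have h1 := (isWeight_weight (by linarith : 0 ≤ N)).le_one x
  rw [Real.norm_of_nonneg (by positivity)]
  calc _ ≤ (k * weight N x) ^ 2 := by gcongr; exact h x
    _ = k ^ 2 * (weight N x * weight N x) := by ring
    _ ≤ k ^ 2 * (1 * weight N x) := by gcongr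
    _ = _ := by ring

/-- Continuity of the heat flow at time zero, in `L²`. -/
theorem tendsto_integral_norm_sq_heat_sub {N k : ℝ} (hN : 3 < N) {R : E3 → Sym0}
    (hR : StronglyMeasurable R) (hk : ∀ x, ‖R x‖ ≤ k * weight N x) :
    Tendsto (fun t => ∫ x, ‖heat t R x - R x‖ ^ 2) (𝓝[>] 0) (𝓝 0) := by
  have hN0 : 0 ≤ N := by linarith
  have hb := isBddMeas_of_le_weight hN0 hR hk
  have hsq := integrable_norm_sq_of_le_weight hN hR hk
  have hL : MemLp R 2 (volume : Measure E3) :=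
    (memLp_two_iff_integrable_sq_norm hR.aestronglyMeasurable).2 hsq
  set f := hL.toLp R
  have hf : f =ᵐ[volume] R := hL.coeFn_toLp
  -- T is the squared L² modulus of continuity of R. By Cauchy–Schwarz and Fubini the quantity to
  -- estimate is at most the Gaussian average of T(√t y), and T is bounded, continuous and zero at
  -- 0.
  set T : E3 → ℝ := fun h => ‖translate (-h) f - f‖ ^ 2 with hT
  have hTeq : ∀ h, T h = ∫ x, ‖R (x - h) - R x‖ ^ 2 := by
    intro h
    rw [hT]
    simp only
    rw [norm_sq_eq_integral]
    refine integral_congr_ae ?_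
    have h1 : (fun x => f (x + -h)) =ᵐ[volume] fun x => R (x + -h) :=
      (measurePreserving_add_right volume (-h)).quasiMeasurePreserving.ae_eq_comp hf
    filter_upwards [Lp.coeFn_sub (translate (-h) f) f, coeFn_translate (-h) f, h1, hf] with x a1 a2
      a3 a4
    rw [a1, Pi.sub_apply, a2, a4]
    rw [a3, ← sub_eq_add_neg]
  have hTc : Continuous T := by
    have := (continuous_translate f).comp (continuous_neg (G := E3))
    exact ((this.sub continuous_const).norm).pow 2
  have hT0 : T 0 = 0 := by simp [hT, translate_zero]
  have hTb : ∀ h, T h ≤ (2 * ‖f‖) ^ 2 := fun h => by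
    simp only [hT]
    gcongr
    refine (norm_sub_le _ _).trans_eq ?_
    rw [(translate (-h)).norm_map]
    ring
  have hle : ∀ t, ∫ x, ‖heat t R x - R x‖ ^ 2 ≤ ∫ y, T (√t • y) ∂gauss := by
    intro t
    have hmeas : StronglyMeasurable fun p : E3 × E3 => ‖R (p.1 - √t • p.2) - R p.1‖ ^ 2 :=
      ((hR.comp_measurable (g := fun p : E3 × E3 => p.1 - √t • p.2) (by fun_prop)).sub
        (hR.comp_measurable measurable_fst)).norm.pow 2
    have hprod : Integrable (fun p : E3 × E3 => ‖R (p.1 - √t • p.2) - R p.1‖ ^ 2)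
        (volume.prod gauss) := by
      have i1 := (integrable_prod_comp_sub hsq (hR.norm.pow 2) t).const_mul 2
      have i2 : Integrable (fun p : E3 × E3 => 2 * ‖R p.1‖ ^ 2) (volume.prod gauss) :=
        (hsq.comp_fst gauss).const_mul 2
      refine (i1.add i2).mono' hmeas.aestronglyMeasurable (ae_of_all _ fun p => ?_)
      rw [Real.norm_of_nonneg (by positivity), Pi.add_apply]
      have := norm_sub_le (R (p.1 - √t • p.2)) (R p.1)
      nlinarith [sq_nonneg (‖R (p.1 - √t • p.2)‖ - ‖R p.1‖),
        norm_nonneg (R (p.1 - √t • p.2) - R p.1)]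
    have hswap : ∫ y, T (√t • y) ∂gauss = ∫ x, ∫ y, ‖R (x - √t • y) - R x‖ ^ 2 ∂gauss := by
      simp only [hTeq]
      rw [integral_integral_swap (f := fun x y => ‖R (x - √t • y) - R x‖ ^ 2) hprod]
    rw [hswap]
    refine integral_mono_of_nonneg (ae_of_all _ fun x => by positivity)
      hprod.integral_prod_left (ae_of_all _ fun x => ?_)
    have hbx : Integrable (fun y => R (x - √t • y)) gauss := hb.integrable t x
    have e : heat t R x - R x = ∫ y, (R (x - √t • y) - R x) ∂gauss := by
      rw [integral_sub hbx (integrable_const _)]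
      simp [heat]
    obtain ⟨C, hC⟩ := hb.bdd
    have hi : Integrable (fun y => ‖R (x - √t • y) - R x‖) gauss :=
      (hbx.sub (integrable_const _)).norm
    have hi2 : Integrable (fun y => ‖R (x - √t • y) - R x‖ ^ 2) gauss := by
      refine Integrable.of_bound (hi.1.pow 2) ((C + C) ^ 2) (ae_of_all _ fun y => ?_)
      rw [norm_pow, norm_norm]
      gcongr
      exact norm_sub_le_of_le (hC _) (hC _)
    simp only [e]
    calc _ ≤ (∫ y, ‖R (x - √t • y) - R x‖ ∂gauss) ^ 2 := by
          gcongr; exact norm_integral_le_integral_norm _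
      _ ≤ _ := sq_integral_le hi hi2
  refine squeeze_zero (fun t => integral_nonneg fun _ => by positivity) hle ?_
  have : Tendsto (fun t => ∫ y, T (√t • y) ∂gauss) (𝓝[>] 0) (𝓝 (∫ y : E3, 0 ∂gauss)) := by
    refine tendsto_integral_filter_of_dominated_convergence (fun _ => (2 * ‖f‖) ^ 2)
      (Eventually.of_forall fun t => (hTc.comp (continuous_const_smul _)).aestronglyMeasurable)
      (Eventually.of_forall fun t => ae_of_all _ fun y => ?_) (integrable_const _)
      (ae_of_all _ fun y => ?_)
    · rw [Real.norm_of_nonneg (by positivity)]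
      exact hTb _
    · have hc : Continuous fun t : ℝ => T (√t • y) := by fun_prop
      have := (hc.tendsto 0).mono_left (nhdsWithin_le_nhds (s := Ioi 0))
      simpa [hT0] using this
  simpa using this

section Phase

/-- The element of the phase space with a given profile. -/
def phaseOf (f : E3 → Sym0) (h2 : MemLp f 2 (volume : Measure E3))
    (h6 : MemLp f 6 (volume : Measure E3)) : H :=
  ⟨(h2.toLp f, h6.toLp f), h2.coeFn_toLp.trans h6.coeFn_toLp.symm⟩

theorem profile_phaseOf {f : E3 → Sym0} (h2 : MemLp f 2 (volume : Measure E3))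
    (h6 : MemLp f 6 (volume : Measure E3)) : profile (phaseOf f h2 h6) =ᵐ[volume] f :=
  h2.coeFn_toLp

theorem memLp_of_le_weight {N k : ℝ} (hN : 3 < N) {f : E3 → Sym0} (hf : StronglyMeasurable f)
    (h : ∀ x, ‖f x‖ ≤ k * weight N x) {p : ℝ≥0∞} (hp : 1 ≤ p) (hp' : p ≠ ⊤) :
    MemLp f p (volume : Measure E3) := by
  have hp1 : 1 ≤ p.toReal := by simpa using ENNReal.toReal_mono hp' hp
  rw [← integrable_norm_rpow_iff hf.aestronglyMeasurable (zero_lt_one.trans_le hp).ne' hp']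
  refine ((integrable_weight hN).const_mul (|k| ^ p.toReal)).mono'
    (hf.norm.measurable.pow_const _).aestronglyMeasurable (ae_of_all _ fun x => ?_)
  have h0 := weight_pos N x
  have h1 := (isWeight_weight (by linarith : 0 ≤ N)).le_one x
  rw [Real.norm_of_nonneg (by positivity)]
  calc _ ≤ (|k| * weight N x) ^ p.toReal := by
        gcongr
        exact (h x).trans (by gcongr; exact le_abs_self k)
    _ = |k| ^ p.toReal * weight N x ^ p.toReal := Real.mul_rpow (abs_nonneg k) h0.le
    _ ≤ _ := by
        gcongr
        calc _ ≤ weight N x ^ (1 : ℝ) := Real.rpow_le_rpow_of_exponent_ge h0 h1 hp1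
          _ = _ := Real.rpow_one _

/-- Interpolation |f|⁶ ≤ B⁴|f|². For bounded profiles the L² norm alone thus controls the norm of H.
-/
theorem norm_snd_pow_le {p : H} {B : ℝ} (hB : ∀ᵐ x, ‖profile p x‖ ≤ B) :
    ‖p.1.2‖ ≤ (B ^ 4 * ‖p.1.1‖ ^ 2) ^ (1 / 6 : ℝ) := by
  have hp : (p.1.1 : E3 → Sym0) =ᵐ[volume] p.1.2 := p.2
  rw [Lp.norm_def, (Lp.memLp p.1.2).eLpNorm_eq_integral_rpow_norm (by norm_num) (by norm_num),
    ENNReal.toReal_ofReal (by positivity), norm_sq_eq_integral, ← integral_const_mul]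
  simp only [ENNReal.toReal_ofNat, one_div]
  refine Real.rpow_le_rpow (integral_nonneg fun _ => by positivity) ?_ (by norm_num)
  refine integral_mono_of_nonneg (ae_of_all _ fun _ => by positivity)
    ((integrable_norm_sq _).const_mul _) ?_
  filter_upwards [hp, hB] with x h1 h2
  rw [← h1]
  change ‖p.1.1 x‖ ≤ B at h2
  norm_cast
  calc ‖p.1.1 x‖ ^ 6 = ‖p.1.1 x‖ ^ 4 * ‖p.1.1 x‖ ^ 2 := by ring
    _ ≤ _ := by gcongr

theorem norm_phase_le {p : H} {B : ℝ} (hB : ∀ᵐ x, ‖profile p x‖ ≤ B) :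
    ‖p‖ ≤ ‖p.1.1‖ + (B ^ 4 * ‖p.1.1‖ ^ 2) ^ (1 / 6 : ℝ) := by
  have h1 := norm_snd_pow_le hB
  have h2 : ‖p‖ = max ‖p.1.1‖ ‖p.1.2‖ := rfl
  rw [h2]
  have h3 := norm_nonneg p.1.2
  exact max_le (by linarith) (by linarith [norm_nonneg p.1.1])

/-- On uniformly bounded sets, convergence in `L²` implies convergence in the phase space. -/
theorem tendsto_phase {X : Type*} {l : Filter X} {q : X → H} {q₀ : H} {B : ℝ}
    (hB : ∀ᶠ s in l, ∀ᵐ x, ‖profile (q s) x‖ ≤ B) (hB0 : ∀ᵐ x, ‖profile q₀ x‖ ≤ B)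
    (h : Tendsto (fun s => ‖(q s - q₀).1.1‖ ^ 2) l (𝓝 0)) : Tendsto q l (𝓝 q₀) := by
  rw [tendsto_iff_norm_sub_tendsto_zero]
  have h1 : Tendsto (fun s => √(‖(q s - q₀).1.1‖ ^ 2) +
      ((B + B) ^ 4 * ‖(q s - q₀).1.1‖ ^ 2) ^ (1 / 6 : ℝ)) l (𝓝 (√0 + ((B + B) ^ 4 * 0) ^
        (1 / 6 : ℝ))) :=
    h.sqrt.add ((h.const_mul _).rpow_const (Or.inr (by norm_num)))
  have e : √0 + ((B + B) ^ 4 * 0) ^ (1 / 6 : ℝ) = 0 := by simp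
  rw [e] at h1
  refine squeeze_zero' (Eventually.of_forall fun _ => norm_nonneg _) (hB.mono fun s hs => ?_) h1
  rw [Real.sqrt_sq (norm_nonneg _)]
  refine norm_phase_le ?_
  filter_upwards [profile_sub (q s) q₀, hs, hB0] with x a1 a2 a3
  rw [a1]
  exact norm_sub_le_of_le a2 a3

theorem norm_fst_sq_eq {p : H} {f : E3 → Sym0} (h : profile p =ᵐ[volume] f) :
    ‖p.1.1‖ ^ 2 = ∫ x, ‖f x‖ ^ 2 := by
  rw [norm_sq_eq_integral]
  exact integral_congr_ae (h.mono fun x hx => by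
    change ‖profile p x‖ ^ 2 = _
    rw [hx])

end Phase

end QTensor
end

/-! ### From small data to trajectories in the phase space -/

noncomputable section

set_option linter.unusedSectionVars false
set_option maxSynthPendingDepth 3

namespace QTensor

theorem ae_norm_le_of_weightedNorm_le {δ ε : ℝ} (hε : 0 ≤ ε) {f : E3 → Sym0}
    (h : weightedNorm δ f ≤ ENNReal.ofReal ε) : ∀ᵐ x, ‖f x‖ ≤ ε * weight (8 + δ) x := by
  rw [weightedNorm, eLpNorm_exponent_top] at h
  filter_upwards [enorm_ae_le_eLpNormEssSup (fun x => (1 + ‖x‖) ^ (8 + δ) • f x) volume] with x hx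
  have h1 : ‖(1 + ‖x‖) ^ (8 + δ) • f x‖ ≤ ε := by
    rw [← ENNReal.ofReal_le_ofReal_iff hε, ofReal_norm]
    exact hx.trans h
  rw [norm_smul, Real.norm_of_nonneg (by positivity)] at h1
  rw [weight, Real.rpow_neg (by positivity), ← div_eq_mul_inv, le_div_iff₀ (by positivity)]
  linarith

theorem weightedNorm_le_of_ae {δ ε : ℝ} {f : E3 → Sym0}
    (h : ∀ᵐ x, ‖f x‖ ≤ ε * weight (8 + δ) x) : weightedNorm δ f ≤ ENNReal.ofReal ε := by
  rw [weightedNorm, eLpNorm_exponent_top]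
  refine eLpNormEssSup_le_of_ae_bound (h.mono fun x hx => ?_)
  rw [norm_smul, Real.norm_of_nonneg (by positivity)]
  rw [weight, Real.rpow_neg (by positivity), ← div_eq_mul_inv, le_div_iff₀ (by positivity)] at hx
  linarith

/-- The smallness condition under which the integral equation is a contraction. -/
structure IsSmallness (a b c η : ℝ) : Prop where
  ha : 0 < a
  hb : 0 < b
  hc : 0 < c
  pos : 0 < η
  le_one : 2 * η ≤ 1
  contr : 16 * η * reactionConst b c ≤ a

/-- `w` solves the integral equation for `e^(at) Q` with a good representative `R` of `Q₀`. -/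
structure IsRepresentation (a b c N η : ℝ) (Q₀ : H) (R : E3 → Sym0) (w : ℝ → E3 → Sym0) :
    Prop where
  sm : StronglyMeasurable R
  le : ∀ x, ‖R x‖ ≤ η * weight N x
  ae : profile Q₀ =ᵐ[volume] R
  dom : IsDominated (weight N) η w
  eq : ∀ t, 0 < t → ∀ x, w t x = picard (scaledReaction a b c) R w t x

theorem IsSmallness.decaying {a b c η : ℝ} (h : IsSmallness a b c η) :
    IsDecayingNonlinearity (scaledReaction a b c) a (reactionConst b c) :=
  isDecayingNonlinearity_scaledReaction h.ha h.hb h.hc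

theorem exists_isRepresentation {a b c δ η : ℝ} (hδ : 0 < δ) (h : IsSmallness a b c η) {Q₀ : H}
    (hQ : Q₀ ∈ smallData δ η) : ∃ R w, IsRepresentation a b c (8 + δ) η Q₀ R w := by
  have hae := ae_norm_le_of_weightedNorm_le h.pos.le (le_of_lt (show weightedNorm _ _ < _ from hQ))
  have hsm : StronglyMeasurable (profile Q₀) := Lp.stronglyMeasurable Q₀.1.1
  -- The fixed-point argument is pointwise and needs the bound everywhere, so the representative is
  -- set to 0 on the null set where it fails.
  set S := {x | ‖profile Q₀ x‖ ≤ η * weight (8 + δ) x} with hS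
  have hSm : MeasurableSet S := measurableSet_le hsm.norm.measurable
    ((continuous_weight _).measurable.const_mul _)
  have hR := hsm.indicator hSm
  have hRle : ∀ x, ‖S.indicator (profile Q₀) x‖ ≤ η * weight (8 + δ) x := fun x => by
    by_cases hx : x ∈ S
    · rw [indicator_of_mem hx]; exact hx
    · rw [indicator_of_notMem hx, norm_zero]
      have := weight_pos (8 + δ) x
      have := h.pos
      positivity
  obtain ⟨w, hw, he⟩ := exists_isDominated_eq_picard h.pos.le h.le_one h.contr
    (isWeight_weight (by linarith : 0 ≤ 8 + δ)) h.decaying hR hRle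
  exact ⟨_, w, hR, hRle, hae.mono fun x hx =>
    (indicator_of_mem (s := S) hx _).symm, hw, he⟩

section

variable {a b c N η : ℝ} {Q₀ Q₁ : H} {R R₁ : E3 → Sym0} {w w₁ : ℝ → E3 → Sym0}

namespace IsRepresentation

theorem isBddMeas (hN : 3 < N) (hr : IsRepresentation a b c N η Q₀ R w) : IsBddMeas R :=
  isBddMeas_of_le_weight (by linarith) hr.sm hr.le

theorem norm_le (hN : 3 < N) (h : IsSmallness a b c η) (hr : IsRepresentation a b c N η Q₀ R w)
    {t : ℝ} (ht : 0 < t) (x : E3) :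
    ‖w t x‖ ≤ gaussMoment N * (1 + √t) ^ N * weight N x :=
  (hr.dom.le t ht x).trans ((mul_le_of_le_one_left
    (heat_nonneg (isWeight_weight (by linarith)).nonneg t x) h.le_one).trans
      (heat_weight_le (by linarith) t x))

theorem norm_le_one (hN : 3 < N) (h : IsSmallness a b c η)
    (hr : IsRepresentation a b c N η Q₀ R w) {t : ℝ} (ht : 0 < t) (x : E3) : ‖w t x‖ ≤ 1 :=
  (hr.dom.norm_le h.pos.le (isWeight_weight (by linarith)) ht x).trans h.le_one

theorem continuous (hr : IsRepresentation a b c N η Q₀ R w) {t : ℝ} (ht : 0 < t) :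
    Continuous (w t) :=
  hr.dom.cont.comp_continuous (f := fun x => (t, x)) (by fun_prop) fun x => ⟨ht, mem_univ _⟩

theorem continuousAt_fst (hr : IsRepresentation a b c N η Q₀ R w) {t : ℝ} (ht : 0 < t) (x : E3) :
    ContinuousAt (fun s => w s x) t :=
  ((hr.dom.cont.continuousAt ((isOpen_Ioi.prod isOpen_univ).mem_nhds
    (show (t, x) ∈ _ from ⟨ht, mem_univ _⟩))).comp (f := fun s => (s, x)) (by fun_prop))

theorem exp_le_one (h : IsSmallness a b c η) {t : ℝ} (ht : 0 ≤ t) : Real.exp (-a * t) ≤ 1 :=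
  Real.exp_le_one_iff.2 (by nlinarith [h.ha])

theorem norm_solution_le (hN : 3 < N) (h : IsSmallness a b c η)
    (hr : IsRepresentation a b c N η Q₀ R w) {t : ℝ} (ht : 0 < t) (x : E3) :
    ‖Real.exp (-a * t) • w t x‖ ≤ gaussMoment N * (1 + √t) ^ N * weight N x := by
  rw [norm_smul, Real.norm_of_nonneg (Real.exp_pos _).le]
  exact (mul_le_of_le_one_left (norm_nonneg _) (exp_le_one h ht.le)).trans (hr.norm_le hN h ht x)

theorem norm_solution_le_one (hN : 3 < N) (h : IsSmallness a b c η)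
    (hr : IsRepresentation a b c N η Q₀ R w) {t : ℝ} (ht : 0 < t) (x : E3) :
    ‖Real.exp (-a * t) • w t x‖ ≤ 1 := by
  rw [norm_smul, Real.norm_of_nonneg (Real.exp_pos _).le]
  exact (mul_le_of_le_one_left (norm_nonneg _) (exp_le_one h ht.le)).trans (hr.norm_le_one hN h ht x)

theorem stronglyMeasurable_solution (hr : IsRepresentation a b c N η Q₀ R w) {t : ℝ} (ht : 0 < t) :
    StronglyMeasurable fun x => Real.exp (-a * t) • w t x :=
  ((hr.continuous ht).const_smul (Real.exp (-a * t))).stronglyMeasurable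

/-- A continuous function of time into the phase space, with the given values for positive times. -/
theorem exists_trajectory (hN : 3 < N) (h : IsSmallness a b c η)
    (hr : IsRepresentation a b c N η Q₀ R w) : ∃ q : ℝ → H, q 0 = Q₀ ∧
      ∀ t, 0 < t → profile (q t) =ᵐ[volume] fun x => Real.exp (-a * t) • w t x := by
  have hm : ∀ t, 0 < t → ∀ p : ℝ≥0∞, 1 ≤ p → p ≠ ⊤ →
      MemLp (fun x => Real.exp (-a * t) • w t x) p (volume : Measure E3) := fun t ht p hp hp' =>
    memLp_of_le_weight hN (hr.stronglyMeasurable_solution ht) (hr.norm_solution_le hN h ht) hp hp'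
  refine ⟨fun t => if ht : 0 < t then phaseOf _ (hm t ht 2 (by norm_num) (by norm_num))
    (hm t ht 6 (by norm_num) (by norm_num)) else Q₀, by simp, fun t ht => ?_⟩
  simp only [ht, dif_pos]
  exact profile_phaseOf _ _

theorem isTrajectory (hN : 3 < N) (h : IsSmallness a b c η)
    (hr : IsRepresentation a b c N η Q₀ R w) {q : ℝ → H} (hq0 : q 0 = Q₀)
    (hq : ∀ t, 0 < t → profile (q t) =ᵐ[volume] fun x => Real.exp (-a * t) • w t x) :
    IsTrajectory a b c Q₀ q := by
  have hN0 : 0 ≤ N := by linarith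
  have hG := gaussMoment_nonneg N
  refine ⟨hq0, fun t₀ ht₀ => ?_, _, isClassicalSolution_of_picard h.ha h.hb h.hc h.pos.le h.le_one
    (isWeight_weight hN0) (hr.isBddMeas hN) hr.dom hr.eq, hq⟩
  have hbq : ∀ t, 0 < t → ∀ᵐ x, ‖profile (q t) x‖ ≤ 1 := fun t ht => by
    filter_upwards [hq t ht] with x hx
    rw [hx]
    exact hr.norm_solution_le_one hN h ht x
  have hbound : ∀ D, Integrable fun x => (D * weight N x) ^ 2 := fun D => by
    have := integrable_norm_sq_of_le_weight hN
      ((continuous_weight N).stronglyMeasurable.const_mul D) (k := |D|) fun x => by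
        rw [norm_mul, Real.norm_of_nonneg (weight_pos N x).le]; rfl
    simpa only [Real.norm_eq_abs, sq_abs] using this
  have hgrow : ∀ T t, 0 < t → t ≤ T → ∀ x, ‖Real.exp (-a * t) • w t x‖ ≤
      gaussMoment N * (1 + √T) ^ N * weight N x := fun T t ht htT x => by
    refine (hr.norm_solution_le hN h ht x).trans ?_
    have := weight_pos N x
    gcongr
  rcases eq_or_lt_of_le (show 0 ≤ t₀ from ht₀) with rfl | ht₀
  · rw [← continuousWithinAt_Ioi_iff_Ici]
    have hb0 : ∀ᵐ x, ‖profile (q 0) x‖ ≤ 1 := by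
      filter_upwards [hr.ae] with x hx
      rw [hq0, hx]
      have h1 := (isWeight_weight hN0).le_one x
      nlinarith [hr.le x, h.pos, h.le_one]
    refine tendsto_phase (eventually_mem_nhdsWithin.mono fun t ht => hbq t ht) hb0 ?_
    -- At time zero `R` need not be continuous, so the solution is compared with the heat flow of
    -- `R`: their difference tends to 0 pointwise under an L² majorant, since the Duhamel term is
    -- O(t), and the heat flow converges to `R` in L².
    set S := fun s y => scaledReaction a b c s (w s y)
    have hsrc := hr.dom.isSource h.pos.le h.le_one (isWeight_weight hN0) h.decaying 2
    have hRle : ∀ t, 0 < t → t ≤ 1 → ∀ x, ‖heat t R x‖ ≤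
        gaussMoment N * (1 + √1) ^ N * weight N x := fun t ht ht1 x => by
      have h1 : ‖heat t R x‖ ≤ heat t (weight N) x :=
        norm_heat_le_heat (isWeight_weight hN0).isBddMeas (fun y => (hr.le y).trans
          (mul_le_of_le_one_left (weight_pos N y).le (by linarith [h.pos, h.le_one]))) t x
      refine h1.trans ((heat_weight_le hN0 t x).trans ?_)
      have := weight_pos N x
      gcongr
    set D := gaussMoment N * (1 + √1) ^ N
    have l1 : Tendsto (fun t => ∫ x, ‖Real.exp (-a * t) • w t x - heat t R x‖ ^ 2) (𝓝[>] 0)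
        (𝓝 (∫ _ : E3, 0)) := by
      refine tendsto_integral_filter_of_dominated_convergence (fun x => (2 * D * weight N x) ^ 2)
        ?_ ?_ (hbound _) (ae_of_all _ fun x => ?_)
      · filter_upwards [self_mem_nhdsWithin] with t ht
        exact (((hr.stronglyMeasurable_solution ht).sub
          (stronglyMeasurable_heat hr.sm t)).norm.pow 2).aestronglyMeasurable
      · filter_upwards [Ioc_mem_nhdsGT (zero_lt_one' ℝ)] with t ht
        refine ae_of_all _ fun x => ?_
        rw [norm_pow, norm_norm]
        gcongr
        refine (norm_sub_le_of_le (hgrow 1 t ht.1 ht.2 x) (hRle t ht.1 ht.2 x)).trans_eq ?_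
        ring
      · have hlim : Tendsto (fun t => ((1 - Real.exp (-a * t)) * 1 + reactionConst b c * t) ^ 2)
            (𝓝[>] 0) (𝓝 0) := by
          have hc : Continuous fun t => ((1 - Real.exp (-a * t)) * 1 + reactionConst b c * t) ^ 2 := by
            fun_prop
          have := (hc.tendsto 0).mono_left (nhdsWithin_le_nhds (s := Ioi 0))
          simpa using this
        refine squeeze_zero' (Eventually.of_forall fun t => by positivity) ?_ hlim
        filter_upwards [Ioc_mem_nhdsGT (zero_lt_one' ℝ)] with t ht
        have e : Real.exp (-a * t) • w t x - heat t R x =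
            (Real.exp (-a * t) - 1) • w t x + duhamel S t x := by
          have := hr.eq t ht.1 x
          rw [picard] at this
          have h2 : heat t R x = w t x - duhamel S t x := by rw [this]; abel
          rw [h2]
          module
        have h1 := hsrc.norm_duhamel_le (t := t) ⟨ht.1, by linarith [ht.2]⟩ x
        have h2 := hr.norm_le_one hN h ht.1 x
        have h3 := exp_le_one h ht.1.le
        gcongr
        rw [e]
        refine norm_add_le_of_le ?_ h1
        rw [norm_smul, Real.norm_of_nonpos (by linarith), neg_sub]
        gcongr
    have l2 := tendsto_integral_norm_sq_heat_sub hN hr.sm hr.le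
    have l3 := (l1.const_mul 2).add (l2.const_mul 2)
    simp only [integral_zero, mul_zero, add_zero] at l3
    refine squeeze_zero' (Eventually.of_forall fun t => by positivity) ?_ l3
    filter_upwards [Ioc_mem_nhdsGT (zero_lt_one' ℝ)] with t ht
    have hpr : profile (q t - q 0) =ᵐ[volume] fun x => Real.exp (-a * t) • w t x - R x := by
      filter_upwards [profile_sub (q t) (q 0), hq t ht.1, hr.ae] with x a1 a2 a3
      rw [a1, a2, hq0, a3]
    rw [norm_fst_sq_eq hpr, ← integral_const_mul, ← integral_const_mul]
    have i1 : Integrable fun x => ‖Real.exp (-a * t) • w t x - heat t R x‖ ^ 2 := by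
      refine integrable_norm_sq_of_le_weight hN (k := D + D)
        ((hr.stronglyMeasurable_solution ht.1).sub (stronglyMeasurable_heat hr.sm t)) fun x => ?_
      rw [add_mul]
      exact norm_sub_le_of_le (hgrow 1 t ht.1 ht.2 x) (hRle t ht.1 ht.2 x)
    have i2 : Integrable fun x => ‖heat t R x - R x‖ ^ 2 := by
      refine integrable_norm_sq_of_le_weight hN (k := D + η)
        ((stronglyMeasurable_heat hr.sm t).sub hr.sm) fun x => ?_
      rw [add_mul]
      exact norm_sub_le_of_le (hRle t ht.1 ht.2 x) (hr.le x)
    rw [← integral_add (i1.const_mul 2) (i2.const_mul 2)]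
    refine integral_mono_of_nonneg (ae_of_all _ fun x => by positivity)
      ((i1.const_mul 2).add (i2.const_mul 2)) (ae_of_all _ fun x => ?_)
    have h1 := norm_sub_le_norm_sub_add_norm_sub (Real.exp (-a * t) • w t x) (heat t R x) (R x)
    simp only
    nlinarith [norm_nonneg (Real.exp (-a * t) • w t x - R x),
      sq_nonneg (‖Real.exp (-a * t) • w t x - heat t R x‖ - ‖heat t R x - R x‖)]
  · refine ContinuousAt.continuousWithinAt ?_
    have hnear : Ioo 0 (t₀ + 1) ∈ 𝓝 t₀ := isOpen_Ioo.mem_nhds ⟨ht₀, by linarith⟩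
    refine tendsto_phase (B := 1) ?_ (hbq t₀ ht₀) ?_
    · filter_upwards [hnear] with t ht using hbq t ht.1
    · set D := gaussMoment N * (1 + √(t₀ + 1)) ^ N
      have l1 : Tendsto (fun t => ∫ x, ‖Real.exp (-a * t) • w t x - Real.exp (-a * t₀) • w t₀ x‖ ^ 2)
          (𝓝 t₀) (𝓝 (∫ _ : E3, 0)) := by
        refine tendsto_integral_filter_of_dominated_convergence (fun x => (2 * D * weight N x) ^ 2)
          ?_ ?_ (hbound _) (ae_of_all _ fun x => ?_)
        · filter_upwards [hnear] with t ht
          exact (((hr.stronglyMeasurable_solution ht.1).sub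
            (hr.stronglyMeasurable_solution ht₀)).norm.pow 2).aestronglyMeasurable
        · filter_upwards [hnear] with t ht
          refine ae_of_all _ fun x => ?_
          rw [norm_pow, norm_norm]
          gcongr
          refine (norm_sub_le_of_le (hgrow (t₀ + 1) t ht.1 ht.2.le x)
            (hgrow (t₀ + 1) t₀ ht₀ (by linarith) x)).trans_eq ?_
          ring
        · have h1 := hr.continuousAt_fst ht₀ x
          have h2 : ContinuousAt (fun t => Real.exp (-a * t)) t₀ := by fun_prop
          have h3 := ((h2.smul h1).sub (continuousAt_const
            (y := Real.exp (-a * t₀) • w t₀ x))).norm.pow 2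
          refine Tendsto.congr' EventuallyEq.rfl (h3.tendsto.trans_eq ?_)
          simp
      rw [integral_zero] at l1
      refine l1.congr' ?_
      filter_upwards [hnear] with t ht
      refine (norm_fst_sq_eq ?_).symm
      filter_upwards [profile_sub (q t) (q t₀), hq t ht.1, hq t₀ ht₀] with x a1 a2 a3
      rw [a1, a2, a3]

theorem isWellPosedAt (hN : 3 < N) (h : IsSmallness a b c η)
    (hr : IsRepresentation a b c N η Q₀ R w) : IsWellPosedAt a b c Q₀ := by
  obtain ⟨q, hq0, hq⟩ := hr.exists_trajectory hN h
  exact ⟨⟨q, hr.isTrajectory hN h hq0 hq⟩, fun q q' hq hq' =>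
    eqOn_of_isTrajectory h.ha h.hb h.hc hq hq'⟩

theorem exists_solutionMap_eq (hN : 3 < N) (h : IsSmallness a b c η)
    (hr : IsRepresentation a b c N η Q₀ R w) :
    solutionMap a b c 0 Q₀ = Q₀ ∧ ∀ t, 0 < t →
      profile (solutionMap a b c t Q₀) =ᵐ[volume] fun x => Real.exp (-a * t) • w t x := by
  obtain ⟨q, hq0, hq⟩ := hr.exists_trajectory hN h
  have hT := hr.isTrajectory hN h hq0 hq
  have hex : ∃ q, IsTrajectory a b c Q₀ q := ⟨q, hT⟩
  -- The solution operator picks some trajectory; uniqueness identifies it with the constructed one.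
  have he := eqOn_of_isTrajectory h.ha h.hb h.hc hex.choose_spec hT
  have hs : ∀ t, 0 ≤ t → solutionMap a b c t Q₀ = q t := fun t ht => by
    rw [solutionMap, dif_pos hex]
    exact he ht
  exact ⟨(hs 0 le_rfl).trans hq0, fun t ht => by rw [hs t ht.le]; exact hq t ht⟩

theorem solutionMap_zero (hN : 3 < N) (h : IsSmallness a b c η)
    (hr : IsRepresentation a b c N η Q₀ R w) : solutionMap a b c 0 Q₀ = Q₀ :=
  (hr.exists_solutionMap_eq hN h).1

theorem profile_solutionMap (hN : 3 < N) (h : IsSmallness a b c η)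
    (hr : IsRepresentation a b c N η Q₀ R w) {t : ℝ} (ht : 0 < t) :
    profile (solutionMap a b c t Q₀) =ᵐ[volume] fun x => Real.exp (-a * t) • w t x :=
  (hr.exists_solutionMap_eq hN h).2 t ht

end IsRepresentation

end

end QTensor
end

/-! ### The coefficient matrix; openness and density -/

noncomputable section

set_option linter.unusedSectionVars false
set_option maxSynthPendingDepth 3

namespace QTensor

theorem continuousOn_shiftedHeatKernel :
    ContinuousOn (fun p : ℝ × E3 => heatKernel (p.1 + 1) p.2) (Ioi 0 ×ˢ univ) := by
  unfold heatKernel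
  have h0 : ∀ p ∈ Ioi (0 : ℝ) ×ˢ (univ : Set E3), (0 : ℝ) < p.1 + 1 := fun p hp => by
    have : (0 : ℝ) < p.1 := hp.1
    linarith
  refine ContinuousOn.div ?_ ?_ fun p hp => ?_
  · refine Real.continuous_exp.comp_continuousOn (ContinuousOn.div (by fun_prop) (by fun_prop) ?_)
    intro p hp
    have := h0 p hp
    positivity
  · refine ContinuousOn.rpow_const (by fun_prop) fun p hp => Or.inl ?_
    have := h0 p hp
    positivity
  · have := h0 p hp
    positivity

theorem IsRemainder.continuous {δ : ℝ} {V : ℝ → E3 → Sym0} (hV : IsRemainder δ V) {t : ℝ}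
    (ht : 0 < t) : Continuous (V t) :=
  hV.1.comp_continuous (f := fun x => (t, x)) (by fun_prop) fun x => ⟨ht, mem_univ _⟩

/-- At x = 0 the kernel has size (t+1)^(-3/2) while both remainders are O((t+1)^(-2)), so A - A' is
O((t+1)^(-1/2)) for all t. Evaluation at a point is legitimate because the two expansions are
continuous in x and agree almost everywhere. -/
theorem isCoefficientMatrix_unique {δ a b c : ℝ} {Q₀ : H} {A A' : Sym0}
    (h : IsCoefficientMatrix δ a b c Q₀ A) (h' : IsCoefficientMatrix δ a b c Q₀ A') : A = A' := by
  obtain ⟨V, hV, hA⟩ := h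
  obtain ⟨V', hV', hA'⟩ := h'
  obtain ⟨M, hM⟩ := hV.2
  obtain ⟨M', hM'⟩ := hV'.2
  have key : ∀ t, 0 < t → ‖A - A'‖ ≤ (M + M') * (4 * Real.pi) ^ (3 / 2 : ℝ) *
      (t + 1) ^ (-(1 / 2) : ℝ) := by
    intro t ht
    have ht1 : 0 < t + 1 := by linarith
    have hc : Continuous (shiftedHeatKernel t) := continuous_heatKernel (t + 1)
    have hcV := hV.continuous ht
    have hcV' := hV'.continuous ht
    have hae := (hA t ht).symm.trans (hA' t ht)
    have heq := congrFun ((Continuous.ae_eq_iff_eq (volume : Measure E3) (by fun_prop)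
      (by fun_prop)).1 hae) 0
    simp only [← smul_add] at heq
    have h1 := smul_right_injective Sym0 (Real.exp_pos (-a * t)).ne' heq
    have h2 : shiftedHeatKernel t 0 • (A - A') = V' t 0 - V t 0 := by
      rw [smul_sub, sub_eq_sub_iff_add_eq_add, add_comm (V' t 0)]
      simpa using h1
    have h3 := hM t ht 0
    have h4 := hM' t ht 0
    simp only [norm_zero, zero_div, add_zero, Real.one_rpow, one_mul] at h3 h4
    have h5 : shiftedHeatKernel t 0 = (4 * Real.pi) ^ (-(3 / 2) : ℝ) * (t + 1) ^ (-(3 / 2) : ℝ) := by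
      rw [shiftedHeatKernel, norm_zero, ← Real.mul_rpow (by positivity) (by positivity),
        Real.rpow_neg (by positivity)]
      simp
    have h6 : (t + 1) ^ 2 * ‖V' t 0 - V t 0‖ ≤ M + M' := by
      have := norm_sub_le (V' t 0) (V t 0)
      nlinarith [sq_nonneg (t + 1)]
    have hK : 0 < shiftedHeatKernel t 0 := heatKernel_pos ht1 0
    rw [← h2, norm_smul, Real.norm_of_nonneg hK.le, h5] at h6
    have h7 : (t + 1) ^ 2 * (t + 1) ^ (-(3 / 2) : ℝ) * (t + 1) ^ (-(1 / 2) : ℝ) = 1 := by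
      rw [← Real.rpow_natCast, ← Real.rpow_add ht1, ← Real.rpow_add ht1]
      norm_num
    have h8 : (4 * Real.pi) ^ (-(3 / 2) : ℝ) * (4 * Real.pi) ^ (3 / 2 : ℝ) = 1 := by
      rw [← Real.rpow_add (by positivity)]
      norm_num
    calc ‖A - A'‖ = ((t + 1) ^ 2 * ((4 * Real.pi) ^ (-(3 / 2) : ℝ) * (t + 1) ^ (-(3 / 2) : ℝ) *
          ‖A - A'‖)) * (4 * Real.pi) ^ (3 / 2 : ℝ) * (t + 1) ^ (-(1 / 2) : ℝ) := by
          linear_combination (-‖A - A'‖) * h7 - ‖A - A'‖ * ((t + 1) ^ 2 *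
            (t + 1) ^ (-(3 / 2) : ℝ) * (t + 1) ^ (-(1 / 2) : ℝ)) * h8
      _ ≤ _ := by gcongr
  have hlim : Tendsto (fun t : ℝ => (M + M') * (4 * Real.pi) ^ (3 / 2 : ℝ) *
      (t + 1) ^ (-(1 / 2) : ℝ)) atTop (𝓝 0) := by
    have := ((tendsto_rpow_neg_atTop (y := 1 / 2) (by norm_num)).comp
      (tendsto_atTop_add_const_right atTop (1 : ℝ) tendsto_id)).const_mul
        ((M + M') * (4 * Real.pi) ^ (3 / 2 : ℝ))
    simpa using this
  have h0 := ge_of_tendsto hlim ((eventually_gt_atTop 0).mono key)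
  exact sub_eq_zero.1 (norm_le_zero_iff.1 h0)

section

variable {a b c δ η : ℝ} {Q₀ Q₁ : H} {R R₁ : E3 → Sym0} {w w₁ : ℝ → E3 → Sym0}

/-- Uniform asymptotics of the solutions with small data. -/
theorem exists_uniform_decay (hδ : 0 < δ) (h : IsSmallness a b c η) : ∃ M, 0 ≤ M ∧ ∀ Q₀ R w,
    IsRepresentation a b c (8 + δ) η Q₀ R w → ∀ t, 0 < t → ∀ x,
      ‖w t x - heatKernel (t + 1) x • massLimit (scaledReaction a b c) R w‖ ≤
        M * decay (4 + δ / 2) t x := by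
  obtain ⟨M, hM0, hM⟩ := exists_norm_sub_massLimit_le_decay (p := 4 + δ / 2) (N := 8 + δ)
    (by linarith) (by linarith) h.pos.le h.le_one h.decaying
  exact ⟨M, hM0, fun Q₀ R w hr => hM R w hr.sm hr.le hr.dom hr.eq⟩

theorem IsRepresentation.isCoefficientMatrix (hδ : 0 < δ) (h : IsSmallness a b c η)
    (hr : IsRepresentation a b c (8 + δ) η Q₀ R w) :
    IsCoefficientMatrix δ a b c Q₀ (massLimit (scaledReaction a b c) R w) := by
  obtain ⟨M, -, hM⟩ := exists_uniform_decay hδ h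
  refine ⟨fun t x => w t x - heatKernel (t + 1) x • massLimit (scaledReaction a b c) R w,
    ⟨hr.dom.cont.sub (continuousOn_shiftedHeatKernel.smul continuousOn_const), M,
      fun t ht x => ?_⟩, fun t ht => ?_⟩
  · calc _ ≤ (1 + ‖x‖ / √(t + 1)) ^ (4 + δ / 2) * (t + 1) ^ 2 * (M * decay (4 + δ / 2) t x) := by
          gcongr
          exact hM Q₀ R w hr t ht x
      _ = M * ((1 + ‖x‖ / √(t + 1)) ^ (4 + δ / 2) * (t + 1) ^ 2 * decay (4 + δ / 2) t x) := by ring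
      _ = M := by rw [mul_decay _ ht.le, mul_one]
  · refine (hr.profile_solutionMap (by linarith) h ht).trans (ae_of_all _ fun x => ?_)
    simp only [shiftedHeatKernel_eq]
    rw [← smul_add, add_sub_cancel]

theorem IsRepresentation.isCoefficientMatrix_zero_iff (hδ : 0 < δ) (h : IsSmallness a b c η)
    (hr : IsRepresentation a b c (8 + δ) η Q₀ R w) :
    IsCoefficientMatrix δ a b c Q₀ 0 ↔ massLimit (scaledReaction a b c) R w = 0 :=
  ⟨fun h0 => isCoefficientMatrix_unique (hr.isCoefficientMatrix hδ h) h0,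
    fun h0 => h0 ▸ hr.isCoefficientMatrix hδ h⟩

theorem IsRepresentation.norm_massLimit_sub_le (hδ : 0 < δ) (h : IsSmallness a b c η)
    (hr : IsRepresentation a b c (8 + δ) η Q₀ R w)
    (hr₁ : IsRepresentation a b c (8 + δ) η Q₁ R₁ w₁) :
    ‖massLimit (scaledReaction a b c) R w - massLimit (scaledReaction a b c) R₁ w₁ -
      ∫ x, (R x - R₁ x)‖ ≤ 1 / 3 * ∫ x, ‖R x - R₁ x‖ :=
  QTensor.norm_massLimit_sub_le (by linarith) h.pos.le h.le_one h.contr h.decaying hr.sm hr₁.sm hr.le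
    hr₁.le hr.dom hr₁.dom hr.eq hr₁.eq

theorem exists_weightedNorm_eq (h : Q₀ ∈ smallData δ η) :
    ∃ ε, 0 ≤ ε ∧ ε < η ∧ weightedNorm δ (profile Q₀) = ENNReal.ofReal ε := by
  have h' : weightedNorm δ (profile Q₀) < ENNReal.ofReal η := h
  refine ⟨(weightedNorm δ (profile Q₀)).toReal, ENNReal.toReal_nonneg, ?_,
    (ENNReal.ofReal_toReal h'.ne_top).symm⟩
  exact (ENNReal.lt_ofReal_iff_toReal_lt h'.ne_top).1 h'

/-- A weighted perturbation of small size stays in the set of small data. -/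
theorem mem_smallData_of_weightedNorm_sub {ε ε' : ℝ} (hη : 0 < η) (hε : 0 ≤ ε) (hε' : 0 ≤ ε')
    (hle : ε + ε' < η) (h : weightedNorm δ (profile Q₀) ≤ ENNReal.ofReal ε)
    (h' : weightedNorm δ (profile (Q₁ - Q₀)) ≤ ENNReal.ofReal ε') : Q₁ ∈ smallData δ η := by
  refine lt_of_le_of_lt (weightedNorm_le_of_ae (ε := ε + ε') ?_)
    ((ENNReal.ofReal_lt_ofReal_iff hη).2 hle)
  filter_upwards [ae_norm_le_of_weightedNorm_le hε h, ae_norm_le_of_weightedNorm_le hε' h',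
    profile_sub Q₁ Q₀] with x h1 h2 h3
  rw [h3] at h2
  have := norm_add_le (profile Q₀ x) (profile Q₁ x - profile Q₀ x)
  rw [add_sub_cancel] at this
  linarith

theorem isWeightedOpen_smallData_diff (hδ : 0 < δ) (h : IsSmallness a b c η) :
    IsWeightedOpen δ (smallData δ η \ zeroCoefficientData δ η a b c) := by
  rintro Q ⟨hQ, hQ0⟩
  obtain ⟨R, w, hr⟩ := exists_isRepresentation hδ h hQ
  set A := massLimit (scaledReaction a b c) R w with hA
  have hA0 : A ≠ 0 := fun h0 => hQ0 ⟨hQ, (hr.isCoefficientMatrix_zero_iff hδ h).2 h0⟩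
  obtain ⟨ε, hε0, hεη, hε⟩ := exists_weightedNorm_eq hQ
  set I := ∫ x, weight (8 + δ) x with hI
  have hI0 : 0 ≤ I := integral_nonneg fun y => (weight_pos _ y).le
  have hAp : 0 < ‖A‖ := norm_pos_iff.2 hA0
  -- The first bound keeps the perturbed datum small. The second defeats a vanishing coefficient:
  -- that would force ‖A‖ ≤ (1 + 1/3) ∫ ‖R - R₁‖ ≤ (4/3) κ I < ‖A‖.
  set κ := min ((η - ε) / 2) (‖A‖ / (2 * (I + 1))) with hκ
  have hκ0 : 0 < κ := lt_min (by linarith) (by positivity)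
  have hκ1 : κ ≤ (η - ε) / 2 := min_le_left _ _
  have hκ2 : κ * (2 * (I + 1)) ≤ ‖A‖ := by
    have := min_le_right ((η - ε) / 2) (‖A‖ / (2 * (I + 1)))
    rwa [← hκ, le_div_iff₀ (by positivity)] at this
  refine ⟨κ, hκ0, fun P hP => ?_⟩
  have hPs : P ∈ smallData δ η :=
    mem_smallData_of_weightedNorm_sub h.pos hε0 hκ0.le (by linarith) hε.le hP.le
  refine ⟨hPs, fun hP0 => ?_⟩
  obtain ⟨R₁, w₁, hr₁⟩ := exists_isRepresentation hδ h hPs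
  have h0 := (hr₁.isCoefficientMatrix_zero_iff hδ h).1 hP0.2
  have hd := hr.norm_massLimit_sub_le hδ h hr₁
  rw [← hA, h0, sub_zero] at hd
  have hJ : ∫ x, ‖R x - R₁ x‖ ≤ κ * I := by
    rw [hI, ← integral_const_mul]
    refine integral_mono_of_nonneg (ae_of_all _ fun x => norm_nonneg _)
      ((integrable_weight (by linarith)).const_mul κ) ?_
    filter_upwards [ae_norm_le_of_weightedNorm_le hκ0.le hP.le, profile_sub P Q, hr.ae, hr₁.ae]
      with x a1 a2 a3 a4
    rw [← a3, ← a4, norm_sub_rev, ← a2]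
    exact a1
  have h2 := norm_integral_le_integral_norm (μ := volume) fun x => R x - R₁ x
  have h3 : ‖A‖ ≤ ‖A - ∫ x, (R x - R₁ x)‖ + ‖∫ x, (R x - R₁ x)‖ := norm_le_norm_sub_add _ _
  nlinarith

theorem exists_sym0_norm_eq_one : ∃ A : Sym0, ‖A‖ = 1 := by
  have : ∃ A : Sym0, A ≠ 0 := by
    refine ⟨Sym0.ofMat !![0, 1, 0; 1, 0, 0; 0, 0, 0] (by ext i j; fin_cases i <;> fin_cases j <;> rfl)
      (by simp [Matrix.trace, Fin.sum_univ_three]), fun h => ?_⟩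
    have h1 := congrArg (fun A : Sym0 => A.mat 0 1) h
    simp [Sym0.mat_ofMat] at h1
    simp [Sym0.mat] at h1
  obtain ⟨A, hA⟩ := this
  exact ⟨‖A‖⁻¹ • A, by rw [norm_smul, norm_inv, norm_norm, inv_mul_cancel₀ (norm_ne_zero_iff.2 hA)]⟩

theorem isWeightedDenseIn_smallData_diff (hδ : 0 < δ) (h : IsSmallness a b c η) :
    IsWeightedDenseIn δ (smallData δ η \ zeroCoefficientData δ η a b c) (smallData δ η) := by
  intro Q hQ κ hκ
  by_cases hQ0 : Q ∈ zeroCoefficientData δ η a b c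
  · obtain ⟨R, w, hr⟩ := exists_isRepresentation hδ h hQ
    have hz := (hr.isCoefficientMatrix_zero_iff hδ h).1 hQ0.2
    obtain ⟨ε, hε0, hεη, hε⟩ := exists_weightedNorm_eq hQ
    obtain ⟨B, hB⟩ := exists_sym0_norm_eq_one
    have hN : 3 < 8 + δ := by linarith
    set s := min ((η - ε) / 2) (κ / 2) with hs
    have hs0 : 0 < s := lt_min (by linarith) (by linarith)
    have hs1 : s ≤ (η - ε) / 2 := min_le_left _ _
    have hs2 : s ≤ κ / 2 := min_le_right _ _
    -- A positive scalar function times a fixed unit matrix: the norm of its integral equals its L¹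
    -- norm, so the nonlinear correction, at most a third of that, cannot cancel it.
    set f : E3 → Sym0 := fun x => (s * weight (8 + δ) x) • B with hf
    have hfs : StronglyMeasurable f :=
      ((continuous_const.mul (continuous_weight _)).smul continuous_const).stronglyMeasurable
    have hfn : ∀ x, ‖f x‖ = s * weight (8 + δ) x := fun x => by
      rw [hf, norm_smul, hB, mul_one, Real.norm_of_nonneg (mul_pos hs0 (weight_pos _ x)).le]
    have hfle : ∀ x, ‖f x‖ ≤ s * weight (8 + δ) x := fun x => (hfn x).le
    set p := phaseOf f (memLp_of_le_weight hN hfs hfle (by norm_num) (by norm_num))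
      (memLp_of_le_weight hN hfs hfle (by norm_num) (by norm_num)) with hp
    have hpf : profile p =ᵐ[volume] f := profile_phaseOf _ _
    have hPQ : Q + p - Q = p := by abel
    have hwn : weightedNorm δ (profile (Q + p - Q)) ≤ ENNReal.ofReal s := by
      rw [hPQ]
      refine weightedNorm_le_of_ae (hpf.mono fun x hx => ?_)
      rw [hx]
      exact hfle x
    have hPs : Q + p ∈ smallData δ η :=
      mem_smallData_of_weightedNorm_sub h.pos hε0 hs0.le (by linarith) hε.le hwn
    refine ⟨Q + p, ⟨hPs, fun hP0 => ?_⟩, hwn.trans_lt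
      ((ENNReal.ofReal_lt_ofReal_iff hκ).2 (by linarith))⟩
    obtain ⟨R₁, w₁, hr₁⟩ := exists_isRepresentation hδ h hPs
    have hz₁ := (hr₁.isCoefficientMatrix_zero_iff hδ h).1 hP0.2
    have hd := hr₁.norm_massLimit_sub_le hδ h hr
    rw [hz, hz₁, sub_zero, zero_sub, norm_neg] at hd
    have hae : (fun x => R₁ x - R x) =ᵐ[volume] f := by
      filter_upwards [hpf, profile_sub (Q + p) Q, hr.ae, hr₁.ae] with x a1 a2 a3 a4
      rw [← a3, ← a4, ← a2, hPQ, a1]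
    have hae' : (fun x => ‖R₁ x - R x‖) =ᵐ[volume] fun x => ‖f x‖ := hae.fun_comp fun v => ‖v‖
    rw [integral_congr_ae hae, integral_congr_ae hae'] at hd
    simp only [hfn] at hd
    simp only [hf] at hd
    rw [integral_smul_const, norm_smul, hB, mul_one, integral_const_mul] at hd
    have hI : 0 < ∫ x, weight (8 + δ) x := by
      refine (integral_pos_iff_support_of_nonneg (fun x => (weight_pos _ x).le)
        (integrable_weight hN)).2 ?_
      have : Function.support (weight (8 + δ)) = univ :=
        eq_univ_of_forall fun x => (weight_pos _ x).ne'
      rw [this]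
      simp
    have h3 := mul_pos hs0 hI
    rw [Real.norm_of_nonneg h3.le] at hd
    linarith
  · refine ⟨Q, ⟨hQ, hQ0⟩, ?_⟩
    have : weightedNorm δ (profile (Q - Q)) ≤ ENNReal.ofReal 0 := by
      refine weightedNorm_le_of_ae ((profile_sub Q Q).mono fun x hx => ?_)
      have e : profile (Q - Q) x = profile Q x - profile Q x := hx
      rw [e, sub_self, norm_zero, zero_mul]
    exact this.trans_lt ((ENNReal.ofReal_lt_ofReal_iff hκ).2 hκ)

end

end QTensor
end

/-! ### Expansion of the two-point function and continuity of the solution operator -/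

noncomputable section

set_option linter.unusedSectionVars false
set_option maxSynthPendingDepth 3

namespace QTensor

theorem twoPoint_eq_inner (r : E3) (Q : H) :
    twoPoint r Q = inner ℝ (translate r Q.1.1) Q.1.1 := by
  rw [L2.inner_def, twoPoint]
  refine integral_congr_ae ((coeFn_translate r Q.1.1).mono fun x hx => ?_)
  simp only [hx, Sym0.trace_mul]
  rfl

theorem onePoint_eq_norm_sq (Q : H) : onePoint Q = ‖Q.1.1‖ ^ 2 := by
  rw [norm_sq_eq_integral, onePoint]
  simp only [Sym0.trace_sq]
  rfl

theorem onePoint_eq_twoPoint (Q : H) : onePoint Q = twoPoint 0 Q := by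
  rw [onePoint_eq_norm_sq, twoPoint_eq_inner, translate_zero, real_inner_self_eq_norm_sq]

theorem continuous_twoPoint (r : E3) : Continuous (twoPoint r) := by
  have h : Continuous fun Q : H => Q.1.1 := continuous_fst.comp continuous_subtype_val
  have : twoPoint r = fun Q => inner ℝ (translate r Q.1.1) Q.1.1 := funext (twoPoint_eq_inner r)
  rw [this]
  exact ((translate r).continuous.comp h).inner h

theorem abs_twoPoint_le (r : E3) (Q : H) : |twoPoint r Q| ≤ ‖Q.1.1‖ ^ 2 := by
  rw [twoPoint_eq_inner]
  refine (abs_real_inner_le_norm _ _).trans_eq ?_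
  rw [(translate r).norm_map, sq]

theorem abs_inner_translate_sub_le (r : E3) (k v : Lp Sym0 2 (volume : Measure E3)) :
    |inner ℝ (translate r (k + v)) (k + v) - inner ℝ (translate r k) k| ≤
      ‖v‖ * (2 * ‖k‖ + ‖v‖) := by
  have e : inner ℝ (translate r (k + v)) (k + v) - inner ℝ (translate r k) k =
      inner ℝ (translate r k) v + inner ℝ (translate r v) (k + v) := by
    rw [map_add, inner_add_left, inner_add_right (translate r k)]
    ring
  rw [e]
  have h1 := abs_real_inner_le_norm (translate r k) v
  have h2 := abs_real_inner_le_norm (translate r v) (k + v)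
  rw [(translate r).norm_map] at h1 h2
  have h3 := norm_add_le k v
  calc _ ≤ ‖k‖ * ‖v‖ + ‖v‖ * ‖k + v‖ := (abs_add_le _ _).trans (add_le_add h1 h2)
    _ ≤ ‖k‖ * ‖v‖ + ‖v‖ * (‖k‖ + ‖v‖) := by gcongr
    _ = _ := by ring

theorem heatKernel_le_zero (t : ℝ) (x : E3) (ht : 0 < t) : heatKernel t x ≤ heatKernel t 0 := by
  unfold heatKernel
  gcongr
  simp

theorem integrable_heatKernel_mul {t : ℝ} (ht : 0 < t) (r : E3) :
    Integrable fun x => heatKernel t (x + r) * heatKernel t x := by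
  have hc : Continuous fun x => heatKernel t (x + r) :=
    (continuous_heatKernel t).comp (continuous_id.add continuous_const)
  refine (integrable_heatKernel ht).bdd_mul hc.aestronglyMeasurable (c := heatKernel t 0)
    (ae_of_all _ fun x => ?_)
  rw [Real.norm_of_nonneg (heatKernel_pos ht _).le]
  exact heatKernel_le_zero t _ ht

/-- Evenness turns the correlation integral into a convolution, and the semigroup law doubles the
time; this is the origin of 8t in the limiting Gaussian. -/
theorem integral_heatKernel_mul {t : ℝ} (ht : 0 < t) (r : E3) :
    ∫ x, heatKernel t (x + r) * heatKernel t x = heatKernel (2 * t) r := by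
  have h1 := heat_heatKernel ht ht (-r)
  rw [heat_eq_integral' ht, heatKernel_neg, ← two_mul] at h1
  rw [← h1]
  refine integral_congr_ae (ae_of_all _ fun x => ?_)
  simp only [smul_eq_mul]
  rw [← heatKernel_neg t (-r - x)]
  congr 2
  abel

theorem memLp_heatKernel_smul {t : ℝ} (ht : 0 < t) (A : Sym0) :
    MemLp (fun x => heatKernel t x • A) 2 (volume : Measure E3) := by
  have hc : Continuous fun x => heatKernel t x • A := (continuous_heatKernel t).smul continuous_const
  refine (memLp_two_iff_integrable_sq_norm hc.aestronglyMeasurable).2 ?_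
  have := (integrable_heatKernel_mul ht 0).mul_const (‖A‖ ^ 2)
  refine this.congr (ae_of_all _ fun x => ?_)
  simp only [add_zero, norm_smul, mul_pow, Real.norm_eq_abs, sq_abs]
  ring

theorem inner_translate_heatKernel {t : ℝ} (ht : 0 < t) (A : Sym0) (r : E3) :
    inner ℝ (translate r (memLp_heatKernel_smul ht A).toLp) ((memLp_heatKernel_smul ht A).toLp) =
      ‖A‖ ^ 2 * heatKernel (2 * t) r := by
  rw [L2.inner_def, ← integral_heatKernel_mul ht, ← integral_const_mul]
  have h0 := (memLp_heatKernel_smul ht A).coeFn_toLp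
  have h1 := (measurePreserving_add_right (volume : Measure E3) r).quasiMeasurePreserving.ae_eq_comp
    h0
  refine integral_congr_ae ?_
  filter_upwards [coeFn_translate r (memLp_heatKernel_smul ht A).toLp, h0, h1] with x a1 a2 a3
  simp only [Function.comp_apply] at a3
  rw [a1, a2, a3, real_inner_smul_left, real_inner_smul_right, real_inner_self_eq_norm_sq]
  ring

theorem norm_sq_toLp_heatKernel {t : ℝ} (ht : 0 < t) (A : Sym0) :
    ‖(memLp_heatKernel_smul ht A).toLp‖ ^ 2 = ‖A‖ ^ 2 * heatKernel (2 * t) 0 := by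
  rw [← inner_translate_heatKernel ht, translate_zero, real_inner_self_eq_norm_sq]

theorem decay_sq_eq (p : ℝ) {t : ℝ} (ht : 0 < t) (x : E3) :
    decay p t x ^ 2 = ((t + 1) ^ 4)⁻¹ * weight (2 * p) ((√(t + 1))⁻¹ • x) := by
  have hs : 0 < √(t + 1) := Real.sqrt_pos.2 (by linarith)
  rw [decay, weight, norm_smul, norm_inv, Real.norm_of_nonneg hs.le, inv_mul_eq_div (√(t + 1)),
    mul_pow, ← Real.rpow_natCast ((1 + ‖x‖ / √(t + 1)) ^ (-p)) 2, ← Real.rpow_mul (by positivity)]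
  congr 1
  · rw [inv_pow]
    ring
  · congr 1
    push_cast
    ring

theorem integrable_decay_sq {p : ℝ} (hp : 3 < 2 * p) {t : ℝ} (ht : 0 < t) :
    Integrable fun x => decay p t x ^ 2 := by
  have hs : 0 < √(t + 1) := Real.sqrt_pos.2 (by linarith)
  simp only [decay_sq_eq p ht]
  exact ((integrable_weight hp).comp_smul (inv_ne_zero hs.ne')).const_mul _

/-- Scaling: (t+1)^(-4) from the square and (t+1)^(3/2) from the change of variables. The remainder
therefore has L² size (t+1)^(-5/4). -/
theorem integral_decay_sq {p : ℝ} {t : ℝ} (ht : 0 < t) :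
    ∫ x, decay p t x ^ 2 = (∫ x, weight (2 * p) x) * (t + 1) ^ (-(5 / 2) : ℝ) := by
  have ht1 : 0 < t + 1 := by linarith
  have hs : 0 < √(t + 1) := Real.sqrt_pos.2 ht1
  simp only [decay_sq_eq p ht]
  rw [integral_const_mul, Measure.integral_comp_inv_smul]
  simp only [finrank_euclideanSpace, Fintype.card_fin, smul_eq_mul]
  rw [abs_of_pos (by positivity), Real.sqrt_eq_rpow, ← Real.rpow_natCast, ← Real.rpow_natCast,
    ← Real.rpow_mul ht1.le, ← Real.rpow_neg ht1.le, ← mul_assoc, ← Real.rpow_add ht1, mul_comm]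
  norm_num

theorem heatKernel_zero_eq {t : ℝ} (ht : 0 < t) :
    heatKernel t 0 = t ^ (-(3 / 2) : ℝ) * (4 * Real.pi) ^ (-(3 / 2) : ℝ) := by
  rw [heatKernel, norm_zero, ← Real.mul_rpow ht.le (by positivity),
    Real.rpow_neg (by positivity), mul_comm t]
  simp

theorem heatKernel_eq_exp_mul {t : ℝ} (x : E3) :
    heatKernel t x = Real.exp (-‖x‖ ^ 2 / (4 * t)) * heatKernel t 0 := by
  simp [heatKernel, div_eq_mul_inv]

section

variable {a b c δ η : ℝ}

/-- Expansion of the two-point function, uniform over the small data. -/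
theorem exists_twoPoint_expansion (hδ : 0 < δ) (h : IsSmallness a b c η) : ∃ C B : ℝ, 0 ≤ C ∧
    ∀ Q ∈ smallData δ η, ∃ A : Sym0, (A = 0 → Q ∈ zeroCoefficientData δ η a b c) ∧ ‖A‖ ≤ B ∧
      ∀ t, 0 < t → ∀ r, |Real.exp (2 * a * t) * twoPoint r (solutionMap a b c t Q) -
        ‖A‖ ^ 2 * heatKernel (2 * (t + 1)) r| ≤ C * (t + 1) ^ (-2 : ℝ) := by
  obtain ⟨M, hM0, hM⟩ := exists_uniform_decay hδ h
  set p := 4 + δ / 2 with hp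
  have hN : 3 < 8 + δ := by linarith
  have hp3 : 3 < 2 * p := by rw [hp]; linarith
  set I := ∫ x, weight (2 * p) x
  have hI0 : 0 ≤ I := integral_nonneg fun y => (weight_pos _ y).le
  set κ := (2 : ℝ) ^ (-(3 / 2) : ℝ) * (4 * Real.pi) ^ (-(3 / 2) : ℝ)
  have hκ0 : 0 < κ := by positivity
  -- A uniform bound for the coefficient matrix, read off the expansion at t = 1, x = 0, where |w| ≤
  -- 1.
  set B := (1 + M * decay p 1 0) / heatKernel 2 0
  have hK2 := heatKernel_pos two_pos (0 : E3)
  refine ⟨M * √I * (2 * (B * √κ) + M * √I), B, ?_, fun Q hQ => ?_⟩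
  · have := decay_nonneg p 1 0
    positivity
  obtain ⟨R, w, hr⟩ := exists_isRepresentation hδ h hQ
  set A := massLimit (scaledReaction a b c) R w
  have hAB : ‖A‖ ≤ B := by
    rw [le_div_iff₀ hK2]
    have h1 := hM Q R w hr 1 one_pos 0
    rw [one_add_one_eq_two] at h1
    have h2 := hr.norm_le_one hN h one_pos 0
    have h3 := norm_sub_norm_le (heatKernel 2 0 • A) (w 1 0)
    rw [norm_sub_rev, norm_smul, Real.norm_of_nonneg hK2.le] at h3
    linarith
  refine ⟨A, fun h0 => ⟨hQ, (hr.isCoefficientMatrix_zero_iff hδ h).2 h0⟩, hAB, fun t ht r => ?_⟩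
  have ht1 : 0 < t + 1 := by linarith
  set f := (solutionMap a b c t Q).1.1
  have hf : f =ᵐ[volume] fun x => Real.exp (-a * t) • w t x := hr.profile_solutionMap hN h ht
  set k := (memLp_heatKernel_smul ht1 A).toLp
  have hk : k =ᵐ[volume] fun x => heatKernel (t + 1) x • A := (memLp_heatKernel_smul ht1 A).coeFn_toLp
  -- The L² class of the remainder of w; k is the class of the leading term.
  set v := Real.exp (a * t) • f - k
  have hexp : Real.exp (a * t) * Real.exp (-a * t) = 1 := by
    rw [← Real.exp_add]
    simp
  have hv : v =ᵐ[volume] fun x => w t x - heatKernel (t + 1) x • A := by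
    filter_upwards [Lp.coeFn_sub (Real.exp (a * t) • f) k, Lp.coeFn_smul (Real.exp (a * t)) f, hf,
      hk] with x a1 a2 a3 a4
    rw [a1, Pi.sub_apply, a2, Pi.smul_apply, a3, a4, smul_smul, hexp, one_smul]
  have hvn : ‖v‖ ≤ M * √I * (t + 1) ^ (-(5 / 4) : ℝ) := by
    refine abs_le_of_sq_le_sq' ?_ (by positivity) |>.2
    rw [norm_sq_eq_integral, mul_pow, mul_pow, Real.sq_sqrt hI0, ← Real.rpow_natCast _ 2,
      ← Real.rpow_natCast ((t + 1) ^ _) 2, ← Real.rpow_mul ht1.le]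
    have e : ((-(5 / 4) : ℝ) * ((2 : ℕ) : ℝ)) = -(5 / 2) := by norm_num
    rw [e, mul_assoc, ← integral_decay_sq ht, ← integral_const_mul, Real.rpow_natCast]
    refine integral_mono_of_nonneg (ae_of_all _ fun x => by positivity)
      ((integrable_decay_sq hp3 ht).const_mul _) (hv.mono fun x hx => ?_)
    simp only [hx]
    rw [← mul_pow]
    gcongr
    exact hM Q R w hr t ht x
  have hkn : ‖k‖ ≤ B * √κ * (t + 1) ^ (-(3 / 4) : ℝ) := by
    refine abs_le_of_sq_le_sq' ?_ (by have := (norm_nonneg A).trans hAB; positivity) |>.2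
    rw [norm_sq_toLp_heatKernel ht1, heatKernel_zero_eq (by positivity),
      Real.mul_rpow (by norm_num) ht1.le, mul_pow, mul_pow, Real.sq_sqrt hκ0.le,
      ← Real.rpow_natCast ((t + 1) ^ _) 2, ← Real.rpow_mul ht1.le]
    have e : ((-(3 / 4) : ℝ) * ((2 : ℕ) : ℝ)) = -(3 / 2) := by norm_num
    rw [e]
    calc _ = ‖A‖ ^ 2 * κ * (t + 1) ^ (-(3 / 2) : ℝ) := by ring
      _ ≤ _ := by gcongr
  have hmain := abs_inner_translate_sub_le r k v
  have hsum : k + v = Real.exp (a * t) • f := add_sub_cancel _ _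
  rw [hsum, inner_translate_heatKernel ht1, map_smul, real_inner_smul_left, real_inner_smul_right,
    ← mul_assoc, ← Real.exp_add] at hmain
  rw [twoPoint_eq_inner, show 2 * a * t = a * t + a * t by ring]
  refine hmain.trans ?_
  -- The cross terms have size (t+1)^(-5/4-3/4) = (t+1)^(-2); the term quadratic in v is smaller and
  -- is weakened to the same rate.
  have h54 : (t + 1) ^ (-(5 / 4) : ℝ) ≤ (t + 1) ^ (-(3 / 4) : ℝ) :=
    Real.rpow_le_rpow_of_exponent_le (by linarith) (by norm_num)
  have e2 : (t + 1) ^ (-(5 / 4) : ℝ) * (t + 1) ^ (-(3 / 4) : ℝ) = (t + 1) ^ (-2 : ℝ) := by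
    rw [← Real.rpow_add ht1]; norm_num
  calc _ ≤ (M * √I * (t + 1) ^ (-(5 / 4) : ℝ)) * (2 * (B * √κ * (t + 1) ^ (-(3 / 4) : ℝ)) +
        M * √I * (t + 1) ^ (-(3 / 4) : ℝ)) := by
        gcongr
        exact hvn.trans (by gcongr)
    _ = M * √I * (2 * (B * √κ) + M * √I) *
        ((t + 1) ^ (-(5 / 4) : ℝ) * (t + 1) ^ (-(3 / 4) : ℝ)) := by ring
    _ = _ := by rw [e2]

/-- The solution operator is Lipschitz on the small data for the `L²` norm. -/
theorem norm_solutionMap_sub_le (hδ : 0 < δ) (h : IsSmallness a b c η) {Q Q' : H}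
    (hQ : Q ∈ smallData δ η) (hQ' : Q' ∈ smallData δ η) {t : ℝ} (ht : 0 < t) :
    ‖(solutionMap a b c t Q - solutionMap a b c t Q').1.1‖ ^ 2 ≤
      (4 / 3) ^ 2 * ‖(Q - Q').1.1‖ ^ 2 := by
  have hN : 3 < 8 + δ := by linarith
  obtain ⟨R, w, hr⟩ := exists_isRepresentation hδ h hQ
  obtain ⟨R', w', hr'⟩ := exists_isRepresentation hδ h hQ'
  have e1 : profile (solutionMap a b c t Q - solutionMap a b c t Q') =ᵐ[volume]
      fun x => Real.exp (-a * t) • (w t x - w' t x) := by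
    filter_upwards [profile_sub (solutionMap a b c t Q) (solutionMap a b c t Q'),
      hr.profile_solutionMap hN h ht, hr'.profile_solutionMap hN h ht] with x a1 a2 a3
    rw [a1, a2, a3, smul_sub]
  have e2 : profile (Q - Q') =ᵐ[volume] fun x => R x - R' x := by
    filter_upwards [profile_sub Q Q', hr.ae, hr'.ae] with x a1 a2 a3
    rw [a1, a2, a3]
  have hg : ∀ x, ‖R x - R' x‖ ≤ (η + η) * weight (8 + δ) x := fun x => by
    rw [add_mul]; exact norm_sub_le_of_le (hr.le x) (hr'.le x)
  have hgs : StronglyMeasurable fun x => ‖R x - R' x‖ := (hr.sm.sub hr'.sm).norm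
  have hgb : IsBddMeas fun x => ‖R x - R' x‖ :=
    isBddMeas_of_le_weight (N := 8 + δ) (by linarith) hgs fun x => by rw [norm_norm]; exact hg x
  have hgi : Integrable fun x => ‖R x - R' x‖ ^ 2 :=
    integrable_norm_sq_of_le_weight hN (hr.sm.sub hr'.sm) hg
  have hgi' : Integrable fun x => heat t (fun y => ‖R y - R' y‖) x ^ 2 := by
    refine (integrable_heat hgi (hgs.pow 2) t).mono'
      ((stronglyMeasurable_heat hgs t).pow 2).aestronglyMeasurable (ae_of_all _ fun x => ?_)
    rw [Real.norm_of_nonneg (by positivity)]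
    exact sq_heat_le hgb t x
  rw [norm_fst_sq_eq e1, norm_fst_sq_eq e2]
  calc _ ≤ ∫ x, (4 / 3) ^ 2 * heat t (fun y => ‖R y - R' y‖) x ^ 2 := by
        refine integral_mono_of_nonneg (ae_of_all _ fun x => by positivity) (hgi'.const_mul _)
          (ae_of_all _ fun x => ?_)
        simp only
        rw [← mul_pow]
        gcongr
        rw [norm_smul, Real.norm_of_nonneg (Real.exp_pos _).le]
        refine (mul_le_of_le_one_left (norm_nonneg _) (IsRepresentation.exp_le_one h ht.le)).trans ?_
        exact norm_sub_le_heat h.pos.le h.le_one h.contr (isWeight_weight (by linarith)) h.decaying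
          (hr.isBddMeas hN) (hr'.isBddMeas hN) hr.dom hr'.dom hr.eq hr'.eq ht x
    _ = (4 / 3) ^ 2 * ∫ x, heat t (fun y => ‖R y - R' y‖) x ^ 2 := integral_const_mul _ _
    _ ≤ _ := by
        exact mul_le_mul_of_nonneg_left (integral_sq_heat_le hgb hgi t) (by positivity)

theorem continuousOn_solutionMap (hδ : 0 < δ) (h : IsSmallness a b c η) {t : ℝ} (ht : 0 ≤ t) :
    ContinuousOn (solutionMap a b c t) (smallData δ η) := by
  have hN : 3 < 8 + δ := by linarith
  rcases eq_or_lt_of_le ht with rfl | ht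
  · refine continuousOn_id.congr fun Q hQ => ?_
    obtain ⟨R, w, hr⟩ := exists_isRepresentation hδ h hQ
    exact hr.solutionMap_zero hN h
  · intro Q hQ
    have hb : ∀ Q ∈ smallData δ η, ∀ᵐ x, ‖profile (solutionMap a b c t Q) x‖ ≤ 1 := fun Q hQ => by
      obtain ⟨R, w, hr⟩ := exists_isRepresentation hδ h hQ
      filter_upwards [hr.profile_solutionMap hN h ht] with x hx
      rw [hx]
      exact hr.norm_solution_le_one hN h ht x
    refine tendsto_phase (eventually_mem_nhdsWithin.mono fun Q' hQ' => hb Q' hQ') (hb Q hQ) ?_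
    have hc : Continuous fun Q' : H => (4 / 3 : ℝ) ^ 2 * ‖(Q' - Q).1.1‖ ^ 2 := by fun_prop
    have hlim := (hc.tendsto Q).mono_left (nhdsWithin_le_nhds (s := smallData δ η))
    have e0 : (4 / 3 : ℝ) ^ 2 * ‖(Q - Q).1.1‖ ^ 2 = 0 := by
      rw [sub_self]
      simp
    rw [e0] at hlim
    refine squeeze_zero' (Eventually.of_forall fun _ => by positivity)
      (eventually_mem_nhdsWithin.mono fun Q' hQ' => ?_) hlim
    exact norm_solutionMap_sub_le hδ h hQ' hQ ht

theorem exists_norm_solutionMap_le (hδ : 0 < δ) (h : IsSmallness a b c η) {t : ℝ} (ht : 0 ≤ t) :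
    ∃ B, ∀ Q ∈ smallData δ η, ‖(solutionMap a b c t Q).1.1‖ ^ 2 ≤ B := by
  have hN : 3 < 8 + δ := by linarith
  have hG := gaussMoment_nonneg (8 + δ)
  set D := max η (gaussMoment (8 + δ) * (1 + √t) ^ (8 + δ))
  have hi : Integrable fun x => ‖D * weight (8 + δ) x‖ ^ 2 :=
    integrable_norm_sq_of_le_weight hN ((continuous_weight _).stronglyMeasurable.const_mul D)
      (k := |D|) fun x => by rw [norm_mul, Real.norm_of_nonneg (weight_pos _ x).le]; rfl
  have key : ∀ (Q : H) (f : E3 → Sym0), profile Q =ᵐ[volume] f →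
      (∀ x, ‖f x‖ ≤ D * weight (8 + δ) x) →
      ‖Q.1.1‖ ^ 2 ≤ ∫ x, ‖D * weight (8 + δ) x‖ ^ 2 := fun Q f hf hD => by
    rw [norm_fst_sq_eq hf]
    refine integral_mono_of_nonneg (ae_of_all _ fun x => by positivity) hi
      (ae_of_all _ fun x => ?_)
    simp only
    gcongr
    exact (hD x).trans (Real.le_norm_self _)
  refine ⟨∫ x, ‖D * weight (8 + δ) x‖ ^ 2, fun Q hQ => ?_⟩
  obtain ⟨R, w, hr⟩ := exists_isRepresentation hδ h hQ
  rcases eq_or_lt_of_le ht with rfl | ht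
  · rw [hr.solutionMap_zero hN h]
    refine key Q R hr.ae fun x => (hr.le x).trans ?_
    have := weight_pos (8 + δ) x
    gcongr
    exact le_max_left _ _
  · refine key _ _ (hr.profile_solutionMap hN h ht) fun x => (hr.norm_solution_le hN h ht x).trans ?_
    have := weight_pos (8 + δ) x
    gcongr
    exact le_max_right _ _

end

end QTensor
end

/-! ### Statistical solutions and the averaged correlation function -/

noncomputable section

set_option linter.unusedSectionVars false
set_option maxSynthPendingDepth 3

namespace QTensor

section

variable {a b c δ η : ℝ}

/-- The solution operator is continuous on the small data, hence on a measurable subset of full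
measure; measurability of the set of small data itself is not required. -/
theorem aemeasurable_solutionMap (hδ : 0 < δ) (h : IsSmallness a b c η) {μ : Measure H}
    (hμ : ∀ᵐ Q ∂μ, Q ∈ smallData δ η) {t : ℝ} (ht : 0 ≤ t) :
    AEMeasurable (solutionMap a b c t) μ := by
  obtain ⟨s, hs0, hsm, hs⟩ := hμ.exists_measurable_mem
  have h1 := ((continuousOn_solutionMap hδ h ht).mono hs).aemeasurable hsm (μ := μ)
  rwa [Measure.restrict_eq_self_of_ae_mem] at h1
  exact hs0

theorem integrable_twoPoint_solutionMap (hδ : 0 < δ) (h : IsSmallness a b c η) {μ : Measure H}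
    [IsFiniteMeasure μ] (hμ : ∀ᵐ Q ∂μ, Q ∈ smallData δ η) {t : ℝ} (ht : 0 ≤ t) (r : E3) :
    Integrable (fun Q => twoPoint r (solutionMap a b c t Q)) μ := by
  obtain ⟨B, hB⟩ := exists_norm_solutionMap_le hδ h ht
  have hm := aemeasurable_solutionMap hδ h hμ ht
  refine Integrable.of_bound
    ((continuous_twoPoint r).measurable.comp_aemeasurable hm).aestronglyMeasurable B ?_
  filter_upwards [hμ] with Q hQ
  exact (abs_twoPoint_le r _).trans (hB Q hQ)

theorem integrable_twoPoint_statSolution (hδ : 0 < δ) (h : IsSmallness a b c η) {μ : Measure H}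
    [IsFiniteMeasure μ] (hμ : ∀ᵐ Q ∂μ, Q ∈ smallData δ η) {t : ℝ} (ht : 0 ≤ t) (r : E3) :
    Integrable (twoPoint r) (statSolution a b c μ t) :=
  (integrable_map_measure (continuous_twoPoint r).aestronglyMeasurable
    (aemeasurable_solutionMap hδ h hμ ht)).2 (integrable_twoPoint_solutionMap hδ h hμ ht r)

theorem integral_twoPoint_statSolution (hδ : 0 < δ) (h : IsSmallness a b c η) {μ : Measure H}
    (hμ : ∀ᵐ Q ∂μ, Q ∈ smallData δ η) {t : ℝ} (ht : 0 ≤ t) (r : E3) :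
    ∫ Q, twoPoint r Q ∂(statSolution a b c μ t) = ∫ Q, twoPoint r (solutionMap a b c t Q) ∂μ :=
  integral_map (aemeasurable_solutionMap hδ h hμ ht) (continuous_twoPoint r).aestronglyMeasurable

theorem onePoint_eq : onePoint = twoPoint 0 := funext onePoint_eq_twoPoint

end

/-- With y = u/(t+1) the difference is e^(-y)(1 - e^(-y/t)) ≤ y e^(-y)/t, and y e^(-y) ≤ 1; hence
the bound is uniform in u, that is, in r. -/
theorem abs_exp_neg_div_sub_le {u t : ℝ} (hu : 0 ≤ u) (ht : 0 < t) :
    |Real.exp (-u / (t + 1)) - Real.exp (-u / t)| ≤ t⁻¹ := by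
  have ht1 : 0 < t + 1 := by linarith
  have hle : -u / t ≤ -u / (t + 1) := by
    rw [neg_div, neg_div]
    gcongr
    linarith
  rw [abs_of_nonneg (sub_nonneg.2 (Real.exp_le_exp.2 hle))]
  set y := u / (t + 1) with hy
  have hy0 : 0 ≤ y := by positivity
  have e1 : -u / (t + 1) = -y := neg_div _ _
  have e2 : -u / t = -y + -(y / t) := by
    rw [hy]; field_simp; ring
  rw [e1, e2, Real.exp_add]
  have h1 : 1 - y / t ≤ Real.exp (-(y / t)) := by linarith [Real.add_one_le_exp (-(y / t))]
  have h2 : Real.exp (-y) * y ≤ 1 := by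
    rw [Real.exp_neg, inv_mul_le_iff₀ (Real.exp_pos y)]
    linarith [Real.add_one_le_exp y]
  calc _ = Real.exp (-y) * (1 - Real.exp (-(y / t))) := by ring
    _ ≤ Real.exp (-y) * (y / t) := by gcongr; linarith
    _ = Real.exp (-y) * y * t⁻¹ := by ring
    _ ≤ 1 * t⁻¹ := by gcongr
    _ = _ := one_mul _

section

variable {a b c δ η : ℝ}

/-- The normalized one-point function. -/
def scaledOnePoint (a b c t : ℝ) (r : E3) (Q : H) : ℝ :=
  Real.exp (2 * a * t) * twoPoint r (solutionMap a b c t Q) / heatKernel (2 * (t + 1)) 0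

/-- Here α = |A|². Dividing by the kernel at 0, of order (t+1)^(-3/2), turns the error (t+1)^(-2)
into (t+1)^(-1/2). -/
theorem exists_scaled_expansion (hδ : 0 < δ) (h : IsSmallness a b c η) : ∃ C B : ℝ, 0 ≤ C ∧
    ∀ Q ∈ smallData δ η, ∃ α : ℝ, 0 ≤ α ∧ (α = 0 → Q ∈ zeroCoefficientData δ η a b c) ∧ α ≤ B ∧
      ∀ t, 0 < t → ∀ r, |scaledOnePoint a b c t r Q -
        Real.exp (-‖r‖ ^ 2 / (8 * (t + 1))) * α| ≤ C * (t + 1) ^ (-(1 / 2) : ℝ) := by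
  obtain ⟨C, B, hC0, hC⟩ := exists_twoPoint_expansion hδ h
  set κ := (2 : ℝ) ^ (-(3 / 2) : ℝ) * (4 * Real.pi) ^ (-(3 / 2) : ℝ) with hκ
  have hκ0 : 0 < κ := by positivity
  refine ⟨C / κ, B ^ 2, by positivity, fun Q hQ => ?_⟩
  obtain ⟨A, hA0, hAB, hA⟩ := hC Q hQ
  refine ⟨‖A‖ ^ 2, by positivity, fun h0 => hA0 (by simpa using h0), by gcongr, fun t ht r => ?_⟩
  have ht1 : 0 < t + 1 := by linarith
  have h1 := hA t ht r
  have hK : heatKernel (2 * (t + 1)) 0 = κ * (t + 1) ^ (-(3 / 2) : ℝ) := by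
    rw [heatKernel_zero_eq (by positivity), Real.mul_rpow (by norm_num) ht1.le, hκ]
    ring
  have hK0 := heatKernel_pos (by positivity : 0 < 2 * (t + 1)) (0 : E3)
  rw [heatKernel_eq_exp_mul, show 4 * (2 * (t + 1)) = 8 * (t + 1) by ring] at h1
  have e : scaledOnePoint a b c t r Q - Real.exp (-‖r‖ ^ 2 / (8 * (t + 1))) * ‖A‖ ^ 2 =
      (Real.exp (2 * a * t) * twoPoint r (solutionMap a b c t Q) - ‖A‖ ^ 2 *
        (Real.exp (-‖r‖ ^ 2 / (8 * (t + 1))) * heatKernel (2 * (t + 1)) 0)) /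
          heatKernel (2 * (t + 1)) 0 := by
    rw [scaledOnePoint]
    field_simp
  rw [e, abs_div, abs_of_pos hK0, div_le_iff₀ hK0]
  refine h1.trans_eq ?_
  have e2 : (t + 1) ^ (-(1 / 2) : ℝ) * (t + 1) ^ (-(3 / 2) : ℝ) = (t + 1) ^ (-2 : ℝ) := by
    rw [← Real.rpow_add ht1]; norm_num
  rw [hK, ← e2]
  field_simp

theorem integral_scaledOnePoint (μ : Measure H) (t : ℝ) (r : E3) :
    ∫ Q, scaledOnePoint a b c t r Q ∂μ = Real.exp (2 * a * t) / heatKernel (2 * (t + 1)) 0 *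
      ∫ Q, twoPoint r (solutionMap a b c t Q) ∂μ := by
  rw [← integral_const_mul]
  congr 1
  ext Q
  rw [scaledOnePoint]
  ring

theorem exists_correlation_bound (hδ : 0 < δ) (h : IsSmallness a b c η) {μ : Measure H}
    [IsProbabilityMeasure μ]
    (hμ : ∀ᵐ Q ∂μ, Q ∈ smallData δ η \ zeroCoefficientData δ η a b c) :
    ∃ C T : ℝ, 0 < C ∧ 0 < T ∧ ∀ t : ℝ, T ≤ t →
      0 < ∫ Q, onePoint Q ∂(statSolution a b c μ t) ∧
      eLpNorm (fun r : E3 => correlation a b c μ r t - Real.exp (-‖r‖ ^ 2 / (8 * t)))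
        ⊤ volume ≤ ENNReal.ofReal (C * t ^ (-(1 / 2) : ℝ)) := by
  have hμs : ∀ᵐ Q ∂μ, Q ∈ smallData δ η := hμ.mono fun Q hQ => hQ.1
  obtain ⟨C, B, hC0, hC⟩ := exists_scaled_expansion hδ h
  choose! α hα0 hαz hαB hα using hC
  have hint : ∀ t, 0 ≤ t → ∀ r, Integrable (scaledOnePoint a b c t r) μ := fun t ht r =>
    ((integrable_twoPoint_solutionMap hδ h hμs ht r).const_mul _).div_const _
  have hα1 : ∀ Q ∈ smallData δ η, ∀ t, 0 < t →
      |scaledOnePoint a b c t 0 Q - α Q| ≤ C * (t + 1) ^ (-(1 / 2) : ℝ) := fun Q hQ t ht => by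
    simpa using hα Q hQ t ht 0
  have hdec : Tendsto (fun t : ℝ => C * (t + 1) ^ (-(1 / 2) : ℝ)) atTop (𝓝 0) := by
    have := ((tendsto_rpow_neg_atTop (y := 1 / 2) (by norm_num)).comp
      (tendsto_atTop_add_const_right atTop (1 : ℝ) tendsto_id)).const_mul C
    simpa using this
  have hconv : ∀ᵐ Q ∂μ, Tendsto (fun t => scaledOnePoint a b c t 0 Q) atTop (𝓝 (α Q)) := by
    filter_upwards [hμs] with Q hQ
    rw [tendsto_iff_norm_sub_tendsto_zero]
    exact squeeze_zero' (Eventually.of_forall fun _ => norm_nonneg _)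
      ((eventually_gt_atTop 0).mono fun t ht => hα1 Q hQ t ht) hdec
  -- α comes from a pointwise choice, so its measurability is not given; it is recovered from the
  -- almost everywhere limit along integer times.
  have hαm : AEStronglyMeasurable α μ := by
    refine aestronglyMeasurable_of_tendsto_ae (atTop : Filter ℕ)
      (f := fun n Q => scaledOnePoint a b c (n : ℝ) 0 Q)
      (fun n => (hint n (Nat.cast_nonneg n) 0).1) ?_
    filter_upwards [hconv] with Q hQ using hQ.comp tendsto_natCast_atTop_atTop
  have hαi : Integrable α μ := Integrable.of_bound hαm B (hμs.mono fun Q hQ => by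
    rw [Real.norm_of_nonneg (hα0 Q hQ)]; exact hαB Q hQ)
  set m := ∫ Q, α Q ∂μ
  -- If α vanished almost everywhere, some datum in the carrier of μ would have α = 0, hence a zero
  -- coefficient matrix.
  have hm : 0 < m := by
    refine (integral_pos_iff_support_of_nonneg_ae (hμs.mono fun Q hQ => hα0 Q hQ) hαi).2 ?_
    refine pos_iff_ne_zero.2 fun h0 => ?_
    obtain ⟨Q, hQ, hQ0⟩ := (hμ.and (measure_eq_zero_iff_ae_notMem.1 h0)).exists
    exact hQ.2 (hαz Q hQ.1 (Function.notMem_support.1 hQ0))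
  have hlow : ∀ t, 0 < t → |(∫ Q, scaledOnePoint a b c t 0 Q ∂μ) - m| ≤
      C * (t + 1) ^ (-(1 / 2) : ℝ) := fun t ht => by
    rw [← integral_sub (hint t ht.le 0) hαi]
    have := norm_integral_le_of_norm_le_const (μ := μ) (f := fun Q => scaledOnePoint a b c t 0 Q - α Q)
      (hμs.mono fun Q hQ => hα1 Q hQ t ht)
    simpa using this
  have hcmp : ∀ t, 0 < t → ∀ r, |(∫ Q, scaledOnePoint a b c t r Q ∂μ) -
      Real.exp (-‖r‖ ^ 2 / (8 * (t + 1))) * m| ≤ C * (t + 1) ^ (-(1 / 2) : ℝ) := fun t ht r => by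
    rw [← integral_const_mul, ← integral_sub (hint t ht.le r) (hαi.const_mul _)]
    have := norm_integral_le_of_norm_le_const (μ := μ)
      (f := fun Q => scaledOnePoint a b c t r Q - Real.exp (-‖r‖ ^ 2 / (8 * (t + 1))) * α Q)
      (hμs.mono fun Q hQ => hα Q hQ t ht r)
    simpa using this
  obtain ⟨T, hT⟩ := eventually_atTop.1 ((tendsto_order.1 hdec).2 (m / 2) (by positivity))
  -- T makes the error smaller than m/2, so the normalized denominator is at least m/2. The term
  -- 4C/m comes from the quotient (error 2C over m/2), and the 1 from replacing t + 1 by t in the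
  -- Gaussian, where t ≥ 1 gives t⁻¹ ≤ t^(-1/2).
  refine ⟨4 * C / m + 1, max T 1, by positivity, by positivity, fun t htT => ?_⟩
  have ht1 : 1 ≤ t := (le_max_right _ _).trans htT
  have ht : 0 < t := by linarith
  set X := ∫ Q, scaledOnePoint a b c t 0 Q ∂μ with hX
  set ε := C * (t + 1) ^ (-(1 / 2) : ℝ)
  have hε0 : 0 ≤ ε := by positivity
  have hε : ε < m / 2 := hT t ((le_max_left _ _).trans htT)
  have hXm : m / 2 ≤ X := by
    have := (abs_le.1 (hlow t ht)).1
    linarith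
  have hfac : 0 < Real.exp (2 * a * t) / heatKernel (2 * (t + 1)) 0 :=
    div_pos (Real.exp_pos _) (heatKernel_pos (by positivity) _)
  have hXe := integral_scaledOnePoint (a := a) (b := b) (c := c) μ t 0
  rw [← hX] at hXe
  have hpos : 0 < ∫ Q, onePoint Q ∂(statSolution a b c μ t) := by
    rw [onePoint_eq, integral_twoPoint_statSolution hδ h hμs ht.le]
    by_contra! hneg
    nlinarith [mul_nonneg hfac.le (neg_nonneg.2 hneg)]
  refine ⟨hpos, ?_⟩
  rw [eLpNorm_exponent_top]
  refine eLpNormEssSup_le_of_ae_bound (ae_of_all _ fun r => ?_)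
  have hcorr : correlation a b c μ r t = (∫ Q, scaledOnePoint a b c t r Q ∂μ) / X := by
    rw [correlation, onePoint_eq, integral_twoPoint_statSolution hδ h hμs ht.le,
      integral_twoPoint_statSolution hδ h hμs ht.le, hXe, integral_scaledOnePoint,
      mul_div_mul_left _ _ hfac.ne']
  set Y := ∫ Q, scaledOnePoint a b c t r Q ∂μ
  set g := Real.exp (-‖r‖ ^ 2 / (8 * (t + 1))) with hg
  have hg1 : g ≤ 1 := Real.exp_le_one_iff.2 (div_nonpos_of_nonpos_of_nonneg
    (by simp) (by positivity))
  have hg0 : 0 < g := Real.exp_pos _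
  have hX0 : 0 < X := by linarith
  -- Both the numerator and the denominator are compared with m, which cancels from the ratio.
  have b1 : |Y - g * X| ≤ 2 * ε := by
    have h1 := hcmp t ht r
    have h2 := hlow t ht
    have e : Y - g * X = (Y - g * m) - g * (X - m) := by ring
    rw [e]
    refine (abs_sub _ _).trans ?_
    rw [abs_mul, abs_of_pos hg0]
    have : g * |X - m| ≤ 1 * ε := by gcongr
    linarith
  have b2 : |Y / X - g| ≤ 4 * C / m * t ^ (-(1 / 2) : ℝ) := by
    have e : Y / X - g = (Y - g * X) / X := by field_simp
    rw [e, abs_div, abs_of_pos hX0, div_le_iff₀ hX0]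
    have h1 : (t + 1) ^ (-(1 / 2) : ℝ) ≤ t ^ (-(1 / 2) : ℝ) :=
      Real.rpow_le_rpow_of_nonpos ht (by linarith) (by norm_num)
    have h2 : ε ≤ C * t ^ (-(1 / 2) : ℝ) := mul_le_mul_of_nonneg_left h1 hC0
    calc _ ≤ 2 * (C * t ^ (-(1 / 2) : ℝ)) := b1.trans (by gcongr)
      _ = 4 * C / m * t ^ (-(1 / 2) : ℝ) * (m / 2) := by field_simp; ring
      _ ≤ _ := by gcongr
  have b3 : |g - Real.exp (-‖r‖ ^ 2 / (8 * t))| ≤ t ^ (-(1 / 2) : ℝ) := by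
    have h1 := abs_exp_neg_div_sub_le (u := ‖r‖ ^ 2 / 8) (by positivity) ht
    have e1 : -(‖r‖ ^ 2 / 8) / (t + 1) = -‖r‖ ^ 2 / (8 * (t + 1)) := by field_simp
    have e2 : -(‖r‖ ^ 2 / 8) / t = -‖r‖ ^ 2 / (8 * t) := by field_simp
    rw [e1, e2] at h1
    refine h1.trans ?_
    rw [← Real.rpow_neg_one]
    exact Real.rpow_le_rpow_of_exponent_le ht1 (by norm_num)
  rw [hcorr, Real.norm_eq_abs]
  calc _ ≤ |Y / X - g| + |g - Real.exp (-‖r‖ ^ 2 / (8 * t))| := abs_sub_le _ _ _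
    _ ≤ _ := (add_le_add b2 b3).trans_eq (by ring)

theorem exists_isSmallness {a b c : ℝ} (ha : 0 < a) (hb : 0 < b) (hc : 0 < c) :
    ∃ η, IsSmallness a b c η := by
  have hL : 0 ≤ reactionConst b c := by unfold reactionConst; positivity
  set L := reactionConst b c with hLdef
  have h1 : min (1 / 2) (a / (16 * (L + 1))) ≤ 1 / 2 := min_le_left _ _
  have h2 : min (1 / 2) (a / (16 * (L + 1))) * (16 * (L + 1)) ≤ a := by
    rw [← le_div_iff₀ (by positivity)]
    exact min_le_right _ _
  have h3 : 0 < min (1 / 2) (a / (16 * (L + 1))) := lt_min (by norm_num) (by positivity)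
  exact ⟨_, ha, hb, hc, h3, by linarith, by rw [← hLdef]; nlinarith⟩

end

end QTensor
end

/-! ### Assembly of the theorem -/

open MeasureTheory Set Filter Topology
open scoped ENNReal ContDiff
open QTensor
theorem theorem4p4 (δ : ℝ) (hδ : 0 < δ) (a b c : ℝ) (habc : (a, b, c) ∈ bistableRegion) :
    ∃ η : ℝ, 0 < η ∧
      (∀ Q₀ ∈ smallData δ η,
        IsWellPosedAt a b c Q₀ ∧ ∃! A : Sym0, IsCoefficientMatrix δ a b c Q₀ A) ∧
      IsWeightedOpen δ (smallData δ η \ zeroCoefficientData δ η a b c) ∧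
      IsWeightedDenseIn δ (smallData δ η \ zeroCoefficientData δ η a b c) (smallData δ η) ∧
      ∀ μ₀ : Measure H, IsProbabilityMeasure μ₀ →
        (∀ᵐ Q₀ ∂μ₀, Q₀ ∈ smallData δ η \ zeroCoefficientData δ η a b c) →
        (∀ t : ℝ, 0 ≤ t → AEMeasurable (solutionMap a b c t) μ₀ ∧
          Integrable onePoint (statSolution a b c μ₀ t) ∧
          ∀ r : E3, Integrable (twoPoint r) (statSolution a b c μ₀ t)) ∧
        ∃ C T : ℝ, 0 < C ∧ 0 < T ∧ ∀ t : ℝ, T ≤ t →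
          0 < ∫ Q, onePoint Q ∂(statSolution a b c μ₀ t) ∧
          eLpNorm (fun r : E3 => correlation a b c μ₀ r t - Real.exp (-‖r‖ ^ 2 / (8 * t)))
            ∞ volume ≤ ENNReal.ofReal (C * t ^ (-(1 / 2) : ℝ)) := by
  obtain ⟨η, hη⟩ := exists_isSmallness habc.1 habc.2.1 habc.2.2.1
  refine ⟨η, hη.pos, fun Q hQ => ?_, isWeightedOpen_smallData_diff hδ hη,
    isWeightedDenseIn_smallData_diff hδ hη, fun μ hμp hμ => ⟨fun t ht => ?_, ?_⟩⟩
  · obtain ⟨R, w, hr⟩ := exists_isRepresentation hδ hη hQ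
    exact ⟨hr.isWellPosedAt (by linarith) hη, _, hr.isCoefficientMatrix hδ hη,
      fun A hA => isCoefficientMatrix_unique hA (hr.isCoefficientMatrix hδ hη)⟩
  · have hμs := hμ.mono fun Q hQ => hQ.1
    refine ⟨aemeasurable_solutionMap hδ hη hμs ht, ?_,
      integrable_twoPoint_statSolution hδ hη hμs ht⟩
    rw [onePoint_eq]
    exact integrable_twoPoint_statSolution hδ hη hμs ht 0
  · exact exists_correlation_bound hδ hη hμ
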